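/- Let $m,p\ge 1$ and let $a_n,b_n$ ($n\in\mathbb Z$) be $p$-periodic sequences of real $m\times m$ matrices with $b_n=b_n^\top$ and $\det a_n\neq 0$. Let $\mathcal J$ be the Jacobi operator $(\mathcal Jy)_n=a_ny_{n+1}+b_ny_n+a_{n-1}^\top y_{n-1}$ on $\ell^2(\mathbb Z)^m$. For $z\in\mathbb C$ let $\varphi_n(z),\vartheta_n(z)$ be the $m\times m$ matrix solutions of $a_ny_{n+1}+b_ny_n+a_{n-1}^\top y_{n-1}=zy_n$ with $\varphi_0=\vartheta_1=0$, $\varphi_1=\vartheta_0=I_m$, and put $$\mathscr M_p=\begin{pmatrix}\vartheta_p&\varphi_p\\ \vartheta_{p+1}&\varphi_{p+1}\end{pmatrix},\quad M=P_0\mathscr M_pP_0^{-1},\quad P_0=a_0^\top\oplus I_m,\quad D(z,\tau)=\det(M(z)-\tau I_{2m}).$$ The eigenvalues of $M(z)$ (the multipliers), counted with algebraic multiplicity, have the form $\tau_j(z)^{\pm1}$, $j\in\{1,\dots,m\}$; the Lyapunov functions are $\Delta_j=\frac12(\tau_j+\tau_j^{-1})$. A gap is a bounded interval $(\alpha,\beta)\subset\mathbb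 R\setminus\sigma(\mathcal J)$ with $\alpha<\beta$ and $\alpha,\beta\in\sigma(\mathcal J)$. A number $z$ is a periodic (anti-periodic) eigenvalue if the equation above has a solution $(y_n)\neq0$ in $\mathbb C^m$ with $y_{n+p}=y_n$ (respectively $y_{n+p}=-y_n$) for all $n\in\mathbb Z$. A $q$-sheeted Riemann surface is a connected Riemann surface $\mathscr R$ with a proper holomorphic map $\pi:\mathscr R\to\mathbb C$ such that $\pi^{-1}(z)$ has exactly $q$ points for all but finitely many $z$; a point $z$ is a branch point if $\pi$ is not injective near some point of $\pi^{-1}(z)$. Let $\tau_1^0,\dots,\tau_m^0$ be the eigenvalues, listed with algebraic multiplicity in any order, of $A_p=(a_1a_2\cdots a_p)^{-1}$. Then the multipliers can be numbered, at each $z\in\mathbb C$, as $\tau_j(z)^{\pm1}$, and there are $p_0\le m$, a partition of $\{1,\dots,m\}$ into nonempty disjoint sets $\omega_1,\dots,\omega_{p_0}$, polynomials $\Phi_s(z,\nu)$, and holomorphic functions $\widetilde\Delta_s$ on $p_s$-sheeted Riemann surfaces $\mathscr R_s$, $p_s=\#\omega_s$, such that the following hold. i) The branches of $\widetilde\Delta_s$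 are the $\Delta_j$ with $j\in\omega_s$: for every $z$ the set of values of $\widetilde\Delta_s$ at the points of $\mathscr R_s$ over $z$ is $\{\Delta_j(z):j\in\omega_s\}$, and for all but finitely many $z$ the values at different points over $z$ are different. For all $z,\nu,\tau\in\mathbb C$ with $\tau\ne0$, $$\frac{D(z,\tau)}{(2\tau)^m}=\prod_{s=1}^{p_0}\Phi_s\Bigl(z,\frac{\tau+\tau^{-1}}2\Bigr),\qquad \Phi_s(z,\nu)=\prod_{j\in\omega_s}(\nu-\Delta_j(z)).$$ If $\Delta_i=\Delta_j$ on an infinite set of points $z$ for some $i\in\omega_k$, $j\in\omega_s$, then $\Phi_k=\Phi_s$ and $\widetilde\Delta_k=\widetilde\Delta_s$ (with $\mathscr R_k=\mathscr R_s$). ii) Let $\delta$ be a real analytic function on an interval $Y=(\alpha,\beta)\subset\mathbb R$ which is a branch of the Lyapunov functions (that is, $\delta(x)\in\{\Delta_1(x),\dots,\Delta_m(x)\}$ for each $x\in Y$), and let $-1<\delta<1$ on $Y$. Then $\delta'(x)\ne0$ for each $x\in Y$. iii) The functions $\rho_s(z)=\prod_{i<j,\ i,j\in\omega_s}(\Delta_i(z)-\Delta_j(z))^2$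 (with $\rho_s=1$ if $\#\omega_s=1$) and $\rho=\prod_{s=1}^{p_0}\rho_s$ are polynomials. iv) Each endpoint of a gap is a periodic eigenvalue, or an anti-periodic eigenvalue, or a branch point of some $\mathscr R_s$ (a real branch point of some $\Delta_j$) that is a zero of $\rho$. v) As $|z|\to\infty$, for all $j\in\{1,\dots,m\}$ and $s\in\{1,\dots,p_0\}$, $$\Delta_j(z)=\frac{z^p}2\bigl(\tau_j^0+O(|z|^{-1/m})\bigr),\qquad \tau_j(z)=z^p\bigl(\tau_j^0+O(|z|^{-1/m})\bigr),$$ $$\rho_s(z)=z^{p\,\#\omega_s(\#\omega_s-1)}\bigl(c_s+O(|z|^{-1/m})\bigr),\qquad c_s=2^{\#\omega_s(1-\#\omega_s)}\prod_{k<j,\ k,j\in\omega_s}(\tau_k^0-\tau_j^0)^2 .$$ Moreover, if $\tau_j^0\neq\tau_k^0$ for all $j\ne k$ in $\omega_s$, then $c_s\ne0$ and $\rho_s(z)=z^{p\,\#\omega_s(\#\omega_s-1)}\bigl(c_s+O(|z|^{-1})\bigr)$. -/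

import Mathlib

open Polynomial Filter Topology Asymptotics
open scoped Polynomial.Bivariate Manifold ContDiff ENNReal

noncomputable section

/-- The coefficients of a `p`-periodic Jacobi operator whose entries are real `m × m` matrices. -/
structure PeriodicJacobi (m p : ℕ) where
  m_pos : 1 ≤ m
  p_pos : 1 ≤ p
  a : ℤ → Matrix (Fin m) (Fin m) ℝ
  b : ℤ → Matrix (Fin m) (Fin m) ℝ
  a_periodic : ∀ n, a (n + p) = a n
  b_periodic : ∀ n, b (n + p) = b n
  b_symm : ∀ n, (b n).transpose = b n
  det_a_ne_zero : ∀ n, (a n).det ≠ 0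

/-- The Hilbert space `ℓ²(ℤ)^m = ℓ²(ℤ; ℂ^m)`. -/
abbrev EllTwo (m : ℕ) : Type := lp (fun _ : ℤ => EuclideanSpace ℂ (Fin m)) 2

theorem memlp_shift_mul {m : ℕ} (c : ℤ → Matrix (Fin m) (Fin m) ℂ) (C : ℝ)
    (hC : ∀ n, ‖Matrix.toEuclideanCLM (𝕜 := ℂ) (c n)‖ ≤ C) (k : ℤ) (y : EllTwo m) :
    Memℓp (fun n : ℤ => Matrix.toEuclideanCLM (𝕜 := ℂ) (c n) (y (n + k))) 2 := by
  have h2 : (0 : ℝ) < (2 : ℝ≥0∞).toReal := by norm_num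
  have hC0 : 0 ≤ C := (norm_nonneg _).trans (hC 0)
  have hs : Summable fun n : ℤ => ‖y (n + k)‖ ^ (2 : ℝ≥0∞).toReal :=
    (Equiv.addRight k).summable_iff.mpr ((lp.memℓp y).summable h2)
  refine memℓp_gen (Summable.of_nonneg_of_le (fun n => by positivity) (fun n => ?_)
    (hs.mul_left (C ^ (2 : ℝ≥0∞).toReal)))
  rw [← Real.mul_rpow hC0 (norm_nonneg _)]
  refine Real.rpow_le_rpow (norm_nonneg _) ?_ h2.le
  exact (ContinuousLinearMap.le_opNorm _ _).trans
    (mul_le_mul_of_nonneg_right (hC n) (norm_nonneg _))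

/-- For a bounded sequence of matrices `c n`, the bounded operator
`(y n) ↦ (c n * y (n + k))` on `ℓ²(ℤ)^m`. -/
def shiftMul {m : ℕ} (c : ℤ → Matrix (Fin m) (Fin m) ℂ)
    (hc : ∃ C : ℝ, ∀ n, ‖Matrix.toEuclideanCLM (𝕜 := ℂ) (c n)‖ ≤ C) (k : ℤ) :
    EllTwo m →L[ℂ] EllTwo m :=
  LinearMap.mkContinuousOfExistsBound
    { toFun := fun y => ⟨fun n : ℤ => Matrix.toEuclideanCLM (𝕜 := ℂ) (c n) (y (n + k)),
        memlp_shift_mul c hc.choose hc.choose_spec k y⟩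
      map_add' := fun x y => by
        ext1; funext n
        simp only [lp.coeFn_add, Pi.add_apply, map_add]
      map_smul' := fun t y => by
        ext1; funext n
        simp only [lp.coeFn_smul, Pi.smul_apply, map_smul, RingHom.id_apply] }
    (by
      obtain ⟨C, hC⟩ := hc
      have hC0 : 0 ≤ C := (norm_nonneg _).trans (hC 0)
      have h2 : (0 : ℝ) < (2 : ℝ≥0∞).toReal := by norm_num
      refine ⟨C, fun y => lp.norm_le_of_forall_sum_le h2 (by positivity) fun s => ?_⟩
      have hs : Summable fun n : ℤ => ‖y (n + k)‖ ^ (2 : ℝ≥0∞).toReal :=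
        (Equiv.addRight k).summable_iff.mpr ((lp.memℓp y).summable h2)
      have ht : ∑' n : ℤ, ‖y (n + k)‖ ^ (2 : ℝ≥0∞).toReal = ‖y‖ ^ (2 : ℝ≥0∞).toReal := by
        rw [lp.norm_rpow_eq_tsum h2 y]
        exact (Equiv.addRight k).tsum_eq fun n => ‖y n‖ ^ (2 : ℝ≥0∞).toReal
      rw [Real.mul_rpow hC0 (norm_nonneg _), ← ht]
      calc ∑ n ∈ s, ‖Matrix.toEuclideanCLM (𝕜 := ℂ) (c n) (y (n + k))‖ ^ (2 : ℝ≥0∞).toReal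
          ≤ ∑ n ∈ s, C ^ (2 : ℝ≥0∞).toReal * ‖y (n + k)‖ ^ (2 : ℝ≥0∞).toReal := by
            refine Finset.sum_le_sum fun n _ => ?_
            rw [← Real.mul_rpow hC0 (norm_nonneg _)]
            refine Real.rpow_le_rpow (norm_nonneg _) ?_ h2.le
            exact (ContinuousLinearMap.le_opNorm _ _).trans
              (mul_le_mul_of_nonneg_right (hC n) (norm_nonneg _))
        _ = C ^ (2 : ℝ≥0∞).toReal * ∑ n ∈ s, ‖y (n + k)‖ ^ (2 : ℝ≥0∞).toReal := by
            rw [Finset.mul_sum]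
        _ ≤ _ := by
            refine mul_le_mul_of_nonneg_left ?_ (by positivity)
            exact hs.sum_le_tsum s fun n _ => by positivity)

theorem shiftMul_apply {m : ℕ} (c : ℤ → Matrix (Fin m) (Fin m) ℂ)
    (hc : ∃ C : ℝ, ∀ n, ‖Matrix.toEuclideanCLM (𝕜 := ℂ) (c n)‖ ≤ C) (k : ℤ)
    (y : EllTwo m) (n : ℤ) :
    shiftMul c hc k y n = Matrix.toEuclideanCLM (𝕜 := ℂ) (c n) (y (n + k)) := rfl

theorem bounded_of_periodic {m p : ℕ} (hp : 1 ≤ p) (c : ℤ → Matrix (Fin m) (Fin m) ℂ)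
    (hc : ∀ n, c (n + p) = c n) :
    ∃ C : ℝ, ∀ n, ‖Matrix.toEuclideanCLM (𝕜 := ℂ) (c n)‖ ≤ C := by
  have hper : Function.Periodic c (p : ℤ) := hc
  refine ⟨∑ j ∈ Finset.Ico (0 : ℤ) p, ‖Matrix.toEuclideanCLM (𝕜 := ℂ) (c j)‖, fun n => ?_⟩
  have hp0 : (0 : ℤ) < p := by exact_mod_cast hp
  have h1 : c n = c (n % p) := by
    conv_lhs => rw [← Int.emod_add_mul_ediv n p, mul_comm]
    simpa using hper.int_mul (n / p) (n % p)
  rw [h1]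
  exact Finset.single_le_sum
    (f := fun j : ℤ => ‖Matrix.toEuclideanCLM (𝕜 := ℂ) (c j)‖)
    (fun j _ => norm_nonneg _)
    (Finset.mem_Ico.mpr ⟨Int.emod_nonneg _ hp0.ne', Int.emod_lt_of_pos _ hp0⟩)

namespace PeriodicJacobi

/-- The matrix `a n`, with its entries regarded as complex numbers. -/
def aC {m p : ℕ} (J : PeriodicJacobi m p) (n : ℤ) : Matrix (Fin m) (Fin m) ℂ :=
  (J.a n).map Complex.ofReal

/-- The matrix `b n`, with its entries regarded as complex numbers. -/
def bC {m p : ℕ} (J : PeriodicJacobi m p) (n : ℤ) : Matrix (Fin m) (Fin m) ℂ :=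
  (J.b n).map Complex.ofReal

theorem aC_periodic {m p : ℕ} (J : PeriodicJacobi m p) (n : ℤ) : J.aC (n + p) = J.aC n := by
  rw [aC, aC, J.a_periodic]

theorem bC_periodic {m p : ℕ} (J : PeriodicJacobi m p) (n : ℤ) : J.bC (n + p) = J.bC n := by
  rw [bC, bC, J.b_periodic]

/-- The Jacobi operator `(𝒥 y) n = a n * y (n + 1) + b n * y n + (a (n - 1))ᵀ * y (n - 1)`
on `ℓ²(ℤ)^m`. -/
def operator {m p : ℕ} (J : PeriodicJacobi m p) : EllTwo m →L[ℂ] EllTwo m :=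
  shiftMul J.aC (bounded_of_periodic J.p_pos _ J.aC_periodic) 1
    + shiftMul J.bC (bounded_of_periodic J.p_pos _ J.bC_periodic) 0
    + shiftMul (fun n => (J.aC (n - 1)).transpose)
        (bounded_of_periodic J.p_pos _ fun n => by
          rw [show n + (p : ℤ) - 1 = n - 1 + p by ring, J.aC_periodic]) (-1)

theorem operator_apply {m p : ℕ} (J : PeriodicJacobi m p) (y : EllTwo m) (n : ℤ) :
    J.operator y n =
      Matrix.toEuclideanCLM (𝕜 := ℂ) (J.aC n) (y (n + 1))
        + Matrix.toEuclideanCLM (𝕜 := ℂ) (J.bC n) (y n)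
        + Matrix.toEuclideanCLM (𝕜 := ℂ) (J.aC (n - 1)).transpose (y (n - 1)) := by
  simp [operator, shiftMul_apply, sub_eq_add_neg]

/-- `(α, β)` is a gap: a bounded maximal open interval in the complement of the spectrum of the
Jacobi operator that separates two parts of the spectrum. -/
def IsGap {m p : ℕ} (J : PeriodicJacobi m p) (α β : ℝ) : Prop :=
  α < β ∧ (α : ℂ) ∈ spectrum ℂ J.operator ∧ (β : ℂ) ∈ spectrum ℂ J.operator ∧
    ∀ x ∈ Set.Ioo α β, (x : ℂ) ∉ spectrum ℂ J.operator

/-- `y : ℤ → ℂ^m` solves `a n * y (n + 1) + b n * y n + (a (n - 1))ᵀ * y (n - 1) = z * y n`. -/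
def IsSolution {m p : ℕ} (J : PeriodicJacobi m p) (z : ℂ) (y : ℤ → Fin m → ℂ) : Prop :=
  ∀ n : ℤ, (J.aC n).mulVec (y (n + 1)) + (J.bC n).mulVec (y n)
    + (J.aC (n - 1)).transpose.mulVec (y (n - 1)) = z • y n

/-- `z` is a periodic eigenvalue: there is a nonzero `p`-periodic solution. -/
def IsPeriodicEigenvalue {m p : ℕ} (J : PeriodicJacobi m p) (z : ℂ) : Prop :=
  ∃ y : ℤ → Fin m → ℂ, y ≠ 0 ∧ J.IsSolution z y ∧ ∀ n, y (n + p) = y n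

/-- `z` is an anti-periodic eigenvalue: there is a nonzero `p`-anti-periodic solution. -/
def IsAntiperiodicEigenvalue {m p : ℕ} (J : PeriodicJacobi m p) (z : ℂ) : Prop :=
  ∃ y : ℤ → Fin m → ℂ, y ≠ 0 ∧ J.IsSolution z y ∧ ∀ n, y (n + p) = -y n

/-- The matrix solution `Y 0, Y 1, Y 2, …` of
`a n * Y (n + 1) + b n * Y n + (a (n - 1))ᵀ * Y (n - 1) = z • Y n` (`n ≥ 1`)
with prescribed initial values `Y 0` and `Y 1`. -/
def matSol {m p : ℕ} (J : PeriodicJacobi m p) (z : ℂ) (Y0 Y1 : Matrix (Fin m) (Fin m) ℂ) :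
    ℕ → Matrix (Fin m) (Fin m) ℂ
  | 0 => Y0
  | 1 => Y1
  | n + 2 => (J.aC (n + 1))⁻¹ *
      ((z • (1 : Matrix (Fin m) (Fin m) ℂ) - J.bC (n + 1)) * matSol J z Y0 Y1 (n + 1)
        - (J.aC n).transpose * matSol J z Y0 Y1 n)

theorem matSol_solves {m p : ℕ} (J : PeriodicJacobi m p) (z : ℂ)
    (Y0 Y1 : Matrix (Fin m) (Fin m) ℂ) (n : ℕ) :
    J.aC (n + 1) * J.matSol z Y0 Y1 (n + 2) + J.bC (n + 1) * J.matSol z Y0 Y1 (n + 1)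
      + (J.aC n).transpose * J.matSol z Y0 Y1 n = z • J.matSol z Y0 Y1 (n + 1) := by
  have hu : IsUnit (J.aC (n + 1)).det := by
    have h : (J.aC (n + 1)).det = Complex.ofReal ((J.a (n + 1)).det) :=
      (RingHom.map_det Complex.ofRealHom (J.a (n + 1))).symm
    rw [h]
    exact (Complex.ofReal_ne_zero.mpr (J.det_a_ne_zero _)).isUnit
  rw [matSol, Matrix.mul_nonsing_inv_cancel_left _ _ hu, sub_mul, Matrix.smul_mul, Matrix.one_mul]
  abel

/-- The fundamental solution `φ` with `φ 0 = 0`, `φ 1 = 1`. -/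
def phi {m p : ℕ} (J : PeriodicJacobi m p) (z : ℂ) : ℕ → Matrix (Fin m) (Fin m) ℂ :=
  J.matSol z 0 1

/-- The fundamental solution `ϑ` with `ϑ 0 = 1`, `ϑ 1 = 0`. -/
def theta {m p : ℕ} (J : PeriodicJacobi m p) (z : ℂ) : ℕ → Matrix (Fin m) (Fin m) ℂ :=
  J.matSol z 1 0

/-- The monodromy matrix, of size `2m × 2m`. -/
def monodromy {m p : ℕ} (J : PeriodicJacobi m p) (z : ℂ) :
    Matrix (Fin m ⊕ Fin m) (Fin m ⊕ Fin m) ℂ :=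
  Matrix.fromBlocks (J.theta z p) (J.phi z p) (J.theta z (p + 1)) (J.phi z (p + 1))

/-- The matrix `P₀ = (a 0)ᵀ ⊕ 1`. -/
def P₀ {m p : ℕ} (J : PeriodicJacobi m p) : Matrix (Fin m ⊕ Fin m) (Fin m ⊕ Fin m) ℂ :=
  Matrix.fromBlocks (J.aC 0).transpose 0 0 1

/-- The modified monodromy matrix `M(z)`, conjugate to the monodromy matrix. -/
def M {m p : ℕ} (J : PeriodicJacobi m p) (z : ℂ) :
    Matrix (Fin m ⊕ Fin m) (Fin m ⊕ Fin m) ℂ :=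
  J.P₀ * J.monodromy z * J.P₀⁻¹

/-- The determinant `D(z, τ) = det (M(z) - τ)`. -/
def D {m p : ℕ} (J : PeriodicJacobi m p) (z τ : ℂ) : ℂ :=
  (J.M z - τ • (1 : Matrix (Fin m ⊕ Fin m) (Fin m ⊕ Fin m) ℂ)).det

/-- The matrix `A_p = (a 1 * a 2 * ⋯ * a p)⁻¹`. -/
def A {m p : ℕ} (J : PeriodicJacobi m p) : Matrix (Fin m) (Fin m) ℂ :=
  (((List.range p).map fun k : ℕ => J.aC ((k : ℤ) + 1)).prod)⁻¹

end PeriodicJacobi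

/-- A holomorphic function `fn` on a connected Riemann surface that is spread over the plane by a
proper holomorphic map `proj` (a branched covering). -/
structure FunctionOnCover where
  carrier : Type
  [topology : TopologicalSpace carrier]
  [t2 : T2Space carrier]
  [connected : ConnectedSpace carrier]
  [charted : ChartedSpace ℂ carrier]
  [complexManifold : IsManifold 𝓘(ℂ) ω carrier]
  proj : carrier → ℂ
  proj_holomorphic : MDifferentiable 𝓘(ℂ) 𝓘(ℂ) proj
  proj_proper : IsProperMap proj
  fn : carrier → ℂ
  fn_holomorphic : MDifferentiable 𝓘(ℂ) 𝓘(ℂ) fn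

attribute [instance] FunctionOnCover.topology FunctionOnCover.t2 FunctionOnCover.connected
  FunctionOnCover.charted FunctionOnCover.complexManifold

namespace FunctionOnCover

/-- The points of the surface over `z`. -/
def fiber (S : FunctionOnCover) (z : ℂ) : Set S.carrier := {x | S.proj x = z}

/-- The surface has `n` sheets: all but finitely many points of the plane (the exceptions being the
projections of the branch points) have exactly `n` preimages. -/
def HasSheets (S : FunctionOnCover) (n : ℕ) : Prop :=
  {z : ℂ | (S.fiber z).encard ≠ n}.Finite

/-- `z` is a branch point: over `z` there is a point of the surface near which the projection is
not one-to-one. -/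
def IsBranchPoint (S : FunctionOnCover) (z : ℂ) : Prop :=
  ∃ x ∈ S.fiber z, ∀ U ∈ 𝓝 x, ¬ Set.InjOn S.proj U

end FunctionOnCover

/-- The product of `(Δ i z - Δ j z) ^ 2` over all `i < j` in `w`. It is `1` if `w` is a
singleton. -/
def discrProd {m : ℕ} (Δ : Fin m → ℂ → ℂ) (w : Finset (Fin m)) (z : ℂ) : ℂ :=
  ∏ q ∈ (w ×ˢ w).filter (fun q => q.1 < q.2), (Δ q.1 z - Δ q.2 z) ^ 2

end

/-!
Everything is read off from one bivariate polynomial. The monodromy matrix `M z` is symplectic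
(`PeriodicJacobi.M_mem_symplecticGroup`), so its characteristic polynomial is palindromic and
equals `(2 * t) ^ m * F (z, (t + t⁻¹) / 2)` for the monic polynomial `F = J.lyapunovPoly` of degree
`m` (`PeriodicJacobi.eval_charpoly_M`). The Lyapunov functions are the roots of `F (z, ·)`, the
polynomials `Φ s` are the monic irreducible factors of `F`, and the discriminants are polynomials
because they are resultants, up to a sign.

*Riemann surfaces.* The surface of an irreducible factor `Φ` is the set of `ℂ`-points of the
integral closure `B` of `ℂ[X]` in the field `ℂ(X)[Y] / (Φ)`, that is, the normalization of the plane
curve `Φ = 0` (`exists_functionOnCover`). As `B` is a Dedekind domain, its local rings have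
uniformizers, which are charts by the implicit function theorem; the projection is proper because
the elements of `B` are integral over `ℂ[X]`. For the connectedness, a clopen set defines by
interpolation a polynomial which is entire of polynomial growth in `z`, and which vanishes on the
curve or agrees there with a nonzero multiple of `∂Φ/∂Y`, because `B` is a domain.

*Spectrum.* The number `z` lies in the spectrum exactly if `F (z, d) = 0` for some `d ∈ [-1, 1]`,
i.e. if some multiplier is unimodular (`PeriodicJacobi.mem_spectrum_iff`). A unimodular multiplier
gives a bounded Floquet solution, whose truncations show that `z - J` is not bounded below.
Conversely, modulo the left ideal generated by `J - z`, the shift by a period acts on the universal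
solution of the difference equation as the monodromy matrix; by the Cayley-Hamilton theorem, and
because the shift is unitary, this solution vanishes if no multiplier is unimodular, and then
`J - z` is left invertible, hence invertible.

*Branches.* Since `J` is self-adjoint, `F (z, d) = 0` with `d ∈ [-1, 1]` forces `z` to be real.
If a holomorphic branch had a critical point at a real point where its value lies in `(-1, 1)`,
it would be real at nonreal points nearby; hence its derivative does not vanish
(`RealOnInterval.deriv_ne_zero`), its local inverse is real, and a real neighbourhood of the point
lies in the spectrum (`RealOnInterval.eventually_exists`). So an endpoint of a gap is a branch
point, unless the value there is `1` or `-1`.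

*Infinity.* The matrices `z ^ (-p) • monodromy z` tend to `0 ⊕ J.A`, so the roots of `F (z, ·)` are
`O (z ^ p)`. After rescaling, the coefficients of the factors are polynomials in `z⁻¹`, hence
converge with an error `O (z⁻¹)`, and the roots converge with an error `O (|z| ^ (-1 / m))`
(`PeriodicJacobi.exists_lyapunov_numbering`).
-/

noncomputable section

set_option linter.unusedSectionVars false
set_option linter.overlappingInstances false

/-! ### Roots of monic bivariate polynomials -/

theorem Polynomial.norm_le_of_monic_of_isRoot {q : ℂ[X]} (hq : q.Monic) {y : ℂ}
    (hy : q.eval y = 0) : ‖y‖ ≤ 1 + ∑ i ∈ Finset.range q.natDegree, ‖q.coeff i‖ := by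
  have h := (IsRoot.norm_lt_cauchyBound hq.ne_zero (a := y) hy).le
  have h2 : cauchyBound q ≤ 1 + ∑ i ∈ Finset.range q.natDegree, ‖q.coeff i‖₊ := by
    rw [cauchyBound, hq.leadingCoeff, nnnorm_one, div_one, add_comm]
    gcongr
    exact Finset.sup_le fun i hi =>
      Finset.single_le_sum (f := fun i => ‖q.coeff i‖₊) (fun _ _ => bot_le) hi
  have h3 := NNReal.coe_le_coe.mpr (h.trans h2)
  push_cast at h3
  exact h3

/-- An explicit bound for the roots of `Φ (z, ·)`, continuous in `z`. -/
def rootBound (Φ : ℂ[X][Y]) (z : ℂ) : ℝ :=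
  1 + ∑ i ∈ Finset.range Φ.natDegree, ‖(Φ.coeff i).eval z‖

theorem continuous_rootBound (Φ : ℂ[X][Y]) : Continuous (rootBound Φ) := by
  unfold rootBound; fun_prop

theorem norm_le_rootBound {Φ : ℂ[X][Y]} (hΦ : Φ.Monic) {z y : ℂ} (h : Φ.evalEval z y = 0) :
    ‖y‖ ≤ rootBound Φ z := by
  rw [← map_evalRingHom_eval] at h
  simpa [rootBound, hΦ.natDegree_map] using norm_le_of_monic_of_isRoot (hΦ.map _) h

/-! ### The points of an integral curve -/

/-- The `ℂ`-points of the affine curve with coordinate ring `B`. -/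
def CurvePoint (B : Type) [CommRing B] [Algebra ℂ B] : Type := B →ₐ[ℂ] ℂ

namespace CurvePoint

section Basic

variable {B : Type} [CommRing B] [Algebra ℂ B]

instance : FunLike (CurvePoint B) B ℂ := inferInstanceAs (FunLike (B →ₐ[ℂ] ℂ) B ℂ)

instance : AlgHomClass (CurvePoint B) ℂ B ℂ := inferInstanceAs (AlgHomClass (B →ₐ[ℂ] ℂ) ℂ B ℂ)

@[ext] theorem ext {P Q : CurvePoint B} (h : ∀ b, P b = Q b) : P = Q := DFunLike.ext _ _ h

/-- The weakest topology for which every element of `B` is a continuous function. -/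
instance : TopologicalSpace (CurvePoint B) :=
  TopologicalSpace.induced (fun P b => P b) (inferInstanceAs (TopologicalSpace (B → ℂ)))

theorem isInducing_coe : IsInducing (fun (P : CurvePoint B) (b : B) => P b) := ⟨rfl⟩

theorem continuous_apply (b : B) : Continuous fun P : CurvePoint B => P b :=
  (_root_.continuous_apply b).comp isInducing_coe.continuous

theorem continuousOn_iff {α : Type*} [TopologicalSpace α] {f : α → CurvePoint B} {s : Set α} :
    ContinuousOn f s ↔ ∀ b, ContinuousOn (fun a => f a b) s := by
  rw [isInducing_coe.continuousOn_iff, continuousOn_pi]; rfl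

theorem tendsto_iff {α : Type*} {l : Filter α} {f : α → CurvePoint B} {P : CurvePoint B} :
    Tendsto f l (𝓝 P) ↔ ∀ b, Tendsto (fun a => f a b) l (𝓝 (P b)) := by
  rw [isInducing_coe.tendsto_nhds_iff, tendsto_pi_nhds]; rfl

instance : T2Space (CurvePoint B) :=
  T2Space.of_injective_continuous (f := fun (P : CurvePoint B) (b : B) => P b)
    (fun _ _ h => ext (congrFun h)) isInducing_coe.continuous

end Basic

section Cover

variable {B : Type} [CommRing B] [Algebra ℂ B] [Algebra ℂ[X] B] [IsScalarTower ℂ ℂ[X] B]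

/-- The value at a point of the coordinate function `X`. -/
def proj (P : CurvePoint B) : ℂ := P (algebraMap ℂ[X] B X)

theorem continuous_proj : Continuous (proj : CurvePoint B → ℂ) := continuous_apply _

theorem apply_algebraMap (P : CurvePoint B) (q : ℂ[X]) :
    P (algebraMap ℂ[X] B q) = q.eval P.proj := by
  have h : (AlgHomClass.toAlgHom P).comp (IsScalarTower.toAlgHom ℂ ℂ[X] B)
      = Polynomial.aeval P.proj := by
    ext; simp [proj]
  simpa [Polynomial.coe_aeval_eq_eval] using DFunLike.congr_fun h q

theorem apply_aeval (P : CurvePoint B) (b : B) (Φ : ℂ[X][Y]) :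
    P (aeval b Φ) = Φ.evalEval P.proj (P b) := by
  rw [← map_evalRingHom_eval, eval_map, aeval_def]
  have h : (RingHomClass.toRingHom P).comp (algebraMap ℂ[X] B) = evalRingHom P.proj := by
    refine RingHom.ext fun q => ?_
    simpa using P.apply_algebraMap q
  rw [← h]
  exact hom_eval₂ Φ (algebraMap ℂ[X] B) (RingHomClass.toRingHom P) b

variable [IsDomain B] [Module.Finite ℂ[X] B] [FaithfulSMul ℂ[X] B]

/-- Lying over: a root of the minimal polynomial of `g` is a value of `g`. -/
theorem exists_point (g : B) {z y : ℂ} (h : (minpoly ℂ[X] g).evalEval z y = 0) :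
    ∃ P : CurvePoint B, P.proj = z ∧ P g = y := by
  have hg : IsIntegral ℂ[X] g := Algebra.IsIntegral.isIntegral g
  let : Algebra ℂ[X][Y] B := (aeval g : ℂ[X][Y] →ₐ[ℂ[X]] B).toRingHom.toAlgebra
  have hmap : ∀ q : ℂ[X][Y], algebraMap ℂ[X][Y] B q = aeval g q := fun _ => rfl
  have : IsScalarTower ℂ[X] ℂ[X][Y] B :=
    IsScalarTower.of_algebraMap_eq fun q => by rw [hmap, algebraMap_eq, aeval_C]
  have : Algebra.IsIntegral ℂ[X][Y] B := Algebra.IsIntegral.tower_top (R := ℂ[X])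
  have hsurj : Function.Surjective (evalEvalRingHom z y) := evalEval_surjective z y
  have : (RingHom.ker (evalEvalRingHom z y)).IsMaximal := RingHom.ker_isMaximal_of_surjective _ hsurj
  obtain ⟨𝔮, h𝔮, hcomap⟩ := Ideal.exists_ideal_over_maximal_of_isIntegral (S := B)
    (RingHom.ker (evalEvalRingHom z y)) (by
      intro q hq
      rw [RingHom.mem_ker, hmap] at hq
      obtain ⟨q', rfl⟩ := minpoly.isIntegrallyClosed_dvd hg hq
      rw [RingHom.mem_ker, map_mul, coe_evalEvalRingHom, h, zero_mul])
  let := Ideal.Quotient.field 𝔮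
  have : Algebra.FiniteType ℂ B :=
    Algebra.FiniteType.trans (S := ℂ[X]) inferInstance inferInstance
  have : Module.Finite ℂ (B ⧸ 𝔮) := finite_of_finite_type_of_isJacobsonRing ℂ (B ⧸ 𝔮)
  have hbij : Function.Bijective (algebraMap ℂ (B ⧸ 𝔮)) :=
    IsAlgClosed.algebraMap_bijective_of_isIntegral
  let e : ℂ ≃ₐ[ℂ] (B ⧸ 𝔮) := AlgEquiv.ofBijective (Algebra.ofId ℂ (B ⧸ 𝔮)) hbij
  let P : B →ₐ[ℂ] ℂ := (e.symm : (B ⧸ 𝔮) →ₐ[ℂ] ℂ).comp (Ideal.Quotient.mkₐ ℂ 𝔮)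
  have hP : ∀ (b : B) (c : ℂ), b - algebraMap ℂ B c ∈ 𝔮 → P b = c := by
    intro b c hbc
    have h1 : P (b - algebraMap ℂ B c) = 0 := by
      simp [P, Ideal.Quotient.eq_zero_iff_mem.mpr hbc]
    rwa [map_sub, AlgHom.commutes, sub_eq_zero] at h1
  have hmem : ∀ q : ℂ[X][Y], q.evalEval z y = 0 → aeval g q ∈ 𝔮 := by
    intro q hq
    have : q ∈ 𝔮.comap (algebraMap ℂ[X][Y] B) := by rw [hcomap]; exact hq
    exact this
  refine ⟨P, hP _ _ ?_, hP _ _ ?_⟩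
  · have := hmem (C (X - C z)) (by rw [evalEval_C]; simp)
    rw [aeval_C, map_sub] at this
    rwa [IsScalarTower.algebraMap_apply ℂ ℂ[X] B]
  · have := hmem (X - C (C y)) (by simp)
    rw [map_sub, aeval_X, aeval_C] at this
    rwa [IsScalarTower.algebraMap_apply ℂ ℂ[X] B]

theorem isIntegral_elem (b : B) : IsIntegral ℂ[X] b := Algebra.IsIntegral.isIntegral b

theorem norm_apply_le (P : CurvePoint B) (b : B) :
    ‖P b‖ ≤ rootBound (minpoly ℂ[X] b) P.proj := by
  refine norm_le_rootBound (minpoly.monic (isIntegral_elem b)) ?_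
  rw [← apply_aeval, minpoly.aeval, map_zero]

/-- Over a bounded set every element of `B` is bounded, so ultrafilters converge pointwise. -/
theorem isProperMap_proj : IsProperMap (proj : CurvePoint B → ℂ) := by
  rw [isProperMap_iff_ultrafilter_of_t2]
  refine ⟨continuous_proj, fun 𝒰 z hz => ?_⟩
  have hlim : ∀ b : B, ∃ l : ℂ, Tendsto (fun P : CurvePoint B => P b) 𝒰 (𝓝 l) := by
    intro b
    have h1 : Tendsto (fun P : CurvePoint B => rootBound (minpoly ℂ[X] b) P.proj) 𝒰
        (𝓝 (rootBound (minpoly ℂ[X] b) z)) :=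
      ((continuous_rootBound _).tendsto z).comp hz
    have h2 : ∀ᶠ P : CurvePoint B in 𝒰,
        P b ∈ Metric.closedBall (0 : ℂ) (rootBound (minpoly ℂ[X] b) z + 1) := by
      filter_upwards [h1.eventually_lt_const (lt_add_one _)] with P hP
      simpa using (P.norm_apply_le b).trans hP.le
    obtain ⟨l, -, hl⟩ := (isCompact_closedBall (0 : ℂ) _).ultrafilter_le_nhds
      (𝒰.map fun P : CurvePoint B => P b) (le_principal_iff.mpr h2)
    exact ⟨l, hl⟩
  choose L hL using hlim
  let P : B →ₐ[ℂ] ℂ :=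
    { toFun := L
      map_one' := tendsto_nhds_unique (hL 1) (by simp)
      map_zero' := tendsto_nhds_unique (hL 0) (by simp)
      map_add' := fun a b => tendsto_nhds_unique (hL (a + b)) (by simpa using (hL a).add (hL b))
      map_mul' := fun a b => tendsto_nhds_unique (hL (a * b)) (by simpa using (hL a).mul (hL b))
      commutes' := fun r => tendsto_nhds_unique (hL _) (by
        simp only [AlgHomClass.commutes]; exact tendsto_const_nhds) }
  exact ⟨P, tendsto_iff (f := id).mpr hL⟩

theorem eq_of_forall_generator {ι : Type*} {gen : ι → B}
    (hgen : Algebra.adjoin ℂ (Set.range gen) = ⊤) {P Q : CurvePoint B}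
    (h : ∀ i, P (gen i) = Q (gen i)) : P = Q := by
  have : (P : B →ₐ[ℂ] ℂ) = Q := by
    refine AlgHom.ext_of_adjoin_eq_top hgen ?_
    rintro _ ⟨i, rfl⟩
    exact h i
  exact this

theorem exists_generators : ∃ (r : ℕ) (gen : Fin r → B),
    Algebra.adjoin ℂ (Set.range gen) = ⊤ := by
  have h : Algebra.FiniteType ℂ B :=
    Algebra.FiniteType.trans (S := ℂ[X]) inferInstance inferInstance
  obtain ⟨s, hs⟩ := h.out
  refine ⟨s.card, fun i => s.equivFin.symm i, ?_⟩
  rw [← hs]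
  congr 1
  ext b
  simp only [Set.mem_range]
  exact ⟨by rintro ⟨i, rfl⟩; exact (s.equivFin.symm i).2,
    fun hb => ⟨s.equivFin ⟨b, hb⟩, by simp⟩⟩

theorem finite_fiber (z : ℂ) : {P : CurvePoint B | P.proj = z}.Finite := by
  obtain ⟨r, gen, hgen⟩ := exists_generators (B := B)
  have hfin : (Set.univ.pi fun i : Fin r =>
      {y : ℂ | (minpoly ℂ[X] (gen i)).evalEval z y = 0}).Finite := by
    refine Set.Finite.pi fun i => ?_
    have hm := (minpoly.monic (isIntegral_elem (gen i))).map (evalRingHom z)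
    refine (Multiset.finite_toSet ((minpoly ℂ[X] (gen i)).map (evalRingHom z)).roots).subset ?_
    intro y hy
    rw [Set.mem_ofPred_eq, ← map_evalRingHom_eval] at hy
    exact (mem_roots hm.ne_zero).mpr hy
  refine Set.Finite.of_finite_image (f := fun P i => P (gen i)) (hfin.subset ?_) ?_
  · rintro _ ⟨P, hP, rfl⟩ i -
    simp only [Set.mem_ofPred_eq]
    rw [← show P.proj = z from hP, ← apply_aeval, minpoly.aeval, map_zero]
  · intro P _ Q _ h
    exact eq_of_forall_generator hgen (congrFun h)

/-- A function vanishing at `P` and at no other point of the same fiber. -/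
theorem exists_separating (P : CurvePoint B) :
    ∃ g : B, P g = 0 ∧ ∀ Q : CurvePoint B, Q.proj = P.proj → Q g = 0 → Q = P := by
  classical
  have hF := finite_fiber (B := B) P.proj
  have hsep : ∀ Q : CurvePoint B, ∃ h : B, Q ≠ P → (P h = 1 ∧ Q h = 0) := by
    intro Q
    by_cases hQ : Q = P
    · exact ⟨0, fun h => absurd hQ h⟩
    · have : ∃ b, Q b ≠ P b := by
        by_contra! hcon
        exact hQ (ext hcon)
      obtain ⟨b, hb⟩ := this
      have hb' : P b - Q b ≠ 0 := sub_ne_zero.mpr (Ne.symm hb)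
      refine ⟨algebraMap ℂ B (P b - Q b)⁻¹ * (b - algebraMap ℂ B (Q b)), fun _ => ?_⟩
      simp [map_mul, map_sub, AlgHomClass.commutes]
      field_simp
  choose h hh using hsep
  refine ⟨1 - ∏ Q ∈ hF.toFinset.erase P, h Q, ?_, ?_⟩
  · rw [map_sub, map_one, map_prod, Finset.prod_eq_one, sub_self]
    intro Q hQ
    exact (hh Q (Finset.ne_of_mem_erase hQ)).1
  · intro Q hQP hQ
    by_contra hne
    rw [map_sub, map_one, map_prod, Finset.prod_eq_zero (i := Q) (by simp [hne, hQP]) (hh Q hne).2]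
      at hQ
    simp at hQ

/-- No point of the curve is isolated, even after finitely many fibers are discarded. -/
theorem frequently_proj_mem (P : CurvePoint B) {Z : Set ℂ} (hZ : Z ∈ 𝓝[≠] P.proj) :
    ∃ᶠ Q in 𝓝 P, Q.proj ∈ Z := by
  obtain ⟨g, hg0, hg⟩ := exists_separating P
  set μ := minpoly ℂ[X] g with hμ
  have hmon : μ.Monic := minpoly.monic (isIntegral_elem g)
  have hdeg : 0 < μ.natDegree := minpoly.natDegree_pos (isIntegral_elem g)
  have hc0 : (μ.coeff 0).eval P.proj = 0 := by
    have h1 : μ.evalEval P.proj (P g) = 0 := by rw [← apply_aeval, minpoly.aeval, map_zero]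
    rw [hg0, ← map_evalRingHom_eval, ← coeff_zero_eq_eval_zero, coeff_map] at h1
    exact h1
  -- the product of the roots of `μ (z, ·)` is small for `z` near `proj P`, hence so is some root
  have hroot : ∀ z : ℂ, ∃ Q : CurvePoint B, Q.proj = z ∧
      ‖Q g‖ ^ μ.natDegree ≤ ‖(μ.coeff 0).eval z‖ := by
    intro z
    have hmz := hmon.map (evalRingHom z)
    have hsp := IsAlgClosed.splits (μ.map (evalRingHom z))
    have : ∃ y ∈ (μ.map (evalRingHom z)).roots, ‖y‖ ^ μ.natDegree ≤ ‖(μ.coeff 0).eval z‖ := by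
      have hne : (μ.map (evalRingHom z)).roots.toFinset.Nonempty := by
        rw [Multiset.toFinset_nonempty, ← Multiset.card_pos, ← hsp.natDegree_eq_card_roots,
          hmon.natDegree_map]
        exact hdeg
      obtain ⟨y, hy, hmin⟩ := Finset.exists_min_image _ (fun y : ℂ => ‖y‖₊) hne
      refine ⟨y, Multiset.mem_toFinset.mp hy, ?_⟩
      have h1 := Multiset.pow_card_le_prod
        (s := (μ.map (evalRingHom z)).roots.map fun y => ‖y‖₊) (a := ‖y‖₊) (by
          intro x hx
          obtain ⟨w, hw, rfl⟩ := Multiset.mem_map.mp hx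
          exact hmin w (Multiset.mem_toFinset.mpr hw))
      have h2 : ((μ.map (evalRingHom z)).roots.map fun y => ‖y‖₊).prod
          = ‖(μ.coeff 0).eval z‖₊ := by
        have h3 := hsp.coeff_zero_eq_prod_roots_of_monic hmz
        rw [coeff_map, coe_evalRingHom] at h3
        rw [h3, nnnorm_mul, nnnorm_pow, nnnorm_neg, nnnorm_one, one_pow, one_mul]
        exact (map_multiset_prod (nnnormHom : ℂ →*₀ NNReal) _).symm
      rw [h2, Multiset.card_map, ← hsp.natDegree_eq_card_roots, hmon.natDegree_map] at h1
      exact_mod_cast h1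
    obtain ⟨y, hy, hle⟩ := this
    rw [mem_roots hmz.ne_zero, IsRoot.def, map_evalRingHom_eval] at hy
    obtain ⟨Q, hQ, rfl⟩ := exists_point g hy
    exact ⟨Q, hQ, hle⟩
  choose Q hQz hQg using hroot
  obtain ⟨𝒰, h𝒰⟩ := Ultrafilter.exists_le (𝓝[≠] P.proj)
  have hproj : Tendsto proj (𝒰.map Q : Filter (CurvePoint B)) (𝓝 P.proj) := by
    rw [Ultrafilter.coe_map, tendsto_map'_iff]
    have : proj ∘ Q = id := funext hQz
    rw [this]
    exact h𝒰.trans nhdsWithin_le_nhds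
  obtain ⟨P', hP', hle⟩ := isProperMap_proj.ultrafilter_le_nhds_of_tendsto hproj
  have hPP' : P' = P := by
    refine hg P' hP' ?_
    have h1 : Tendsto (fun z => Q z g) 𝒰 (𝓝 (P' g)) :=
      ((continuous_apply g).tendsto P').comp hle
    have h2 : Tendsto (fun z => ‖(μ.coeff 0).eval z‖) 𝒰 (𝓝 0) := by
      have : Tendsto (fun z => ‖(μ.coeff 0).eval z‖) (𝓝 P.proj) (𝓝 ‖(μ.coeff 0).eval P.proj‖) :=
        (μ.coeff 0).continuous.norm.tendsto _
      rw [hc0, norm_zero] at this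
      exact this.mono_left (h𝒰.trans nhdsWithin_le_nhds)
    have h3 : ‖P' g‖ ^ μ.natDegree ≤ 0 :=
      le_of_tendsto_of_tendsto (h1.norm.pow _) h2 (Eventually.of_forall hQg)
    have := le_antisymm h3 (by positivity)
    simpa using pow_eq_zero_iff hdeg.ne' |>.mp this
  subst hPP'
  have hev : ∀ᶠ R in (𝒰.map Q : Filter (CurvePoint B)), R.proj ∈ Z := by
    rw [Ultrafilter.coe_map, eventually_map]
    filter_upwards [h𝒰 hZ] with z hz
    rwa [hQz]
  exact hev.frequently.filter_mono hle

end Cover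

end CurvePoint

/-! ### Local coordinates -/

/-- An implicit function: the system `S i b * (b i - β i) = t * C i b` with `S i β ≠ 0` is solved
near `(0, β)` by a holomorphic curve `t ↦ b = γ t`. -/
theorem exists_implicit_curve {r : ℕ} (S C : Fin r → MvPolynomial (Fin r) ℂ) (β : Fin r → ℂ)
    (hS : ∀ i, MvPolynomial.eval β (S i) ≠ 0) :
    ∃ (N : Set (ℂ × (Fin r → ℂ))) (γ : ℂ → Fin r → ℂ) (ε : ℝ), IsOpen N ∧ 0 < ε ∧ (0, β) ∈ N ∧
      DifferentiableOn ℂ γ (Metric.ball 0 ε) ∧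
      (∀ w ∈ Metric.ball (0 : ℂ) ε, (w, γ w) ∈ N) ∧
      (∀ w b, (w, b) ∈ N →
        (∀ i, MvPolynomial.eval b (S i) * (b i - β i) = w * MvPolynomial.eval b (C i)) →
        b = γ w) := by
  have hpoly : ∀ q : MvPolynomial (Fin r) ℂ,
      ContDiff ℂ 1 fun x : ℂ × (Fin r → ℂ) => MvPolynomial.eval x.2 q := by
    intro q
    rw [contDiff_iff_contDiffAt]
    intro x
    exact (AnalyticAt.aeval_mvPolynomial (𝕜 := ℂ) (f := fun x : ℂ × (Fin r → ℂ) => x.2)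
      (fun i => ((ContinuousLinearMap.proj i).comp
        (ContinuousLinearMap.snd ℂ ℂ (Fin r → ℂ))).analyticAt x) q).contDiffAt
  set Θ : ℂ × (Fin r → ℂ) → ℂ × (Fin r → ℂ) := fun x => (x.1, fun i =>
    MvPolynomial.eval x.2 (S i) * (x.2 i - β i) - x.1 * MvPolynomial.eval x.2 (C i)) with hΘ
  have hcomp : ∀ i : Fin r, ContDiff ℂ 1 fun x : ℂ × (Fin r → ℂ) => x.2 i := fun i =>
    ((ContinuousLinearMap.proj i).comp (ContinuousLinearMap.snd ℂ ℂ (Fin r → ℂ))).contDiff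
  have hΘc : ContDiff ℂ 1 Θ := by
    refine contDiff_fst.prodMk (contDiff_pi.mpr fun i => ?_)
    exact ((hpoly _).mul ((hcomp i).sub contDiff_const)).sub (contDiff_fst.mul (hpoly _))
  let fwd : (ℂ × (Fin r → ℂ)) →L[ℂ] ℂ × (Fin r → ℂ) :=
    (ContinuousLinearMap.fst ℂ ℂ (Fin r → ℂ)).prod (ContinuousLinearMap.pi fun i =>
      MvPolynomial.eval β (S i) • ((ContinuousLinearMap.proj i).comp
        (ContinuousLinearMap.snd ℂ ℂ (Fin r → ℂ)))
      - MvPolynomial.eval β (C i) • ContinuousLinearMap.fst ℂ ℂ (Fin r → ℂ))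
  let bwd : (ℂ × (Fin r → ℂ)) →L[ℂ] ℂ × (Fin r → ℂ) :=
    (ContinuousLinearMap.fst ℂ ℂ (Fin r → ℂ)).prod (ContinuousLinearMap.pi fun i =>
      (MvPolynomial.eval β (S i))⁻¹ • ((ContinuousLinearMap.proj i).comp
        (ContinuousLinearMap.snd ℂ ℂ (Fin r → ℂ))
      + MvPolynomial.eval β (C i) • ContinuousLinearMap.fst ℂ ℂ (Fin r → ℂ)))
  let L : (ℂ × (Fin r → ℂ)) ≃L[ℂ] ℂ × (Fin r → ℂ) :=
    ContinuousLinearEquiv.equivOfInverse fwd bwd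
      (by
        rintro ⟨t, v⟩
        refine Prod.ext rfl (funext fun i => ?_)
        have := hS i
        simp [fwd, bwd]
        field_simp
        ring)
      (by
        rintro ⟨t, v⟩
        refine Prod.ext rfl (funext fun i => ?_)
        have := hS i
        simp [fwd, bwd]
        field_simp
        ring)
  have hder : HasFDerivAt Θ (L : (ℂ × (Fin r → ℂ)) →L[ℂ] ℂ × (Fin r → ℂ)) (0, β) := by
    refine (hasFDerivAt_fst).prodMk (hasFDerivAt_pi.mpr fun i => ?_)
    have h1 := ((hpoly (S i)).differentiable one_ne_zero (0, β)).hasFDerivAt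
    have h2 := ((hpoly (C i)).differentiable one_ne_zero (0, β)).hasFDerivAt
    have h3 : HasFDerivAt (fun x : ℂ × (Fin r → ℂ) => x.2 i - β i)
        ((ContinuousLinearMap.proj i).comp (ContinuousLinearMap.snd ℂ ℂ (Fin r → ℂ))) (0, β) :=
      ((ContinuousLinearMap.proj i).comp
        (ContinuousLinearMap.snd ℂ ℂ (Fin r → ℂ))).hasFDerivAt.sub_const _
    have h4 : HasFDerivAt (fun x : ℂ × (Fin r → ℂ) => x.1)
        (ContinuousLinearMap.fst ℂ ℂ (Fin r → ℂ)) (0, β) := hasFDerivAt_fst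
    refine ((h1.mul h3).sub (h4.mul h2)).congr_fderiv ?_
    refine ContinuousLinearMap.ext fun v => ?_
    simp
  have hΘ0 : Θ (0, β) = (0, 0) := by
    simp only [hΘ]; refine Prod.ext rfl (funext fun i => ?_); simp
  set R := hΘc.contDiffAt.toOpenPartialHomeomorph Θ hder one_ne_zero with hR
  have hRΘ : ∀ x, R x = Θ x := fun _ => rfl
  have hsrc : ((0 : ℂ), β) ∈ R.source :=
    hΘc.contDiffAt.mem_toOpenPartialHomeomorph_source hder one_ne_zero
  have htgt : ((0 : ℂ), (0 : Fin r → ℂ)) ∈ R.target := by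
    rw [← hΘ0]; exact R.map_source hsrc
  have hsymm : ContDiffAt ℂ 1 R.symm (0, 0) := by
    rw [← hΘ0]
    exact hΘc.contDiffAt.to_localInverse hder one_ne_zero
  set γ : ℂ → Fin r → ℂ := fun w => (R.symm (w, 0)).2 with hγ
  have hγd : ContDiffAt ℂ 1 γ 0 := by
    have h1 : ContDiffAt ℂ 1 (fun w : ℂ => ((w, 0) : ℂ × (Fin r → ℂ))) 0 :=
      contDiffAt_id.prodMk contDiffAt_const
    exact contDiff_snd.contDiffAt.comp _ (ContDiffAt.comp (0 : ℂ) hsymm h1)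
  have hev1 : ∀ᶠ w in 𝓝 (0 : ℂ), DifferentiableAt ℂ γ w := by
    filter_upwards [hγd.eventually (by simp)] with w hw
    exact hw.differentiableAt one_ne_zero
  have hev2 : ∀ᶠ w in 𝓝 (0 : ℂ), ((w, 0) : ℂ × (Fin r → ℂ)) ∈ R.target := by
    have hc : Continuous fun w : ℂ => ((w, 0) : ℂ × (Fin r → ℂ)) := by fun_prop
    exact hc.continuousAt.eventually_mem (R.open_target.mem_nhds htgt)
  obtain ⟨ε, hε, hball⟩ := Metric.eventually_nhds_iff_ball.mp (hev1.and hev2)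
  refine ⟨R.source, γ, ε, R.open_source, hε, hsrc,
    fun w hw => (hball w hw).1.differentiableWithinAt, fun w hw => ?_, fun w b hwb hE => ?_⟩
  · have h1 := R.map_target (hball w hw).2
    have h2 : (R.symm (w, 0)).1 = w := by
      have := congrArg Prod.fst (R.right_inv (hball w hw).2)
      rwa [hRΘ] at this
    have h3 : (w, γ w) = R.symm (w, 0) := Prod.ext h2.symm rfl
    rwa [h3]
  · have h1 : R (w, b) = (w, 0) := by
      rw [hRΘ]
      refine Prod.ext rfl (funext fun i => ?_)
      simp only [hΘ, hE i, sub_self, Pi.zero_apply]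
    have h2 := R.left_inv hwb
    rw [h1] at h2
    simp only [hγ, h2]

namespace CurvePoint

variable {B : Type} [CommRing B] [Algebra ℂ B]

/-- `t` generates the maximal ideal of the local ring of the curve at `P`. -/
def Uniformizes (t : B) (P : CurvePoint B) : Prop :=
  P t = 0 ∧ ∀ b : B, ∃ s c : B, P s ≠ 0 ∧ s * (b - algebraMap ℂ B (P b)) = t * c

/-- A chart of the curve given by an element of the coordinate ring, such that all elements of the
ring are holomorphic functions of the coordinate. -/
structure IsCoordinate (e : OpenPartialHomeomorph (CurvePoint B) ℂ) (t : B) : Prop where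
  apply_eq : ∀ Q, e Q = Q t
  differentiableOn : ∀ b, DifferentiableOn ℂ (fun w => e.symm w b) e.target

variable [Algebra ℂ[X] B] [IsScalarTower ℂ ℂ[X] B]
  [IsDomain B] [Module.Finite ℂ[X] B] [FaithfulSMul ℂ[X] B]

/-- A uniformizer is a chart. The equations of `Uniformizes` for generators of `B` are solved by
a holomorphic curve `γ`; every relation between the generators holds along `γ` by the identity
theorem, because it holds at the points of the curve near `P`, and so `γ` runs in the curve. -/
theorem Uniformizes.exists_chart {t : B} {P : CurvePoint B} (h : Uniformizes t P) :
    ∃ e : OpenPartialHomeomorph (CurvePoint B) ℂ, P ∈ e.source ∧ IsCoordinate e t := by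
  obtain ⟨r, gen, hgen⟩ := exists_generators (B := B)
  have hsurj : Function.Surjective (MvPolynomial.aeval (R := ℂ) gen) := by
    rw [← AlgHom.range_eq_top, ← Algebra.adjoin_range_eq_range_aeval, hgen]
  choose lift hlift using hsurj
  have heval : ∀ (Q : CurvePoint B) (q : MvPolynomial (Fin r) ℂ),
      Q (MvPolynomial.aeval gen q) = MvPolynomial.eval (fun i => Q (gen i)) q := by
    intro Q q
    have : (AlgHomClass.toAlgHom Q).comp (MvPolynomial.aeval gen)
        = MvPolynomial.aeval (fun i => Q (gen i)) :=
      MvPolynomial.algHom_ext fun i => by simp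
    exact DFunLike.congr_fun this q
  choose s c hs hsc using fun i => h.2 (gen i)
  obtain ⟨N, γ, ε, hN, hε, hmem, hγd, hγN, huniq⟩ := exists_implicit_curve
    (fun i => lift (s i)) (fun i => lift (c i)) (fun i => P (gen i))
    (fun i => by rw [← heval, hlift]; exact hs i)
  set U : Set (CurvePoint B) :=
    {Q | Q t ∈ Metric.ball (0 : ℂ) ε ∧ (Q t, fun i => Q (gen i)) ∈ N} with hU
  have hUo : IsOpen U := by
    refine (Metric.isOpen_ball.preimage (continuous_apply t)).inter (hN.preimage ?_)
    exact (continuous_apply t).prodMk (continuous_pi fun i => continuous_apply _)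
  have hPU : P ∈ U := by
    refine ⟨?_, ?_⟩ <;> rw [h.1]
    · exact Metric.mem_ball_self hε
    · exact hmem
  have hQγ : ∀ Q ∈ U, (fun i => Q (gen i)) = γ (Q t) := by
    rintro Q ⟨hQ1, hQ2⟩
    refine huniq _ _ hQ2 fun i => ?_
    have := congrArg Q (hsc i)
    simp only [map_mul, map_sub, AlgHomClass.commutes] at this
    rw [← heval, hlift, ← heval, hlift]
    exact this
  have ht0 : ∀ Q ∈ U, Q t = 0 → Q = P := by
    intro Q hQ h0
    refine eq_of_forall_generator hgen fun i => ?_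
    have h1 := hQγ Q hQ
    have h2 := hQγ P hPU
    rw [h0] at h1
    rw [h.1] at h2
    exact congrFun (h1.trans h2.symm) i
  -- points of the curve near `P` provide zeros accumulating at the origin
  have hvanish : ∀ f : ℂ → ℂ, DifferentiableOn ℂ f (Metric.ball 0 ε) →
      (∀ Q ∈ U, f (Q t) = 0) → ∀ w ∈ Metric.ball (0 : ℂ) ε, f w = 0 := by
    intro f hf hfU
    refine (hf.analyticOnNhd Metric.isOpen_ball).eqOn_zero_of_preconnected_of_frequently_eq_zero
      (convex_ball _ _).isPreconnected (Metric.mem_ball_self hε) ?_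
    have h1 : ∃ᶠ Q : CurvePoint B in 𝓝 P, Q.proj ∈ ({P.proj}ᶜ : Set ℂ) :=
      frequently_proj_mem P self_mem_nhdsWithin
    have h2 : ∃ᶠ Q in 𝓝 P, f (Q t) = 0 ∧ Q t ≠ 0 := by
      refine (h1.and_eventually (hUo.mem_nhds hPU)).mono ?_
      rintro Q ⟨hQ1, hQ2⟩
      refine ⟨hfU Q hQ2, fun h0 => hQ1 ?_⟩
      rw [ht0 Q hQ2 h0]; rfl
    rw [frequently_nhdsWithin_iff]
    have h3 : Tendsto (fun Q : CurvePoint B => Q t) (𝓝 P) (𝓝 0) := by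
      simpa [h.1] using (continuous_apply t).tendsto P
    exact h3.frequently h2
  have hpd : ∀ q : MvPolynomial (Fin r) ℂ,
      DifferentiableOn ℂ (fun w => MvPolynomial.eval (γ w) q) (Metric.ball 0 ε) := by
    intro q
    have : Differentiable ℂ fun x : Fin r → ℂ => MvPolynomial.eval x q := fun x =>
      (AnalyticAt.aeval_mvPolynomial (𝕜 := ℂ) (f := fun x : Fin r → ℂ => x)
        (fun i => (ContinuousLinearMap.proj (R := ℂ) (φ := fun _ : Fin r => ℂ) i).analyticAt x)
        q).differentiableAt
    exact this.comp_differentiableOn hγd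
  have hker : ∀ w ∈ Metric.ball (0 : ℂ) ε,
      RingHom.ker (MvPolynomial.aeval (R := ℂ) gen) ≤ RingHom.ker (MvPolynomial.aeval (R := ℂ) (γ w)) := by
    intro w hw q hq
    refine hvanish (fun w => MvPolynomial.eval (γ w) q) (hpd q) (fun Q hQ => ?_) w hw
    rw [← hQγ Q hQ, ← heval, (RingHom.mem_ker).mp hq, map_zero]
  classical
  let pt : ℂ → CurvePoint B := fun w =>
    if hw : w ∈ Metric.ball (0 : ℂ) ε then
      AlgHom.liftOfSurjective (MvPolynomial.aeval (R := ℂ) gen) (fun b => ⟨lift b, hlift b⟩)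
        (MvPolynomial.aeval (γ w)) (hker w hw)
    else P
  have hpt : ∀ w ∈ Metric.ball (0 : ℂ) ε, ∀ q : MvPolynomial (Fin r) ℂ,
      pt w (MvPolynomial.aeval gen q) = MvPolynomial.eval (γ w) q := by
    intro w hw q
    have h1 : pt w = AlgHom.liftOfSurjective (MvPolynomial.aeval (R := ℂ) gen)
        (fun b => ⟨lift b, hlift b⟩) (MvPolynomial.aeval (γ w)) (hker w hw) := dif_pos hw
    rw [h1]
    exact AlgHom.liftOfSurjective_apply _ _ _ _ _
  have hptgen : ∀ w ∈ Metric.ball (0 : ℂ) ε, (fun i => pt w (gen i)) = γ w := by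
    intro w hw
    funext i
    simpa using hpt w hw (MvPolynomial.X i)
  have hptb : ∀ b : B, ∀ w ∈ Metric.ball (0 : ℂ) ε,
      pt w b = MvPolynomial.eval (γ w) (lift b) := by
    intro b w hw
    rw [← hpt w hw, hlift]
  have hptt : ∀ w ∈ Metric.ball (0 : ℂ) ε, pt w t = w := by
    intro w hw
    rw [hptb t w hw, ← sub_eq_zero]
    refine hvanish (fun w => MvPolynomial.eval (γ w) (lift t) - w)
      ((hpd _).sub differentiableOn_id) (fun Q hQ => ?_) w hw
    rw [← hQγ Q hQ, ← heval, hlift, sub_self]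
  have hptd : ∀ b : B, DifferentiableOn ℂ (fun w => pt w b) (Metric.ball 0 ε) := fun b =>
    (hpd (lift b)).congr fun w hw => hptb b w hw
  refine ⟨{ toFun := fun Q => Q t
            invFun := pt
            source := U
            target := Metric.ball 0 ε
            map_source' := fun Q hQ => hQ.1
            map_target' := fun w hw => ?_
            left_inv' := fun Q hQ => ?_
            right_inv' := fun w hw => hptt w hw
            open_source := hUo
            open_target := Metric.isOpen_ball
            continuousOn_toFun := (continuous_apply t).continuousOn
            continuousOn_invFun := continuousOn_iff.mpr fun b => (hptd b).continuousOn },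
    hPU, fun Q => rfl, hptd⟩
  · refine ⟨by rwa [hptt w hw], ?_⟩
    rw [hptt w hw, hptgen w hw]
    exact hγN w hw
  · refine eq_of_forall_generator hgen fun i => ?_
    have h1 := hptgen (Q t) hQ.1
    rw [← hQγ Q hQ] at h1
    exact congrFun h1 i

end CurvePoint

namespace CurvePoint

/-! ### Uniformizers -/

variable {B : Type} [CommRing B] [Algebra ℂ B] [Algebra ℂ[X] B] [IsScalarTower ℂ ℂ[X] B]
  [IsDomain B] [Module.Finite ℂ[X] B] [FaithfulSMul ℂ[X] B]

/-- The generator of the maximal ideal of the local ring, a discrete valuation ring, can be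
taken in `B`. -/
theorem exists_uniformizes [IsDedekindDomain B] (P : CurvePoint B) : ∃ t : B, Uniformizes t P := by
  set 𝔪 : Ideal B := RingHom.ker (AlgHomClass.toAlgHom P).toRingHom with h𝔪
  have hmem : ∀ b : B, b ∈ 𝔪 ↔ P b = 0 := fun b => Iff.rfl
  have hmax : 𝔪.IsMaximal := RingHom.ker_isMaximal_of_surjective _ fun c =>
    ⟨algebraMap ℂ B c, AlgHomClass.commutes P c⟩
  have hne : 𝔪 ≠ ⊥ := by
    intro h0
    have h1 : algebraMap ℂ[X] B (X - C P.proj) ∈ 𝔪 := by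
      rw [hmem, apply_algebraMap]; simp
    rw [h0, Ideal.mem_bot, map_eq_zero_iff _ (FaithfulSMul.algebraMap_injective ℂ[X] B)] at h1
    exact X_sub_C_ne_zero _ h1
  have hdvr := IsLocalization.AtPrime.isDiscreteValuationRing_of_dedekind_domain B hne
    (Localization.AtPrime 𝔪)
  obtain ⟨ϖ, hϖ⟩ := IsDiscreteValuationRing.exists_irreducible (Localization.AtPrime 𝔪)
  have hgen := hϖ.maximalIdeal_eq
  obtain ⟨a, s, rfl⟩ := IsLocalization.exists_mk'_eq 𝔪.primeCompl ϖ
  have hinj : Function.Injective (algebraMap B (Localization.AtPrime 𝔪)) :=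
    IsLocalization.injective _ 𝔪.primeCompl_le_nonZeroDivisors
  have hmem' : ∀ b : B, b ∈ 𝔪 ↔
      algebraMap B (Localization.AtPrime 𝔪) b ∈ IsLocalRing.maximalIdeal _ := fun b =>
    (IsLocalization.AtPrime.to_map_mem_maximal_iff (Localization.AtPrime 𝔪) 𝔪 b).symm
  refine ⟨a, ?_, fun b => ?_⟩
  · rw [← hmem, hmem']
    rw [← IsLocalization.mk'_spec (Localization.AtPrime 𝔪) a s]
    refine Ideal.mul_mem_right _ _ ?_
    rw [hgen]
    exact Ideal.mem_span_singleton_self _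
  · have h1 : b - algebraMap ℂ B (P b) ∈ 𝔪 := by
      rw [hmem, map_sub, AlgHomClass.commutes]; simp
    rw [hmem', hgen, Ideal.mem_span_singleton] at h1
    obtain ⟨y, hy⟩ := h1
    obtain ⟨c, s', rfl⟩ := IsLocalization.exists_mk'_eq 𝔪.primeCompl y
    refine ⟨s * s', c, ?_, ?_⟩
    · exact fun h => (s * s').2 ((hmem _).mpr (by simpa using h))
    · apply hinj
      have e1 := IsLocalization.mk'_spec (Localization.AtPrime 𝔪) a s
      have e2 := IsLocalization.mk'_spec (Localization.AtPrime 𝔪) c s'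
      rw [map_mul, map_mul, hy, map_mul, ← e1, ← e2]
      ring

/-! ### Simple roots -/

section SimpleRoot

variable {ν : B} {Φ : ℂ[X][Y]} {P : CurvePoint B}

/-- If `P ν` is a simple root, then in the local ring of the plane curve at the image of `P` every
function vanishing there is divisible by `X - proj P`. -/
theorem exists_mul_eq_X_sub_mul (hν : aeval ν Φ = 0)
    (hs : Φ.derivative.evalEval P.proj (P ν) ≠ 0) :
    ∃ A : ℂ[X][Y], P (aeval ν A) ≠ 0 ∧ ∀ q : ℂ[X][Y], P (aeval ν q) = 0 →
      ∃ c : ℂ[X][Y], aeval ν (A * q) = algebraMap ℂ[X] B (X - C P.proj) * aeval ν c := by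
  set a : ℂ[X] := C (P ν) with ha
  -- Taylor expansion to first order at `(proj P, P ν)`
  have hexp : ∀ q : ℂ[X][Y], P (aeval ν q) = 0 → ∃ c : ℂ[X],
      q = C ((X - C P.proj) * c) + (X - C a) * (q /ₘ (X - C a)) := by
    intro q hq
    rw [apply_aeval] at hq
    have h1 : (q.eval a).IsRoot P.proj := hq
    obtain ⟨c, hc⟩ := dvd_iff_isRoot.mpr h1
    refine ⟨c, ?_⟩
    rw [← hc, ← modByMonic_X_sub_C_eq_C_eval, modByMonic_add_div]
  obtain ⟨c₀, hc₀⟩ := hexp Φ (by rw [hν, map_zero])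
  set A := Φ /ₘ (X - C a) with hA
  refine ⟨A, ?_, fun q hq => ?_⟩
  · rw [apply_aeval]
    rw [hc₀] at hs
    simpa [evalEval_add, evalEval_mul, evalEval_sub, ha, evalEval_C] using hs
  · obtain ⟨c₁, hc₁⟩ := hexp q hq
    refine ⟨A * C c₁ - C c₀ * (q /ₘ (X - C a)), ?_⟩
    have h2 : A * q = C (X - C P.proj) * (A * C c₁ - C c₀ * (q /ₘ (X - C a)))
        + Φ * (q /ₘ (X - C a)) := by
      conv_lhs => rw [hc₁]
      conv_rhs => rw [hc₀]
      simp only [C_mul]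
      ring
    rw [h2, map_add, map_mul, map_mul, hν, zero_mul, add_zero, aeval_C]

/-- At a simple root every element of `B` is a quotient of polynomials in `ν`. -/
theorem exists_mul_eq_aeval (hν : aeval ν Φ = 0)
    (hs : Φ.derivative.evalEval P.proj (P ν) ≠ 0) {b : B}
    (hb : ∃ d : ℂ[X], d ≠ 0 ∧ ∃ q : ℂ[X][Y], algebraMap ℂ[X] B d * b = aeval ν q) :
    ∃ s q : ℂ[X][Y], P (aeval ν s) ≠ 0 ∧ aeval ν s * b = aeval ν q := by
  obtain ⟨A, hA, hdiv⟩ := exists_mul_eq_X_sub_mul hν hs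
  have hX : algebraMap ℂ[X] B (X - C P.proj) ≠ 0 := by
    rw [Ne, map_eq_zero_iff _ (FaithfulSMul.algebraMap_injective ℂ[X] B)]
    exact X_sub_C_ne_zero _
  have key : ∀ (n : ℕ) (s q : ℂ[X][Y]), P (aeval ν s) ≠ 0 →
      algebraMap ℂ[X] B (X - C P.proj) ^ n * (aeval ν s * b) = aeval ν q →
      ∃ s q : ℂ[X][Y], P (aeval ν s) ≠ 0 ∧ aeval ν s * b = aeval ν q := by
    intro n
    induction n with
    | zero => intro s q h1 h2; exact ⟨s, q, h1, by simpa using h2⟩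
    | succ n ih =>
      intro s q h1 h2
      have h3 : P (aeval ν q) = 0 := by
        rw [← h2, map_mul, map_pow, apply_algebraMap]; simp
      obtain ⟨c, hc⟩ := hdiv q h3
      refine ih (A * s) c (by rw [map_mul, map_mul]; exact mul_ne_zero hA h1) ?_
      apply mul_left_cancel₀ hX
      rw [← hc, map_mul, map_mul, ← h2]
      ring
  obtain ⟨d, hd, q, hq⟩ := hb
  obtain ⟨d', hd', hnd⟩ := exists_eq_pow_rootMultiplicity_mul_and_not_dvd d hd P.proj
  refine key (d.rootMultiplicity P.proj) (C d') q ?_ ?_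
  · rw [aeval_C, apply_algebraMap]
    exact fun h => hnd (dvd_iff_isRoot.mpr h)
  · rw [← hq, aeval_C, ← mul_assoc, ← map_pow, ← map_mul, ← hd']

theorem uniformizes_of_simple_root (hν : aeval ν Φ = 0)
    (hs : Φ.derivative.evalEval P.proj (P ν) ≠ 0)
    (hfrac : ∀ b : B, ∃ d : ℂ[X], d ≠ 0 ∧ ∃ q : ℂ[X][Y], algebraMap ℂ[X] B d * b = aeval ν q) :
    Uniformizes (algebraMap ℂ[X] B (X - C P.proj)) P := by
  refine ⟨by rw [apply_algebraMap]; simp, fun b => ?_⟩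
  obtain ⟨s, q, h1, h2⟩ := exists_mul_eq_aeval hν hs (hfrac b)
  obtain ⟨A, hA, hdiv⟩ := exists_mul_eq_X_sub_mul hν hs
  have e : aeval ν s * (b - algebraMap ℂ B (P b)) = aeval ν (q - C (C (P b)) * s) := by
    rw [mul_sub, h2, map_sub, map_mul, aeval_C, IsScalarTower.algebraMap_apply ℂ ℂ[X] B,
      algebraMap_eq]
    ring
  obtain ⟨c, hc⟩ := hdiv (q - C (C (P b)) * s) (by
    rw [← e, map_mul, map_sub, AlgHomClass.commutes]; simp)
  refine ⟨aeval ν (A * s), aeval ν c, ?_, ?_⟩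
  · rw [map_mul, map_mul]; exact mul_ne_zero hA h1
  · rw [← hc, map_mul, map_mul, ← e, mul_assoc]

/-- At a simple root there is only one point of the curve. -/
theorem eq_of_simple_root (hν : aeval ν Φ = 0)
    (hs : Φ.derivative.evalEval P.proj (P ν) ≠ 0)
    (hfrac : ∀ b : B, ∃ d : ℂ[X], d ≠ 0 ∧ ∃ q : ℂ[X][Y], algebraMap ℂ[X] B d * b = aeval ν q)
    {Q : CurvePoint B} (hproj : Q.proj = P.proj) (hQ : Q ν = P ν) : Q = P := by
  ext b
  obtain ⟨s, q, h1, h2⟩ := exists_mul_eq_aeval hν hs (hfrac b)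
  have hs' : Q (aeval ν s) = P (aeval ν s) := by rw [apply_aeval, apply_aeval, hproj, hQ]
  have hq' : Q (aeval ν q) = P (aeval ν q) := by rw [apply_aeval, apply_aeval, hproj, hQ]
  have e1 := congrArg P h2
  have e2 := congrArg Q h2
  rw [map_mul] at e1 e2
  rw [hs', hq', ← e1] at e2
  exact mul_left_cancel₀ h1 e2

end SimpleRoot

/-! ### The Riemann surface structure -/

section Manifold

variable [IsDedekindDomain B]

/-- A chart around `P` given by a uniformizer at `P`. -/
def chart (P : CurvePoint B) : OpenPartialHomeomorph (CurvePoint B) ℂ :=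
  (exists_uniformizes P).choose_spec.exists_chart.choose

theorem mem_chart_source' (P : CurvePoint B) : P ∈ (chart P).source :=
  (exists_uniformizes P).choose_spec.exists_chart.choose_spec.1

theorem isCoordinate_chart (P : CurvePoint B) :
    IsCoordinate (chart P) (exists_uniformizes P).choose :=
  (exists_uniformizes P).choose_spec.exists_chart.choose_spec.2

instance : ChartedSpace ℂ (CurvePoint B) where
  atlas := Set.range chart
  chartAt := chart
  mem_chart_source := mem_chart_source'
  chart_mem_atlas := fun P => ⟨P, rfl⟩

instance : IsManifold 𝓘(ℂ) ω (CurvePoint B) := by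
  refine isManifold_of_contDiffOn _ _ _ ?_
  rintro _ _ ⟨P, rfl⟩ ⟨Q, rfl⟩
  have h1 : ContDiffOn ℂ ω (fun w => chart Q ((chart P).symm w)) (chart P).target := by
    have h2 : DifferentiableOn ℂ (fun w => chart Q ((chart P).symm w)) (chart P).target :=
      ((isCoordinate_chart P).differentiableOn (exists_uniformizes Q).choose).congr
        fun w _ => (isCoordinate_chart Q).apply_eq _
    exact (h2.analyticOnNhd (chart P).open_target).contDiffOn (chart P).open_target.uniqueDiffOn
  refine h1.mono ?_
  intro w hw
  simp only [mfld_simps] at hw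
  exact hw.1

theorem mdifferentiable_apply (b : B) :
    MDifferentiable 𝓘(ℂ) 𝓘(ℂ) (fun P : CurvePoint B => P b) := by
  intro P
  rw [mdifferentiableAt_iff]
  refine ⟨(continuous_apply b).continuousAt, ?_⟩
  have h1 := ((isCoordinate_chart P).differentiableOn b).differentiableAt
    ((chart P).open_target.mem_nhds ((chart P).map_source (mem_chart_source' P)))
  exact h1.differentiableWithinAt

end Manifold

end CurvePoint

/-! ### Entire functions of polynomial growth -/

/-- `f` is bounded by a polynomial in the norm of its argument. -/
def PolyGrowth (f : ℂ → ℝ) : Prop := ∃ (K : ℝ) (N : ℕ), ∀ z, f z ≤ K * (1 + ‖z‖) ^ N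

theorem PolyGrowth.mono {f g : ℂ → ℝ} (hf : PolyGrowth f) (h : ∀ z, g z ≤ f z) : PolyGrowth g := by
  obtain ⟨K, N, hK⟩ := hf
  exact ⟨K, N, fun z => (h z).trans (hK z)⟩

theorem polyGrowth_const (c : ℝ) : PolyGrowth fun _ => c := ⟨c, 0, fun z => by simp⟩

theorem PolyGrowth.mul {f g : ℂ → ℝ} (hf : PolyGrowth f) (hg : PolyGrowth g) (hf0 : ∀ z, 0 ≤ f z)
    (hg0 : ∀ z, 0 ≤ g z) : PolyGrowth fun z => f z * g z := by
  obtain ⟨K, N, hK⟩ := hf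
  obtain ⟨K', N', hK'⟩ := hg
  refine ⟨K * K', N + N', fun z => ?_⟩
  calc f z * g z ≤ (K * (1 + ‖z‖) ^ N) * (K' * (1 + ‖z‖) ^ N') :=
        mul_le_mul (hK z) (hK' z) (hg0 z) ((hf0 z).trans (hK z))
    _ = _ := by ring

theorem PolyGrowth.add {f g : ℂ → ℝ} (hf : PolyGrowth f) (hg : PolyGrowth g) :
    PolyGrowth fun z => f z + g z := by
  obtain ⟨K, N, hK⟩ := hf
  obtain ⟨K', N', hK'⟩ := hg
  refine ⟨|K| + |K'|, N + N', fun z => ?_⟩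
  have h1 : (1 : ℝ) ≤ 1 + ‖z‖ := by linarith [norm_nonneg z]
  have h2 : K * (1 + ‖z‖) ^ N ≤ |K| * (1 + ‖z‖) ^ (N + N') :=
    mul_le_mul (le_abs_self K) (pow_le_pow_right₀ h1 (by omega)) (by positivity) (abs_nonneg _)
  have h3 : K' * (1 + ‖z‖) ^ N' ≤ |K'| * (1 + ‖z‖) ^ (N + N') :=
    mul_le_mul (le_abs_self K') (pow_le_pow_right₀ h1 (by omega)) (by positivity) (abs_nonneg _)
  linarith [hK z, hK' z]

theorem PolyGrowth.pow {f : ℂ → ℝ} (hf : PolyGrowth f) (hf0 : ∀ z, 0 ≤ f z) (n : ℕ) :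
    PolyGrowth fun z => f z ^ n := by
  induction n with
  | zero => simpa using polyGrowth_const 1
  | succ n ih =>
    simp_rw [pow_succ]
    exact ih.mul hf (fun z => pow_nonneg (hf0 z) n) hf0

theorem PolyGrowth.sum {ι : Type*} {f : ι → ℂ → ℝ} (s : Finset ι) (hf : ∀ i, PolyGrowth (f i)) :
    PolyGrowth fun z => ∑ i ∈ s, f i z := by
  classical
  induction s using Finset.induction_on with
  | empty => simpa using polyGrowth_const 0
  | insert i s hi ih =>
    simp_rw [Finset.sum_insert hi]
    exact (hf i).add ih

theorem polyGrowth_eval (q : ℂ[X]) : PolyGrowth fun z => ‖q.eval z‖ := by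
  have h : PolyGrowth fun z => ∑ i ∈ Finset.range (q.natDegree + 1), ‖q.coeff i‖ * ‖z‖ ^ i := by
    refine PolyGrowth.sum _ fun i => (polyGrowth_const _).mul ?_ (fun _ => norm_nonneg _)
      (fun z => by positivity)
    exact PolyGrowth.pow ⟨1, 1, fun z => by simp⟩ (fun z => norm_nonneg z) i
  refine h.mono fun z => ?_
  rw [eval_eq_sum_range]
  exact (norm_sum_le _ _).trans (by simp)

theorem polyGrowth_rootBound (Φ : ℂ[X][Y]) : PolyGrowth (rootBound Φ) :=
  (polyGrowth_const 1).add (PolyGrowth.sum _ fun _ => polyGrowth_eval _)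

/-- An entire function of polynomial growth is a polynomial. -/
theorem exists_polynomial_of_polyGrowth {f : ℂ → ℂ} (hf : Differentiable ℂ f)
    (hg : PolyGrowth fun z => ‖f z‖) : ∃ q : ℂ[X], ∀ z, q.eval z = f z := by
  obtain ⟨K, N, hK⟩ := hg
  induction N generalizing f K with
  | zero =>
    have hb : Bornology.IsBounded (Set.range f) := by
      refine (Metric.isBounded_closedBall (x := (0 : ℂ)) (r := K)).subset ?_
      rintro _ ⟨z, rfl⟩
      simpa using hK z
    obtain ⟨c, hc⟩ := hf.exists_const_forall_eq_of_bounded hb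
    exact ⟨C c, fun z => by simp [hc]⟩
  | succ N ih =>
    have hd : Differentiable ℂ (dslope f 0) := by
      rw [← differentiableOn_univ] at hf ⊢
      exact (Complex.differentiableOn_dslope univ_mem).mpr hf
    -- near the origin `dslope f 0` is bounded by continuity
    obtain ⟨K₁, hK₁⟩ := (isCompact_closedBall (0 : ℂ) 1).exists_bound_of_continuousOn
      hd.continuous.continuousOn
    obtain ⟨q, hq⟩ := ih hd (|K₁| + 4 * |K|) (by
      intro z
      change ‖dslope f 0 z‖ ≤ _
      have h1 : (1 : ℝ) ≤ (1 + ‖z‖) ^ N := one_le_pow₀ (by linarith [norm_nonneg z])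
      rcases le_or_gt ‖z‖ 1 with hz | hz
      · have h2 := hK₁ z (by simpa using hz)
        calc ‖dslope f 0 z‖ ≤ |K₁| := h2.trans (le_abs_self _)
          _ ≤ (|K₁| + 4 * |K|) * 1 := by linarith [abs_nonneg K]
          _ ≤ _ := by gcongr
      · have hz0 : z ≠ 0 := by rintro rfl; simp at hz; linarith
        have hzp : 0 < ‖z‖ := norm_pos_iff.mpr hz0
        rw [dslope_of_ne _ hz0, slope_def_field, sub_zero, norm_div, div_le_iff₀ hzp]
        have h3 := hK z
        have h4 := hK 0
        have hKa : K ≤ |K| := le_abs_self K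
        simp only [norm_zero, add_zero, one_pow, mul_one] at h4
        have h5 : (1 : ℝ) ≤ (1 + ‖z‖) ^ (N + 1) := one_le_pow₀ (by linarith)
        calc ‖f z - f 0‖ ≤ ‖f z‖ + ‖f 0‖ := norm_sub_le _ _
          _ ≤ |K| * (1 + ‖z‖) ^ (N + 1) + |K| * (1 + ‖z‖) ^ (N + 1) := by
              refine add_le_add (h3.trans (by gcongr)) (h4.trans (hKa.trans ?_))
              exact le_mul_of_one_le_right (abs_nonneg K) h5
          _ = 2 * |K| * (1 + ‖z‖) ^ N * (1 + ‖z‖) := by ring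
          _ ≤ 2 * |K| * (1 + ‖z‖) ^ N * (2 * ‖z‖) := by gcongr; linarith
          _ ≤ (|K₁| + 4 * |K|) * (1 + ‖z‖) ^ N * ‖z‖ := by
              have : 0 ≤ |K₁| * (1 + ‖z‖) ^ N * ‖z‖ := by positivity
              nlinarith)
    refine ⟨C (f 0) + X * q, fun z => ?_⟩
    have := sub_smul_dslope f 0 z
    simp only [sub_zero, smul_eq_mul] at this
    rw [eval_add, eval_C, eval_mul, eval_X, hq, this]
    ring

/-! ### Connectedness of the curve -/

namespace CurvePoint

variable {B : Type} [CommRing B] [Algebra ℂ B] [Algebra ℂ[X] B] [IsScalarTower ℂ ℂ[X] B]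
  [IsDomain B] [Module.Finite ℂ[X] B] [FaithfulSMul ℂ[X] B]

theorem exists_proj_eq (z : ℂ) : ∃ P : CurvePoint B, P.proj = z := by
  have h0 : IsIntegral ℂ[X] (0 : B) := isIntegral_elem 0
  have hm := (minpoly.monic h0).natDegree_map (evalRingHom z)
  obtain ⟨y, hy⟩ := IsAlgClosed.exists_root ((minpoly ℂ[X] (0 : B)).map (evalRingHom z)) (by
    refine (natDegree_pos_iff_degree_pos.mp ?_).ne'
    rw [hm]
    exact minpoly.natDegree_pos h0)
  rw [IsRoot.def, map_evalRingHom_eval] at hy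
  obtain ⟨P, hP, -⟩ := exists_point (B := B) 0 hy
  exact ⟨P, hP⟩

theorem exists_mem_of_isOpen {U : Set (CurvePoint B)} (hU : IsOpen U) (hne : U.Nonempty)
    {r : ℂ[X]} (hr : r ≠ 0) : ∃ P ∈ U, r.eval P.proj ≠ 0 := by
  obtain ⟨P, hP⟩ := hne
  have hZ : {z : ℂ | r.eval z ≠ 0} ∈ 𝓝[≠] P.proj := by
    have h1 : {z : ℂ | r.eval z = 0}.Finite :=
      (Multiset.finite_toSet r.roots).subset fun z hz => (mem_roots hr).mpr hz
    have h3 : ({z : ℂ | r.eval z = 0} \ {P.proj})ᶜ ∈ 𝓝 P.proj :=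
      (h1.subset Set.sdiff_subset).isClosed.isOpen_compl.mem_nhds (by simp)
    filter_upwards [nhdsWithin_le_nhds h3, self_mem_nhdsWithin] with z hz1 hz2 hz3
    exact hz1 ⟨hz3, hz2⟩
  obtain ⟨Q, hQ1, hQ2⟩ := ((frequently_proj_mem P hZ).and_eventually (hU.mem_nhds hP)).exists
  exact ⟨Q, hQ2, hQ1⟩

/-- An element of `B` which vanishes on all but finitely many fibers is zero. -/
theorem eq_zero_of_forall_apply {b : B} {r : ℂ[X]} (hr : r ≠ 0)
    (h : ∀ P : CurvePoint B, r.eval P.proj ≠ 0 → P b = 0) : b = 0 := by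
  have hb := isIntegral_elem b
  set c := (minpoly ℂ[X] b).coeff 0 with hc
  have hc0 : c = 0 := by
    have h1 : r * c = 0 := by
      refine Polynomial.funext fun z => ?_
      rw [eval_mul, eval_zero]
      by_cases hz : r.eval z = 0
      · rw [hz, zero_mul]
      · obtain ⟨P, rfl⟩ := exists_proj_eq (B := B) z
        have h2 : (minpoly ℂ[X] b).evalEval P.proj (P b) = 0 := by
          rw [← apply_aeval, minpoly.aeval, map_zero]
        rw [h P hz, ← map_evalRingHom_eval, ← coeff_zero_eq_eval_zero, coeff_map] at h2
        rw [show c.eval P.proj = 0 from h2, mul_zero]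
    exact (mul_eq_zero.mp h1).resolve_left hr
  obtain ⟨q, hq⟩ := X_dvd_iff.mpr hc0
  rcases (minpoly.irreducible hb).isUnit_or_isUnit hq with hu | hu
  · exact absurd hu not_isUnit_X
  · have h1 := minpoly.aeval ℂ[X] b
    rw [hq, map_mul, aeval_X] at h1
    exact (mul_eq_zero.mp h1).resolve_right (hu.map (aeval b)).ne_zero

section Sections

variable {ν : B} {Φ : ℂ[X][Y]}

/-- Near a point over which all roots are simple, the curve is a disjoint union of graphs of
holomorphic sections. -/
theorem exists_sections (hν : aeval ν Φ = 0)
    (hfrac : ∀ b : B, ∃ d : ℂ[X], d ≠ 0 ∧ ∃ q : ℂ[X][Y], algebraMap ℂ[X] B d * b = aeval ν q)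
    {z₀ : ℂ} (hs : ∀ P : CurvePoint B, P.proj = z₀ → Φ.derivative.evalEval z₀ (P ν) ≠ 0) :
    ∃ σ : CurvePoint B → ℂ → CurvePoint B,
      (∀ P : CurvePoint B, P.proj = z₀ → Tendsto (σ P) (𝓝 z₀) (𝓝 P)) ∧
      (∀ P : CurvePoint B, P.proj = z₀ → DifferentiableAt ℂ (fun z => σ P z ν) z₀) ∧
      (∀ᶠ z in 𝓝 z₀, {Q : CurvePoint B | Q.proj = z} =
        (fun P => σ P z) '' {P : CurvePoint B | P.proj = z₀} ∧
        Set.InjOn (fun P => σ P z) {P : CurvePoint B | P.proj = z₀}) := by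
  have hch₀ : ∀ P : CurvePoint B, P.proj = z₀ → ∃ e : OpenPartialHomeomorph (CurvePoint B) ℂ,
      P ∈ e.source ∧ IsCoordinate e (algebraMap ℂ[X] B (X - C z₀)) := by
    rintro P rfl
    exact (uniformizes_of_simple_root hν (hs P rfl) hfrac).exists_chart
  obtain ⟨P₀, hP₀⟩ := exists_proj_eq (B := B) z₀
  have hch : ∀ P : CurvePoint B, ∃ e : OpenPartialHomeomorph (CurvePoint B) ℂ, P.proj = z₀ →
      P ∈ e.source ∧ IsCoordinate e (algebraMap ℂ[X] B (X - C z₀)) := by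
    intro P
    by_cases hP : P.proj = z₀
    · obtain ⟨e, he⟩ := hch₀ P hP
      exact ⟨e, fun _ => he⟩
    · exact ⟨(hch₀ P₀ hP₀).choose, fun h => absurd h hP⟩
  choose e he using hch
  have happ : ∀ P : CurvePoint B, P.proj = z₀ → ∀ Q, e P Q = Q.proj - z₀ := by
    intro P hP Q
    rw [(he P hP).2.apply_eq, apply_algebraMap]; simp
  have hF := finite_fiber (B := B) z₀
  have h0 : ∀ P : CurvePoint B, P.proj = z₀ → (0 : ℂ) ∈ (e P).target := by
    intro P hP
    have := (e P).map_source (he P hP).1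
    rwa [happ P hP, hP, sub_self] at this
  have hsub : Tendsto (fun z : ℂ => z - z₀) (𝓝 z₀) (𝓝 0) := by
    have : Continuous fun z : ℂ => z - z₀ := by fun_prop
    simpa using this.tendsto z₀
  have htend : ∀ P : CurvePoint B, P.proj = z₀ →
      Tendsto (fun z => (e P).symm (z - z₀)) (𝓝 z₀) (𝓝 P) := by
    intro P hP
    have h1 : (e P).symm 0 = P := by
      have := (e P).left_inv (he P hP).1
      rwa [happ P hP, hP, sub_self] at this
    have h2 := ((e P).continuousAt_symm (h0 P hP)).tendsto
    rw [h1] at h2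
    exact h2.comp hsub
  refine ⟨fun P z => (e P).symm (z - z₀), htend, fun P hP => ?_, ?_⟩
  · have h1 := ((he P hP).2.differentiableOn ν).differentiableAt
      ((e P).open_target.mem_nhds (h0 P hP))
    have h2 : DifferentiableAt ℂ (fun z : ℂ => z - z₀) z₀ := differentiableAt_id.sub_const z₀
    refine DifferentiableAt.comp z₀ (g := fun w => (e P).symm w ν) ?_ h2
    rwa [sub_self]
  · -- the fiber over a nearby point lies in the union of the charts, since `proj` is closed
    have hO : ∀ᶠ z in 𝓝 z₀, ∀ Q : CurvePoint B, Q.proj = z → ∃ P : CurvePoint B, P.proj = z₀ ∧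
        Q ∈ (e P).source := by
      set O : Set (CurvePoint B) := ⋃ P ∈ {P : CurvePoint B | P.proj = z₀}, (e P).source with hO
      have hOo : IsOpen O := isOpen_biUnion fun P _ => (e P).open_source
      have hcl := isProperMap_proj.isClosedMap _ hOo.isClosed_compl
      have : z₀ ∈ (proj '' Oᶜ)ᶜ := by
        rintro ⟨P, hP, hPz⟩
        exact hP (Set.mem_biUnion (show P ∈ {P : CurvePoint B | P.proj = z₀} from hPz)
          (he P hPz).1)
      filter_upwards [hcl.isOpen_compl.mem_nhds this] with z hz Q hQ
      by_contra hcon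
      refine hz ⟨Q, fun hQO => hcon ?_, hQ⟩
      obtain ⟨P, hP1, hP2⟩ := Set.mem_iUnion₂.mp hQO
      exact ⟨P, hP1, hP2⟩
    have htgt : ∀ᶠ z in 𝓝 z₀, ∀ P ∈ {P : CurvePoint B | P.proj = z₀}, z - z₀ ∈ (e P).target :=
      (Filter.eventually_all_finite hF).mpr fun P hP =>
        hsub ((e P).open_target.mem_nhds (h0 P hP))
    have hinj : ∀ᶠ z in 𝓝 z₀, ∀ P ∈ {P : CurvePoint B | P.proj = z₀},
        ∀ Q ∈ {P : CurvePoint B | P.proj = z₀},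
          (e P).symm (z - z₀) = (e Q).symm (z - z₀) → P = Q := by
      refine (Filter.eventually_all_finite hF).mpr fun P hP =>
        (Filter.eventually_all_finite hF).mpr fun Q hQ => ?_
      by_cases hPQ : P = Q
      · exact Eventually.of_forall fun _ _ => hPQ
      · obtain ⟨u, v, hu, hv, hPu, hQv, huv⟩ := t2_separation hPQ
        filter_upwards [htend P hP (hu.mem_nhds hPu), htend Q hQ (hv.mem_nhds hQv)] with z h1 h2 h3
        exact absurd h3 (huv.ne_of_mem h1 h2)
    filter_upwards [hO, htgt, hinj] with z hz1 hz2 hz3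
    refine ⟨?_, fun P hP Q hQ h => hz3 P hP Q hQ h⟩
    ext Q
    constructor
    · intro hQ
      obtain ⟨P, hP, hPQ⟩ := hz1 Q hQ
      refine ⟨P, hP, ?_⟩
      have h1 := (e P).left_inv hPQ
      rw [happ P hP] at h1
      rw [← show Q.proj = z from hQ]
      exact h1
    · rintro ⟨P, hP, rfl⟩
      have h1 := (e P).right_inv (hz2 P hP)
      rw [happ P hP] at h1
      exact sub_left_injective h1

end Sections

end CurvePoint

namespace CurvePoint

variable {B : Type} [CommRing B] [Algebra ℂ B] [Algebra ℂ[X] B] [IsScalarTower ℂ ℂ[X] B]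
  [IsDomain B] [Module.Finite ℂ[X] B] [FaithfulSMul ℂ[X] B] {ν : B} {Φ : ℂ[X][Y]}

/-- The sum of the `j`-th powers of `ν` over the points of `U` above `z`. -/
def powerSum (U : Set (CurvePoint B)) (ν : B) (j : ℕ) (z : ℂ) : ℂ :=
  ∑ᶠ P ∈ {P : CurvePoint B | P.proj = z} ∩ U, P ν ^ j

theorem differentiableAt_powerSum (hν : aeval ν Φ = 0)
    (hfrac : ∀ b : B, ∃ d : ℂ[X], d ≠ 0 ∧ ∃ q : ℂ[X][Y], algebraMap ℂ[X] B d * b = aeval ν q)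
    {U : Set (CurvePoint B)} (hU : IsClopen U) (j : ℕ) {z₀ : ℂ}
    (hs : ∀ P : CurvePoint B, P.proj = z₀ → Φ.derivative.evalEval z₀ (P ν) ≠ 0) :
    DifferentiableAt ℂ (powerSum U ν j) z₀ := by
  obtain ⟨σ, h1, h2, h3⟩ := exists_sections hν hfrac hs
  have hF := finite_fiber (B := B) z₀
  have hFU : ({P : CurvePoint B | P.proj = z₀} ∩ U).Finite := hF.subset Set.inter_subset_left
  -- a section starting in the clopen set `U`, or in its complement, stays there
  have h4 : ∀ᶠ z in 𝓝 z₀, ∀ P ∈ {P : CurvePoint B | P.proj = z₀}, (σ P z ∈ U ↔ P ∈ U) := by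
    refine (Filter.eventually_all_finite hF).mpr fun P hP => ?_
    by_cases hPU : P ∈ U
    · filter_upwards [h1 P hP (hU.isOpen.mem_nhds hPU)] with z hz
      exact ⟨fun _ => hPU, fun _ => hz⟩
    · filter_upwards [h1 P hP (hU.compl.isOpen.mem_nhds hPU)] with z hz
      exact ⟨fun h => absurd h hz, fun h => absurd h hPU⟩
  have h5 : powerSum U ν j =ᶠ[𝓝 z₀] fun z => ∑ P ∈ hFU.toFinset, (σ P z ν) ^ j := by
    filter_upwards [h3, h4] with z hz3 hz4
    have h6 : {Q : CurvePoint B | Q.proj = z} ∩ U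
        = (fun P => σ P z) '' ({P : CurvePoint B | P.proj = z₀} ∩ U) := by
      rw [hz3.1]
      ext Q
      constructor
      · rintro ⟨⟨P, hP, rfl⟩, hQ⟩
        exact ⟨P, ⟨hP, (hz4 P hP).mp hQ⟩, rfl⟩
      · rintro ⟨P, ⟨hP, hPU⟩, rfl⟩
        exact ⟨⟨P, hP, rfl⟩, (hz4 P hP).mpr hPU⟩
    rw [powerSum, h6, finsum_mem_image (hz3.2.mono Set.inter_subset_left),
      finsum_mem_eq_finite_toFinset_sum _ hFU]
  refine DifferentiableAt.congr_of_eventuallyEq ?_ h5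
  refine DifferentiableAt.fun_sum fun P hP => ?_
  exact (h2 P (hFU.mem_toFinset.mp hP).1).pow j

theorem norm_powerSum_le (hΦ : Φ.Monic) (hν : aeval ν Φ = 0)
    (hfrac : ∀ b : B, ∃ d : ℂ[X], d ≠ 0 ∧ ∃ q : ℂ[X][Y], algebraMap ℂ[X] B d * b = aeval ν q)
    (U : Set (CurvePoint B)) (j : ℕ) {z : ℂ}
    (hs : ∀ P : CurvePoint B, P.proj = z → Φ.derivative.evalEval z (P ν) ≠ 0) :
    ‖powerSum U ν j z‖ ≤ Φ.natDegree * rootBound Φ z ^ j := by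
  classical
  have hFU : ({P : CurvePoint B | P.proj = z} ∩ U).Finite :=
    (finite_fiber z).subset Set.inter_subset_left
  have hroot : ∀ P : CurvePoint B, P.proj = z → Φ.evalEval z (P ν) = 0 := by
    rintro P rfl
    rw [← apply_aeval, hν, map_zero]
  rw [powerSum, finsum_mem_eq_finite_toFinset_sum _ hFU]
  have h1 : ∀ P ∈ hFU.toFinset, ‖P ν ^ j‖ ≤ rootBound Φ z ^ j := by
    intro P hP
    rw [norm_pow]
    exact pow_le_pow_left₀ (norm_nonneg _)
      (norm_le_rootBound hΦ (hroot P (hFU.mem_toFinset.mp hP).1)) j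
  refine (norm_sum_le_of_le _ h1).trans ?_
  rw [Finset.sum_const, nsmul_eq_mul]
  have h0 : 0 ≤ rootBound Φ z := by unfold rootBound; positivity
  refine mul_le_mul_of_nonneg_right ?_ (pow_nonneg h0 j)
  norm_cast
  -- a point over `z` is determined by the value of `ν`, a root of `Φ (z, ·)`
  have hm := hΦ.map (evalRingHom z)
  calc hFU.toFinset.card ≤ (Φ.map (evalRingHom z)).roots.toFinset.card := by
        refine Finset.card_le_card_of_injOn (fun P => P ν) (fun P hP => ?_) ?_
        · have := hroot P (hFU.mem_toFinset.mp hP).1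
          rw [← map_evalRingHom_eval] at this
          simpa [hm.ne_zero] using this
        · intro P hP Q hQ hPQ
          have hP' : P.proj = z := (hFU.mem_toFinset.mp hP).1
          have hQ' : Q.proj = z := (hFU.mem_toFinset.mp hQ).1
          subst hQ'
          exact eq_of_simple_root hν (hs Q rfl) hfrac hP' hPQ
    _ ≤ _ := Multiset.toFinset_card_le _
    _ ≤ _ := card_roots' _
    _ = _ := hΦ.natDegree_map _

/-- The power sums over a clopen set are polynomials up to the factor `r`, whose zeros contain
the exceptional points. -/
theorem exists_polynomial_powerSum (hΦ : Φ.Monic) (hν : aeval ν Φ = 0)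
    (hfrac : ∀ b : B, ∃ d : ℂ[X], d ≠ 0 ∧ ∃ q : ℂ[X][Y], algebraMap ℂ[X] B d * b = aeval ν q)
    {r : ℂ[X]}
    (hs : ∀ z, r.eval z ≠ 0 → ∀ y, Φ.evalEval z y = 0 → Φ.derivative.evalEval z y ≠ 0)
    {U : Set (CurvePoint B)} (hU : IsClopen U) (j : ℕ) :
    ∃ q : ℂ[X], ∀ z, q.eval z = r.eval z * powerSum U ν j z := by
  have hs' : ∀ z, r.eval z ≠ 0 → ∀ P : CurvePoint B, P.proj = z →
      Φ.derivative.evalEval z (P ν) ≠ 0 := by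
    rintro z hz P rfl
    refine hs _ hz _ ?_
    rw [← apply_aeval, hν, map_zero]
  have hb : ∀ z, ‖r.eval z * powerSum U ν j z‖ ≤
      ‖r.eval z‖ * (Φ.natDegree * rootBound Φ z ^ j) := by
    intro z
    rw [norm_mul]
    by_cases hz : r.eval z = 0
    · simp [hz]
    · exact mul_le_mul_of_nonneg_left (norm_powerSum_le hΦ hν hfrac U j (hs' z hz))
        (norm_nonneg _)
  have hrb : ∀ z, 0 ≤ rootBound Φ z := fun z => by unfold rootBound; positivity
  have hgood : ∀ z, r.eval z ≠ 0 →
      DifferentiableAt ℂ (fun z => r.eval z * powerSum U ν j z) z := fun z hz =>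
    r.differentiable.differentiableAt.mul (differentiableAt_powerSum hν hfrac hU j (hs' z hz))
  refine exists_polynomial_of_polyGrowth (fun z => ?_) (PolyGrowth.mono ?_ hb)
  · by_cases hz : r.eval z = 0
    · by_cases hr : r = 0
      · simp [hr]
      have hfin : {w : ℂ | r.eval w = 0}.Finite :=
        (Multiset.finite_toSet r.roots).subset fun w hw => (mem_roots hr).mpr hw
      refine (Complex.analyticAt_of_differentiable_on_punctured_nhds_of_continuousAt
        ?_ ?_).differentiableAt
      · have h3 : ({w : ℂ | r.eval w = 0} \ {z})ᶜ ∈ 𝓝 z :=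
          (hfin.subset Set.sdiff_subset).isClosed.isOpen_compl.mem_nhds (by simp)
        filter_upwards [nhdsWithin_le_nhds h3, self_mem_nhdsWithin] with w hw1 hw2
        exact hgood w fun hw3 => hw1 ⟨hw3, hw2⟩
      · have hc : Continuous fun z => ‖r.eval z‖ * (Φ.natDegree * rootBound Φ z ^ j) :=
          r.continuous.norm.mul (continuous_const.mul ((continuous_rootBound Φ).pow j))
        have h4 := hc.tendsto z
        rw [hz, norm_zero, zero_mul] at h4
        rw [ContinuousAt, hz, zero_mul]
        exact squeeze_zero_norm hb h4
    · exact hgood z hz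
  · exact (polyGrowth_eval r).mul ((polyGrowth_const _).mul ((polyGrowth_rootBound Φ).pow hrb j)
      (fun _ => by positivity) fun z => pow_nonneg (hrb z) j) (fun _ => norm_nonneg _)
      fun z => mul_nonneg (by positivity) (pow_nonneg (hrb z) j)

/-- The two-variable divided difference of `Φ (z, ·)`. -/
def divDiff (Φ : ℂ[X][Y]) (z a b : ℂ) : ℂ :=
  ∑ i ∈ Finset.range (Φ.natDegree + 1), (Φ.coeff i).eval z *
    ∑ k ∈ Finset.range i, a ^ k * b ^ (i - 1 - k)

theorem evalEval_eq_sum (Φ : ℂ[X][Y]) (z a : ℂ) : Φ.evalEval z a =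
    ∑ i ∈ Finset.range (Φ.natDegree + 1), (Φ.coeff i).eval z * a ^ i := by
  conv_lhs => rw [Φ.as_sum_range_C_mul_X_pow]
  simp [evalEval_finsetSum, evalEval_mul, evalEval_pow, evalEval_C]

theorem divDiff_mul_sub (Φ : ℂ[X][Y]) (z a b : ℂ) :
    divDiff Φ z a b * (a - b) = Φ.evalEval z a - Φ.evalEval z b := by
  rw [evalEval_eq_sum, evalEval_eq_sum, divDiff, Finset.sum_mul, ← Finset.sum_sub_distrib]
  refine Finset.sum_congr rfl fun i _ => ?_
  rw [mul_assoc, (Commute.all a b).geom_sum₂_mul, mul_sub]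

theorem divDiff_self (Φ : ℂ[X][Y]) (z a : ℂ) :
    divDiff Φ z a a = Φ.derivative.evalEval z a := by
  have h : Φ.derivative.evalEval z a = ∑ i ∈ Finset.range (Φ.natDegree + 1),
      (Φ.coeff i).eval z * (i * a ^ (i - 1)) := by
    conv_lhs => rw [Φ.as_sum_range_C_mul_X_pow]
    simp [evalEval_finsetSum, evalEval_mul, evalEval_pow, evalEval_C, derivative_X_pow]
  rw [h, divDiff]
  refine Finset.sum_congr rfl fun i _ => ?_
  rw [geom_sum₂_self]

/-- The curve is connected. For a clopen set `U`, interpolation of the indicator function of `U`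
at the values of `ν` has numerator `W`, whose coefficients are polynomials in `z` because they are
entire of polynomial growth. Then `W (W - r Φ')` vanishes on the curve, hence one of its factors
does. -/
theorem connectedSpace (hΦ : Φ.Monic) (hν : aeval ν Φ = 0)
    (hfrac : ∀ b : B, ∃ d : ℂ[X], d ≠ 0 ∧ ∃ q : ℂ[X][Y], algebraMap ℂ[X] B d * b = aeval ν q)
    {r : ℂ[X]} (hr : r ≠ 0)
    (hs : ∀ z, r.eval z ≠ 0 → ∀ y, Φ.evalEval z y = 0 → Φ.derivative.evalEval z y ≠ 0) :
    ConnectedSpace (CurvePoint B) := by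
  have hne : Nonempty (CurvePoint B) := ⟨(exists_proj_eq 0).choose⟩
  have hpre : PreconnectedSpace (CurvePoint B) := by
    rw [preconnectedSpace_iff_clopen]
    intro U hU
    choose c hc using exists_polynomial_powerSum hΦ hν hfrac hs hU
    set W : ℂ[X][Y] := ∑ i ∈ Finset.range (Φ.natDegree + 1), C (Φ.coeff i) *
      ∑ k ∈ Finset.range i, C (c (i - 1 - k)) * X ^ k with hW
    have hroot : ∀ P : CurvePoint B, Φ.evalEval P.proj (P ν) = 0 := fun P => by
      rw [← apply_aeval, hν, map_zero]
    have hWeval : ∀ P : CurvePoint B, r.eval P.proj ≠ 0 → P (aeval ν W) =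
        r.eval P.proj * ∑ᶠ Q ∈ {Q : CurvePoint B | Q.proj = P.proj} ∩ U,
          divDiff Φ P.proj (P ν) (Q ν) := by
      intro P hP
      have hFU : ({Q : CurvePoint B | Q.proj = P.proj} ∩ U).Finite :=
        (finite_fiber _).subset Set.inter_subset_left
      rw [apply_aeval, hW, finsum_mem_eq_finite_toFinset_sum _ hFU]
      simp only [evalEval_finsetSum, evalEval_mul, evalEval_C, evalEval_pow, evalEval_X, hc,
        powerSum, finsum_mem_eq_finite_toFinset_sum _ hFU, divDiff, Finset.mul_sum,
        Finset.sum_mul]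
      rw [Finset.sum_comm (s := hFU.toFinset)]
      refine Finset.sum_congr rfl fun i _ => ?_
      rw [Finset.sum_comm]
      refine Finset.sum_congr rfl fun Q _ => Finset.sum_congr rfl fun k _ => ?_
      ring
    have hdiff : ∀ P Q : CurvePoint B, r.eval P.proj ≠ 0 → Q.proj = P.proj → Q ≠ P →
        divDiff Φ P.proj (P ν) (Q ν) = 0 := by
      intro P Q hP hQ hQP
      have h1 := divDiff_mul_sub Φ P.proj (P ν) (Q ν)
      have h2 := hroot Q
      rw [hQ] at h2
      rw [hroot P, h2, sub_zero] at h1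
      refine (mul_eq_zero.mp h1).resolve_right fun h3 => hQP ?_
      exact eq_of_simple_root hν (hs _ hP _ (hroot P)) hfrac hQ (sub_eq_zero.mp h3).symm
    have hin : ∀ P : CurvePoint B, r.eval P.proj ≠ 0 → P ∈ U →
        P (aeval ν W) = r.eval P.proj * Φ.derivative.evalEval P.proj (P ν) := by
      intro P hP hPU
      have hFU : ({Q : CurvePoint B | Q.proj = P.proj} ∩ U).Finite :=
        (finite_fiber _).subset Set.inter_subset_left
      rw [hWeval P hP, ← divDiff_self, finsum_mem_eq_finite_toFinset_sum _ hFU,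
        Finset.sum_eq_single_of_mem P (hFU.mem_toFinset.mpr ⟨rfl, hPU⟩)]
      exact fun Q hQ hQP => hdiff P Q hP (hFU.mem_toFinset.mp hQ).1 hQP
    have hout : ∀ P : CurvePoint B, r.eval P.proj ≠ 0 → P ∉ U → P (aeval ν W) = 0 := by
      intro P hP hPU
      rw [hWeval P hP, finsum_mem_eq_zero_of_forall_eq_zero, mul_zero]
      rintro Q ⟨hQ, hQU⟩
      exact hdiff P Q hP hQ fun h => hPU (h ▸ hQU)
    have hprod : aeval ν W * aeval ν (W - C r * Φ.derivative) = 0 := by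
      refine eq_zero_of_forall_apply hr fun P hP => ?_
      rw [map_mul]
      by_cases hPU : P ∈ U
      · rw [map_sub, map_sub, hin P hP hPU, map_mul, map_mul, apply_aeval P ν Φ.derivative, aeval_C,
          apply_algebraMap, sub_self, mul_zero]
      · rw [hout P hP hPU, zero_mul]
    rcases mul_eq_zero.mp hprod with h | h
    · left
      by_contra hne
      obtain ⟨P, hPU, hP⟩ := exists_mem_of_isOpen hU.isOpen (Set.nonempty_iff_ne_empty.mpr hne) hr
      have h1 := hin P hP hPU
      rw [h, map_zero] at h1
      exact mul_ne_zero hP (hs _ hP _ (hroot P)) h1.symm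
    · right
      by_contra hne
      obtain ⟨P, hPU, hP⟩ := exists_mem_of_isOpen hU.compl.isOpen
        (Set.nonempty_compl.mpr hne) hr
      have h1 := hout P hP hPU
      rw [map_sub, sub_eq_zero, map_mul, aeval_C] at h
      rw [h, map_mul, apply_algebraMap, apply_aeval] at h1
      exact mul_ne_zero hP (hs _ hP _ (hroot P)) h1
  exact { hpre with toNonempty := hne }

end CurvePoint

/-! ### The Riemann surface of an irreducible polynomial -/

/-- Two polynomials in `y` which are coprime over the field of rational functions in `z` have a
common root only over finitely many `z`. -/
theorem exists_ne_zero_of_isCoprime_map {f g : ℂ[X][Y]} (hf : f.Monic)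
    (h : IsCoprime (f.map (algebraMap ℂ[X] (FractionRing ℂ[X])))
      (g.map (algebraMap ℂ[X] (FractionRing ℂ[X])))) :
    ∃ r : ℂ[X], r ≠ 0 ∧ ∀ z, r.eval z ≠ 0 → ∀ y, f.evalEval z y = 0 → g.evalEval z y ≠ 0 := by
  by_cases hd : f.natDegree = 0
  · refine ⟨1, one_ne_zero, fun z _ y hy => ?_⟩
    rw [hf.natDegree_eq_zero.mp hd, evalEval_one] at hy
    exact absurd hy one_ne_zero
  · have hinj := IsFractionRing.injective ℂ[X] (FractionRing ℂ[X])
    refine ⟨f.resultant g, fun h0 => resultant_ne_zero _ _ h ?_, fun z hz y hy hy' => hz ?_⟩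
    · rw [hf.natDegree_map, natDegree_map_eq_of_injective hinj, resultant_map_map, h0, map_zero]
    · obtain ⟨a, b, -, -, hab⟩ :=
        exists_mul_add_mul_eq_C_resultant f g le_rfl le_rfl (Or.inl hd)
      have h1 := congrArg (evalEval z y) hab
      rw [evalEval_add, evalEval_mul, evalEval_mul, hy, hy', evalEval_C, zero_mul, zero_mul,
        add_zero] at h1
      exact h1.symm

/-- All roots of `Φ (z, ·)` are simple. -/
def SimpleRootsAt (Φ : ℂ[X][Y]) (z : ℂ) : Prop :=
  ∀ y, Φ.evalEval z y = 0 → Φ.derivative.evalEval z y ≠ 0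

theorem SimpleRootsAt.nodup_roots {Φ : ℂ[X][Y]} (hΦ : Φ.Monic) {z : ℂ} (h : SimpleRootsAt Φ z) :
    (Φ.map (evalRingHom z)).roots.Nodup := by
  classical
  have hm := hΦ.map (evalRingHom z)
  rw [Multiset.nodup_iff_count_le_one]
  intro y
  rw [count_roots]
  by_contra! hlt
  obtain ⟨h1, h2⟩ := (one_lt_rootMultiplicity_iff_isRoot hm.ne_zero).mp hlt
  rw [IsRoot.def, derivative_map, map_evalRingHom_eval] at h2
  rw [IsRoot.def, map_evalRingHom_eval] at h1
  exact h y h1 h2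

namespace CurvePoint

variable {B : Type} [CommRing B] [Algebra ℂ B] [Algebra ℂ[X] B] [IsScalarTower ℂ ℂ[X] B]
  [IsDomain B] [Module.Finite ℂ[X] B] [FaithfulSMul ℂ[X] B] {ν : B} {Φ : ℂ[X][Y]}

theorem image_fiber (hν : minpoly ℂ[X] ν = Φ) (z : ℂ) :
    (fun P : CurvePoint B => P ν) '' {P | P.proj = z} = {y | Φ.evalEval z y = 0} := by
  ext y
  constructor
  · rintro ⟨P, rfl, rfl⟩
    rw [Set.mem_ofPred_eq, ← apply_aeval, ← hν, minpoly.aeval, map_zero]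
  · intro hy
    obtain ⟨P, hP, hPν⟩ := exists_point ν (z := z) (y := y) (by rw [hν]; exact hy)
    exact ⟨P, hP, hPν⟩

theorem injOn_fiber (hν : aeval ν Φ = 0)
    (hfrac : ∀ b : B, ∃ d : ℂ[X], d ≠ 0 ∧ ∃ q : ℂ[X][Y], algebraMap ℂ[X] B d * b = aeval ν q)
    {z : ℂ} (hs : SimpleRootsAt Φ z) :
    Set.InjOn (fun P : CurvePoint B => P ν) {P | P.proj = z} := by
  rintro P hP Q rfl hPQ
  refine eq_of_simple_root hν (hs _ ?_) hfrac hP hPQ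
  rw [← apply_aeval, hν, map_zero]

theorem encard_fiber (hΦ : Φ.Monic) (hν : minpoly ℂ[X] ν = Φ)
    (hfrac : ∀ b : B, ∃ d : ℂ[X], d ≠ 0 ∧ ∃ q : ℂ[X][Y], algebraMap ℂ[X] B d * b = aeval ν q)
    {z : ℂ} (hs : SimpleRootsAt Φ z) :
    {P : CurvePoint B | P.proj = z}.encard = Φ.natDegree := by
  classical
  have hν' : aeval ν Φ = 0 := by rw [← hν, minpoly.aeval]
  have hm := hΦ.map (evalRingHom z)
  rw [← (injOn_fiber hν' hfrac hs).encard_image, image_fiber hν]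
  have h1 : {y | Φ.evalEval z y = 0} = ((Φ.map (evalRingHom z)).roots.toFinset : Set ℂ) := by
    ext y
    simp [hm.ne_zero, map_evalRingHom_eval]
  rw [h1, Set.encard_coe_eq_coe_finsetCard,
    Multiset.toFinset_card_of_nodup (hs.nodup_roots hΦ),
    ← (IsAlgClosed.splits _).natDegree_eq_card_roots, hΦ.natDegree_map]

theorem exists_injOn_nhds (hν : aeval ν Φ = 0)
    (hfrac : ∀ b : B, ∃ d : ℂ[X], d ≠ 0 ∧ ∃ q : ℂ[X][Y], algebraMap ℂ[X] B d * b = aeval ν q)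
    {P : CurvePoint B} (hs : SimpleRootsAt Φ P.proj) :
    ∃ U ∈ 𝓝 P, Set.InjOn (proj : CurvePoint B → ℂ) U := by
  have hP : Φ.evalEval P.proj (P ν) = 0 := by rw [← apply_aeval, hν, map_zero]
  obtain ⟨e, he, hc⟩ := (uniformizes_of_simple_root hν (hs _ hP) hfrac).exists_chart
  refine ⟨e.source, e.open_source.mem_nhds he, fun Q hQ R hR hQR => e.injOn hQ hR ?_⟩
  rw [hc.apply_eq, hc.apply_eq, apply_algebraMap, apply_algebraMap, hQR]

end CurvePoint

/-- The Riemann surface of an irreducible monic polynomial: the `ℂ`-points of the normalization of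
the plane curve `Φ = 0`. -/
theorem exists_functionOnCover {Φ : ℂ[X][Y]} (hΦ : Φ.Monic) (hirr : Irreducible Φ) :
    ∃ S : FunctionOnCover, (∀ z, S.fn '' S.fiber z = {y | Φ.evalEval z y = 0}) ∧
      S.HasSheets Φ.natDegree ∧ {z : ℂ | ¬ Set.InjOn S.fn (S.fiber z)}.Finite ∧
      ∀ z, SimpleRootsAt Φ z → ¬ S.IsBranchPoint z := by
  let K := FractionRing ℂ[X]
  have hirrK : Irreducible (Φ.map (algebraMap ℂ[X] K)) :=
    (Monic.irreducible_iff_irreducible_map_fraction_map hΦ).mp hirr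
  have : Fact (Irreducible (Φ.map (algebraMap ℂ[X] K))) := ⟨hirrK⟩
  obtain ⟨r, hr, hs⟩ := exists_ne_zero_of_isCoprime_map (f := Φ) (g := Φ.derivative) hΦ (by
    rw [← derivative_map]
    exact hirrK.separable)
  have hgood : {z : ℂ | ¬ SimpleRootsAt Φ z}.Finite := by
    refine (Multiset.finite_toSet r.roots).subset fun z hz => (mem_roots hr).mpr ?_
    by_contra h
    exact hz (hs z h)
  let L := AdjoinRoot (Φ.map (algebraMap ℂ[X] K))
  have hfin : FiniteDimensional K L := (AdjoinRoot.powerBasis hirrK.ne_zero).finite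
  let B := integralClosure ℂ[X] L
  have : Module.Finite ℂ[X] B := IsIntegralClosure.finite ℂ[X] K L B
  have : IsDedekindDomain B := integralClosure.isDedekindDomain ℂ[X] K L
  have hinjL : Function.Injective (algebraMap ℂ[X] L) := by
    rw [IsScalarTower.algebraMap_eq ℂ[X] K L]
    exact (algebraMap K L).injective.comp (IsFractionRing.injective ℂ[X] K)
  have : FaithfulSMul ℂ[X] B := (faithfulSMul_iff_algebraMap_injective ℂ[X] B).mpr (by
    refine Function.Injective.of_comp (f := algebraMap B L) ?_
    rw [← RingHom.coe_comp, ← IsScalarTower.algebraMap_eq ℂ[X] B L]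
    exact hinjL)
  have hroot : aeval (AdjoinRoot.root (Φ.map (algebraMap ℂ[X] K))) Φ = 0 := by
    rw [← aeval_map_algebraMap K, AdjoinRoot.aeval_eq, AdjoinRoot.mk_self]
  let ν : B := ⟨AdjoinRoot.root _, Φ, hΦ, hroot⟩
  have hcoe : ∀ q : ℂ[X][Y], ((aeval ν q : B) : L) = aeval (AdjoinRoot.root _) q := fun q =>
    (Subalgebra.aeval_coe B ν q).symm
  have hν' : aeval ν Φ = 0 := Subtype.ext (by rw [hcoe, hroot]; rfl)
  have hint : IsIntegral ℂ[X] ν := ⟨Φ, hΦ, hν'⟩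
  have hν : minpoly ℂ[X] ν = Φ := by
    obtain ⟨q, hq⟩ := minpoly.isIntegrallyClosed_dvd hint hν'
    have hu := (hirr.isUnit_or_isUnit hq).resolve_left (minpoly.not_isUnit ℂ[X] ν)
    exact eq_of_monic_of_associated (minpoly.monic hint) hΦ ⟨hu.unit, hq.symm⟩
  have hfrac : ∀ b : B, ∃ d : ℂ[X], d ≠ 0 ∧ ∃ q : ℂ[X][Y],
      algebraMap ℂ[X] B d * b = aeval ν q := by
    intro b
    obtain ⟨p, hp⟩ := AdjoinRoot.mk_surjective (b : L)
    obtain ⟨d, hd0, hd⟩ := IsLocalization.integerNormalization_spec (S := K)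
      (nonZeroDivisors ℂ[X]) p
    refine ⟨d, nonZeroDivisors.ne_zero hd0, IsLocalization.integerNormalization (nonZeroDivisors ℂ[X]) p,
      Subtype.ext ?_⟩
    rw [hcoe, ← aeval_map_algebraMap K, hd, ← algebraMap_smul K d p, map_smul,
      AdjoinRoot.aeval_eq, hp, algebraMap_smul]
    exact (Algebra.smul_def d (b : L)).symm
  have := CurvePoint.connectedSpace hΦ hν' hfrac hr hs
  let S : FunctionOnCover :=
    { carrier := CurvePoint B
      proj := CurvePoint.proj
      proj_holomorphic := CurvePoint.mdifferentiable_apply _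
      proj_proper := CurvePoint.isProperMap_proj
      fn := fun P => P ν
      fn_holomorphic := CurvePoint.mdifferentiable_apply _ }
  refine ⟨S, CurvePoint.image_fiber hν, hgood.subset fun z hz h => hz ?_,
    hgood.subset fun z hz h => hz ?_, ?_⟩
  · exact CurvePoint.encard_fiber hΦ hν hfrac h
  · exact CurvePoint.injOn_fiber hν' hfrac h
  · rintro z hz ⟨P, rfl, hP⟩
    obtain ⟨U, hU, hinj⟩ := CurvePoint.exists_injOn_nhds hν' hfrac hz
    exact hP U hU hinj

/-! ### Symplectic matrices and palindromic polynomials -/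

namespace Matrix

theorem charpoly_reverse_of_mem_symplecticGroup {m : ℕ}
    {N : Matrix (Fin m ⊕ Fin m) (Fin m ⊕ Fin m) ℂ} (hN : N ∈ symplecticGroup (Fin m) ℂ) :
    N.charpoly.reverse = N.charpoly := by
  have hdet := SymplecticGroup.det_eq_one hN
  have hu : IsUnit N := (isUnit_iff_isUnit_det N).mpr (by rw [hdet]; exact isUnit_one)
  have h1 := charpoly_inv N hu
  rw [hdet, Ring.inverse_one, map_one, mul_one, Fintype.card_sum,
    Even.neg_one_pow ⟨_, rfl⟩, one_mul, SymplecticGroup.inv_eq_symplectic_inv N hN,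
    charpoly_mul_comm, ← mul_assoc, mul_neg, J_squared, neg_neg, one_mul, charpoly_transpose] at h1
  rw [reverse_charpoly, ← h1]

theorem coeff_charpoly_of_mem_symplecticGroup {m : ℕ}
    {N : Matrix (Fin m ⊕ Fin m) (Fin m ⊕ Fin m) ℂ} (hN : N ∈ symplecticGroup (Fin m) ℂ)
    {i j : ℕ} (hij : i + j = 2 * m) : N.charpoly.coeff i = N.charpoly.coeff j := by
  have hd : N.charpoly.natDegree = 2 * m := by
    rw [charpoly_natDegree_eq_dim, Fintype.card_sum, Fintype.card_fin, two_mul]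
  conv_lhs => rw [← charpoly_reverse_of_mem_symplecticGroup hN]
  rw [coeff_reverse, hd, revAt_le (by omega)]
  congr 1
  omega

end Matrix

/-- If `c` has degree `2 * m` and is palindromic, then `c = (2 * Y) ^ m * F ((Y + Y⁻¹) / 2)` for a
polynomial `F` of degree `m`, which is written here in terms of the Chebyshev polynomials. -/
def foldPalindromic (m : ℕ) (c : ℂ[X][Y]) : ℂ[X][Y] :=
  C (C ((2 : ℂ)⁻¹ ^ m)) * (C (c.coeff m) + ∑ k ∈ Finset.range m,
    C (c.coeff (m + (k + 1))) * (2 * Chebyshev.T ℂ (k + 1 : ℕ)).map C)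

/-- The Chebyshev polynomials express `t ^ n + t⁻¹ ^ n` through `(t + t⁻¹) / 2`. -/
theorem chebyshev_T_eval_add_inv {t : ℂ} (ht : t ≠ 0) (n : ℕ) :
    2 * (Chebyshev.T ℂ n).eval ((t + t⁻¹) / 2) = t ^ n + t⁻¹ ^ n := by
  have h := dickson_one_one_eval_add_inv t t⁻¹ (mul_inv_cancel₀ ht) n
  rw [dickson_one_one_eq_chebyshev_C] at h
  have h2 := congrArg (eval ((t + t⁻¹) / 2)) (Chebyshev.C_comp_two_mul_X ℂ n)
  rw [eval_comp, eval_mul, eval_mul, eval_X, eval_ofNat, mul_div_cancel₀ _ two_ne_zero, h] at h2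
  exact h2.symm

theorem eval_eq_mul_of_palindromic {m : ℕ} {c : ℂ[X]} (hd : c.natDegree ≤ 2 * m)
    (hc : ∀ i j, i + j = 2 * m → c.coeff i = c.coeff j) {t : ℂ} (ht : t ≠ 0) :
    c.eval t = t ^ m * (c.coeff m +
      ∑ k ∈ Finset.range m, c.coeff (m + (k + 1)) * (t ^ (k + 1) + t⁻¹ ^ (k + 1))) := by
  rw [eval_eq_sum_range' (show c.natDegree < m + 1 + m by omega), Finset.sum_range_add,
    Finset.sum_range_succ, ← Finset.sum_range_reflect, mul_add, Finset.mul_sum]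
  have h1 : ∀ k ∈ Finset.range m, c.coeff (m - 1 - k) * t ^ (m - 1 - k)
      = t ^ m * (c.coeff (m + (k + 1)) * t⁻¹ ^ (k + 1)) := by
    intro k hk
    have hk := Finset.mem_range.mp hk
    rw [hc (m - 1 - k) (m + (k + 1)) (by omega)]
    have h2 : t ^ m = t ^ (m - 1 - k) * t ^ (k + 1) := by rw [← pow_add]; congr 1; omega
    rw [h2, inv_pow]
    field_simp
  have h2 : ∀ k ∈ Finset.range m, c.coeff (m + 1 + k) * t ^ (m + 1 + k)
      = t ^ m * (c.coeff (m + (k + 1)) * t ^ (k + 1)) := by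
    intro k _
    rw [show m + 1 + k = m + (k + 1) by ring, pow_add]
    ring
  rw [Finset.sum_congr rfl h1, Finset.sum_congr rfl h2]
  simp only [mul_add, Finset.sum_add_distrib]
  ring

theorem evalEval_foldPalindromic (m : ℕ) (c : ℂ[X][Y]) (z : ℂ) {t : ℂ} (ht : t ≠ 0) :
    (foldPalindromic m c).evalEval z ((t + t⁻¹) / 2) = 2⁻¹ ^ m * ((c.coeff m).eval z +
      ∑ k ∈ Finset.range m, (c.coeff (m + (k + 1))).eval z * (t ^ (k + 1) + t⁻¹ ^ (k + 1))) := by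
  simp only [foldPalindromic, evalEval_mul, evalEval_add, evalEval_C, evalEval_finsetSum,
    evalEval_map_C, eval_C, eval_mul, eval_ofNat, chebyshev_T_eval_add_inv ht]

theorem foldPalindromic_monic_natDegree {m : ℕ} (hm : 1 ≤ m) {c : ℂ[X][Y]}
    (hc : c.coeff (2 * m) = 1) :
    (foldPalindromic m c).Monic ∧ (foldPalindromic m c).natDegree = m := by
  obtain ⟨n, rfl⟩ : ∃ n, m = n + 1 := ⟨m - 1, by omega⟩
  have h2 : (2 : ℂ[X]) = C 2 := rfl
  have hdeg : ∀ k : ℕ, (2 * Chebyshev.T ℂ (k + 1 : ℕ)).natDegree = k + 1 := fun k => by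
    rw [h2, natDegree_C_mul two_ne_zero, Chebyshev.natDegree_T, Int.natAbs_natCast]
  have hlead : (2 * Chebyshev.T ℂ (n + 1 : ℕ)).coeff (n + 1) = 2 ^ (n + 1) := by
    have h3 := Chebyshev.leadingCoeff_T (R := ℂ) (n + 1 : ℕ)
    rw [leadingCoeff, Chebyshev.natDegree_T, Int.natAbs_natCast] at h3
    rw [h2, coeff_C_mul, h3, pow_succ', Nat.add_sub_cancel]
  have hle : (foldPalindromic (n + 1) c).natDegree ≤ n + 1 := by
    refine (natDegree_C_mul_le _ _).trans (natDegree_add_le_of_degree_le (by simp) ?_)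
    refine natDegree_sum_le_of_forall_le _ _ fun k hk => ?_
    refine (natDegree_C_mul_le _ _).trans (natDegree_map_le.trans ?_)
    have := Finset.mem_range.mp hk
    rw [hdeg]
    omega
  have hcoeff : (foldPalindromic (n + 1) c).coeff (n + 1) = 1 := by
    rw [foldPalindromic, coeff_C_mul, coeff_add, finsetSum_coeff, Finset.sum_range_succ,
      Finset.sum_eq_zero, coeff_C_of_ne_zero (by omega), zero_add, zero_add, coeff_C_mul, coeff_map,
      hlead, ← two_mul, hc, one_mul, ← C_mul, inv_pow, inv_mul_cancel₀ (pow_ne_zero _ two_ne_zero), C_1]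
    intro k hk
    have := Finset.mem_range.mp hk
    rw [coeff_C_mul, coeff_map,
      coeff_eq_zero_of_natDegree_lt (p := 2 * Chebyshev.T ℂ _) (by rw [hdeg]; omega), map_zero,
      mul_zero]
  have hmon := monic_of_natDegree_le_of_coeff_eq_one _ hle hcoeff
  refine ⟨hmon, le_antisymm hle ?_⟩
  by_contra! h
  rw [coeff_eq_zero_of_natDegree_lt h] at hcoeff
  exact zero_ne_one hcoeff

/-! ### The monodromy matrix and the Lyapunov polynomial -/

namespace PeriodicJacobi

variable {m p : ℕ} (J : PeriodicJacobi m p)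

theorem isUnit_det_aC (n : ℤ) : IsUnit (J.aC n).det := by
  have h : (J.aC n).det = Complex.ofReal ((J.a n).det) :=
    (RingHom.map_det Complex.ofRealHom (J.a n)).symm
  rw [h]
  exact (Complex.ofReal_ne_zero.mpr (J.det_a_ne_zero _)).isUnit

theorem bC_transpose (n : ℤ) : (J.bC n).transpose = J.bC n := by
  rw [bC, ← Matrix.transpose_map, J.b_symm]

theorem aC_natCast_self : J.aC p = J.aC 0 := by simpa using J.aC_periodic 0

theorem isUnit_P₀ : IsUnit J.P₀.det := by
  rw [P₀, Matrix.det_fromBlocks_zero₁₂, Matrix.det_transpose, Matrix.det_one, mul_one]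
  exact J.isUnit_det_aC 0

/-- The matrix that carries `((a n)ᵀ * y n, y (n + 1))` to
`((a (n + 1))ᵀ * y (n + 1), y (n + 2))` for a solution `y`. -/
def transfer (z : ℂ) (n : ℕ) : Matrix (Fin m ⊕ Fin m) (Fin m ⊕ Fin m) ℂ :=
  Matrix.fromBlocks 0 (J.aC (n + 1)).transpose (-(J.aC (n + 1))⁻¹)
    ((J.aC (n + 1))⁻¹ * (z • 1 - J.bC (n + 1)))

theorem transfer_mem_symplecticGroup (z : ℂ) (n : ℕ) :
    J.transfer z n ∈ Matrix.symplecticGroup (Fin m) ℂ := by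
  have h := J.isUnit_det_aC (n + 1)
  rw [transfer, SymplecticGroup.fromBlocks_mem_iff]
  refine ⟨by simp, ?_, ?_⟩
  · rw [Matrix.transpose_transpose, Matrix.mul_nonsing_inv_cancel_left _ _ h,
      Matrix.transpose_mul, mul_assoc, ← Matrix.transpose_mul, Matrix.mul_nonsing_inv _ h,
      Matrix.transpose_one, mul_one, Matrix.transpose_sub, Matrix.transpose_smul,
      Matrix.transpose_one, bC_transpose]
  · rw [Matrix.transpose_zero, zero_mul, zero_sub, Matrix.transpose_neg, neg_mul, neg_neg,
      ← Matrix.transpose_mul, Matrix.mul_nonsing_inv _ h, Matrix.transpose_one]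

/-- The matrices with the columns `((a n)ᵀ * y n, y (n + 1))` for the columns `y` of the
fundamental solutions. -/
def fundamental (z : ℂ) (n : ℕ) : Matrix (Fin m ⊕ Fin m) (Fin m ⊕ Fin m) ℂ :=
  Matrix.fromBlocks (J.aC n).transpose 0 0 1 *
    Matrix.fromBlocks (J.theta z n) (J.phi z n) (J.theta z (n + 1)) (J.phi z (n + 1))

theorem fundamental_succ (z : ℂ) (n : ℕ) :
    J.fundamental z (n + 1) = J.transfer z n * J.fundamental z n := by
  have key : ∀ Y0 Y1, J.matSol z Y0 Y1 (n + 1 + 1) =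
      -(J.aC (n + 1))⁻¹ * ((J.aC n).transpose * J.matSol z Y0 Y1 n)
      + (J.aC (n + 1))⁻¹ * (z • 1 - J.bC (n + 1)) * J.matSol z Y0 Y1 (n + 1) := by
    intro Y0 Y1
    rw [matSol]
    noncomm_ring
  simp only [fundamental, transfer, Matrix.fromBlocks_multiply, zero_mul, zero_add, add_zero,
    one_mul, theta, phi, key, Nat.cast_add, Nat.cast_one]

theorem fundamental_zero (z : ℂ) : J.fundamental z 0 = J.P₀ := by
  simp [fundamental, P₀, theta, phi, matSol]

theorem M_eq (z : ℂ) : J.M z = J.fundamental z p * J.P₀⁻¹ := by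
  rw [M, P₀, monodromy, fundamental, aC_natCast_self]

theorem M_mem_symplecticGroup (z : ℂ) : J.M z ∈ Matrix.symplecticGroup (Fin m) ℂ := by
  rw [M_eq]
  suffices h : ∀ n, J.fundamental z n * J.P₀⁻¹ ∈ Matrix.symplecticGroup (Fin m) ℂ from h p
  intro n
  induction n with
  | zero =>
    rw [fundamental_zero, Matrix.mul_nonsing_inv _ J.isUnit_P₀]
    exact one_mem _
  | succ n ih =>
    rw [fundamental_succ, mul_assoc]
    exact mul_mem (J.transfer_mem_symplecticGroup z n) ih

/-- The values of `matSol` as polynomials in the spectral parameter. -/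
def polySol (Y0 Y1 : Matrix (Fin m) (Fin m) ℂ[X]) : ℕ → Matrix (Fin m) (Fin m) ℂ[X]
  | 0 => Y0
  | 1 => Y1
  | n + 2 => (J.aC (n + 1))⁻¹.map C *
      (((X : ℂ[X]) • (1 : Matrix (Fin m) (Fin m) ℂ[X]) - (J.bC (n + 1)).map C)
          * polySol Y0 Y1 (n + 1)
        - (J.aC n).transpose.map C * polySol Y0 Y1 n)

theorem map_polySol (z : ℂ) (Y0 Y1 : Matrix (Fin m) (Fin m) ℂ[X]) (n : ℕ) :
    (J.polySol Y0 Y1 n).map (evalRingHom z) =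
      J.matSol z (Y0.map (evalRingHom z)) (Y1.map (evalRingHom z)) n := by
  induction n using Nat.twoStepInduction with
  | zero => rfl
  | one => rfl
  | more n ih1 ih2 =>
    have hC : ∀ B : Matrix (Fin m) (Fin m) ℂ, (B.map C).map (evalRingHom z) = B := fun B => by
      ext i j; simp
    have hX : ((X : ℂ[X]) • (1 : Matrix (Fin m) (Fin m) ℂ[X])).map (evalRingHom z)
        = z • (1 : Matrix (Fin m) (Fin m) ℂ) := by
      ext i j
      by_cases h : i = j <;> simp [h]
    rw [polySol, matSol, Matrix.map_mul, Matrix.map_sub _ (map_sub _), Matrix.map_mul,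
      Matrix.map_mul, Matrix.map_sub _ (map_sub _), hC, hC, hC, hX, ih1, ih2]

/-- The monodromy matrix as a matrix of polynomials in the spectral parameter. -/
def polyMonodromy : Matrix (Fin m ⊕ Fin m) (Fin m ⊕ Fin m) ℂ[X] :=
  Matrix.fromBlocks (J.polySol 1 0 p) (J.polySol 0 1 p) (J.polySol 1 0 (p + 1))
    (J.polySol 0 1 (p + 1))

theorem map_polyMonodromy (z : ℂ) : J.polyMonodromy.map (evalRingHom z) = J.monodromy z := by
  simp only [polyMonodromy, monodromy, Matrix.fromBlocks_map, map_polySol, theta, phi]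
  rw [Matrix.map_one _ (map_zero _) (map_one _), Matrix.map_zero _ (map_zero _)]

theorem charpoly_M (z : ℂ) : (J.M z).charpoly = (J.monodromy z).charpoly := by
  rw [M, Matrix.charpoly_mul_comm, ← mul_assoc, Matrix.nonsing_inv_mul _ J.isUnit_P₀, one_mul]

theorem charpoly_polyMonodromy (z : ℂ) :
    J.polyMonodromy.charpoly.map (evalRingHom z) = (J.M z).charpoly := by
  rw [charpoly_M, ← map_polyMonodromy, Matrix.charpoly_map]

theorem natDegree_charpoly_M (z : ℂ) : (J.M z).charpoly.natDegree = 2 * m := by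
  rw [Matrix.charpoly_natDegree_eq_dim, Fintype.card_sum, Fintype.card_fin, two_mul]

theorem D_eq_eval_charpoly (z t : ℂ) : J.D z t = (J.M z).charpoly.eval t := by
  rw [D, Matrix.eval_charpoly, ← neg_sub, Matrix.det_neg, Fintype.card_sum,
    Even.neg_one_pow ⟨_, rfl⟩, one_mul, Matrix.smul_one_eq_diagonal]
  rfl

/-- The polynomial whose roots are the Lyapunov functions. -/
def lyapunovPoly : ℂ[X][Y] := foldPalindromic m J.polyMonodromy.charpoly

theorem lyapunovPoly_monic_natDegree : J.lyapunovPoly.Monic ∧ J.lyapunovPoly.natDegree = m := by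
  refine foldPalindromic_monic_natDegree J.m_pos ?_
  have h := Matrix.charpoly_natDegree_eq_dim J.polyMonodromy
  rw [Fintype.card_sum, Fintype.card_fin, ← two_mul] at h
  rw [← h]
  exact Matrix.charpoly_monic _

/-- The relation between the multipliers `t` and the Lyapunov functions `(t + t⁻¹) / 2`. -/
theorem eval_charpoly_M (z : ℂ) {t : ℂ} (ht : t ≠ 0) :
    (J.M z).charpoly.eval t = (2 * t) ^ m * J.lyapunovPoly.evalEval z ((t + t⁻¹) / 2) := by
  rw [eval_eq_mul_of_palindromic (J.natDegree_charpoly_M z).le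
    (fun i j h => Matrix.coeff_charpoly_of_mem_symplecticGroup (J.M_mem_symplecticGroup z) h) ht,
    lyapunovPoly, evalEval_foldPalindromic _ _ _ ht, ← charpoly_polyMonodromy]
  simp only [coeff_map, coe_evalRingHom]
  rw [mul_pow, inv_pow]
  field_simp

end PeriodicJacobi

/-- Every number is of the form `(t + t⁻¹) / 2` with `1 ≤ ‖t‖`. -/
theorem exists_add_inv_div_two_eq (d : ℂ) : ∃ t : ℂ, 1 ≤ ‖t‖ ∧ d = (t + t⁻¹) / 2 := by
  obtain ⟨s, hs⟩ := IsAlgClosed.exists_pow_nat_eq (d ^ 2 - 1) (n := 2) two_pos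
  have h1 : (d + s) * (d - s) = 1 := by linear_combination -hs
  have h2 : d + s ≠ 0 := left_ne_zero_of_mul_eq_one h1
  have h3 : (d + s)⁻¹ = d - s := inv_eq_of_mul_eq_one_right h1
  have h4 : (d - s)⁻¹ = d + s := inv_eq_of_mul_eq_one_left h1
  rcases le_total 1 ‖d + s‖ with h | h
  · exact ⟨d + s, h, by rw [h3]; ring⟩
  · refine ⟨d - s, ?_, by rw [h4]; ring⟩
    rw [← h3, norm_inv]
    exact (one_le_inv₀ (norm_pos_iff.mpr h2)).mpr h

theorem mul_sub_add_inv {t s : ℂ} (ht : t ≠ 0) (hs : s ≠ 0) :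
    2 * t * ((t + t⁻¹) / 2 - (s + s⁻¹) / 2) = (t - s) * (t - s⁻¹) := by
  field_simp
  ring

namespace PeriodicJacobi

variable {m p : ℕ} (J : PeriodicJacobi m p)

theorem charpoly_M_eq_prod (z : ℂ) {τ : Fin m → ℂ} (hτ : ∀ j, τ j ≠ 0)
    (h : ∀ ν, J.lyapunovPoly.evalEval z ν = ∏ j, (ν - (τ j + (τ j)⁻¹) / 2)) :
    (J.M z).charpoly = ∏ j, ((X - C (τ j)) * (X - C (τ j)⁻¹)) := by
  refine eq_of_infinite_eval_eq _ _ (Set.Infinite.mono (s := {0}ᶜ) (fun t ht => ?_)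
    (Set.finite_singleton _).infinite_compl)
  rw [Set.mem_ofPred_eq, J.eval_charpoly_M z ht, h, eval_prod]
  have hc : (2 * t) ^ m = ∏ _j : Fin m, 2 * t := by
    rw [Finset.prod_const, Finset.card_univ, Fintype.card_fin]
  rw [hc, ← Finset.prod_mul_distrib]
  refine Finset.prod_congr rfl fun j _ => ?_
  rw [mul_sub_add_inv ht (hτ j)]
  simp

end PeriodicJacobi

/-! ### Shifts and multiplications on the sequence space -/

theorem bounded_const {m : ℕ} (B : Matrix (Fin m) (Fin m) ℂ) :
    ∃ C : ℝ, ∀ _ : ℤ, ‖Matrix.toEuclideanCLM (𝕜 := ℂ) B‖ ≤ C :=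
  ⟨_, fun _ => le_rfl⟩

theorem star_shiftMul {m : ℕ} (c d : ℤ → Matrix (Fin m) (Fin m) ℂ)
    (hc : ∃ C : ℝ, ∀ n, ‖Matrix.toEuclideanCLM (𝕜 := ℂ) (c n)‖ ≤ C)
    (hd : ∃ C : ℝ, ∀ n, ‖Matrix.toEuclideanCLM (𝕜 := ℂ) (d n)‖ ≤ C) (k : ℤ)
    (h : ∀ n, d n = (c (n - k)).conjTranspose) :
    star (shiftMul c hc k) = shiftMul d hd (-k) := by
  rw [ContinuousLinearMap.star_eq_adjoint, eq_comm, ContinuousLinearMap.eq_adjoint_iff]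
  intro x y
  rw [lp.inner_eq_tsum, lp.inner_eq_tsum]
  rw [← (Equiv.addRight k).tsum_eq]
  refine tsum_congr fun n => ?_
  rw [shiftMul_apply, shiftMul_apply, Equiv.coe_addRight, h, ← sub_eq_add_neg, add_sub_cancel_right,
    ← Matrix.star_eq_conjTranspose, map_star, ContinuousLinearMap.star_eq_adjoint,
    ContinuousLinearMap.adjoint_inner_left]

theorem EllTwo.clm_ext {m : ℕ} {S T : EllTwo m →L[ℂ] EllTwo m}
    (h : ∀ y n, S y n = T y n) : S = T :=
  ContinuousLinearMap.ext fun y => lp.ext (funext fun n => h y n)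

/-- The operator that multiplies every entry of a sequence by the matrix `B`. -/
def constMul (m : ℕ) : Matrix (Fin m) (Fin m) ℂ →ₐ[ℂ] (EllTwo m →L[ℂ] EllTwo m) :=
  AlgHom.ofLinearMap
    { toFun := fun B => shiftMul (fun _ => B) (bounded_const B) 0
      map_add' := fun A B => EllTwo.clm_ext fun y n => by simp [shiftMul_apply]
      map_smul' := fun t A => EllTwo.clm_ext fun y n => by simp [shiftMul_apply] }
    (EllTwo.clm_ext fun y n => by simp [shiftMul_apply])
    (fun A B => EllTwo.clm_ext fun y n => by simp [shiftMul_apply])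

theorem constMul_apply {m : ℕ} (B : Matrix (Fin m) (Fin m) ℂ) (y : EllTwo m) (n : ℤ) :
    constMul m B y n = Matrix.toEuclideanCLM (𝕜 := ℂ) B (y n) := by
  change Matrix.toEuclideanCLM (𝕜 := ℂ) B (y (n + 0)) = _
  rw [add_zero]

/-- The shift `(y n) ↦ (y (n + k))`. -/
def shift (m : ℕ) (k : ℤ) : EllTwo m →L[ℂ] EllTwo m :=
  shiftMul (fun _ => 1) (bounded_const 1) k

theorem shift_apply {m : ℕ} (k : ℤ) (y : EllTwo m) (n : ℤ) : shift m k y n = y (n + k) := by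
  simp [shift, shiftMul_apply]

theorem star_shift (m : ℕ) (k : ℤ) : star (shift m k) = shift m (-k) :=
  star_shiftMul _ _ _ _ _ fun _ => by simp

theorem shift_mul_shift_neg (m : ℕ) (k : ℤ) : shift m k * shift m (-k) = 1 :=
  EllTwo.clm_ext fun y n => by simp [shift_apply]

theorem shift_mem_unitary (m : ℕ) (k : ℤ) : shift m k ∈ unitary (EllTwo m →L[ℂ] EllTwo m) := by
  refine Unitary.mem_iff.mpr ⟨?_, ?_⟩ <;> rw [star_shift]
  · simpa using shift_mul_shift_neg m (-k)
  · exact shift_mul_shift_neg m k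

theorem bounded_indicator (m p : ℕ) : ∃ C : ℝ, ∀ n : ℤ, ‖Matrix.toEuclideanCLM (𝕜 := ℂ)
    (if (p : ℤ) ∣ n then (1 : Matrix (Fin m) (Fin m) ℂ) else 0)‖ ≤ C := by
  refine ⟨‖Matrix.toEuclideanCLM (𝕜 := ℂ) (1 : Matrix (Fin m) (Fin m) ℂ)‖, fun n => ?_⟩
  split_ifs
  · exact le_rfl
  · rw [map_zero, norm_zero]
    exact norm_nonneg _

/-- The projection onto the sequences supported at the multiples of `p`. -/
def sublattice (m p : ℕ) : EllTwo m →L[ℂ] EllTwo m :=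
  shiftMul (fun n => if (p : ℤ) ∣ n then 1 else 0) (bounded_indicator m p) 0

theorem sublattice_apply {m p : ℕ} (y : EllTwo m) (n : ℤ) :
    sublattice m p y n = if (p : ℤ) ∣ n then y n else 0 := by
  rw [sublattice, shiftMul_apply, add_zero]
  split_ifs <;> simp

/-- The translates of the projection `sublattice m p` add up to the identity. -/
theorem sum_shift_sublattice_shift (m : ℕ) {p : ℕ} (hp : 1 ≤ p) :
    ∑ j ∈ Finset.range p, shift m (-j) * (sublattice m p * shift m j) = 1 := by
  refine EllTwo.clm_ext fun y n => ?_
  have h1 : ∀ j : ℕ, (shift m (-j) * (sublattice m p * shift m j)) y n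
      = if (p : ℤ) ∣ n - j then y n else 0 := by
    intro j
    simp only [mul_apply_eq_comp, shift_apply, sublattice_apply, ← sub_eq_add_neg,
      sub_add_cancel]
  have hp0 : (0 : ℤ) < p := by exact_mod_cast hp
  rw [sum_apply, lp.coeFn_sum, Finset.sum_apply,
    Finset.sum_eq_single (n % p).toNat]
  · rw [h1, Int.toNat_of_nonneg (Int.emod_nonneg _ hp0.ne'), if_pos (Int.dvd_self_sub_emod)]
    rfl
  · intro j hj hne
    rw [h1, if_neg]
    intro hd
    have hj' := Finset.mem_range.mp hj
    apply hne
    have h2 : n % p = (j : ℤ) % p :=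
      Int.emod_eq_emod_iff_emod_sub_eq_zero.mpr (Int.emod_eq_zero_of_dvd hd)
    rw [h2, Int.emod_eq_of_lt (by positivity) (by exact_mod_cast hj'), Int.toNat_natCast]
  · intro h
    refine absurd (Finset.mem_range.mpr ?_) h
    rw [Int.toNat_lt (Int.emod_nonneg _ hp0.ne')]
    exact Int.emod_lt_of_pos _ hp0

/-! ### Points of the spectrum have unimodular multipliers -/

namespace PeriodicJacobi

variable {m p : ℕ} (J : PeriodicJacobi m p)

theorem isSelfAdjoint_operator : IsSelfAdjoint J.operator := by
  have ha : ∀ n, (J.aC n).conjTranspose = (J.aC n).transpose := fun n => by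
    ext i j; simp [aC]
  have hb : ∀ n, (J.bC n).conjTranspose = J.bC n := fun n => by
    conv_rhs => rw [← J.bC_transpose n]
    ext i j; simp [bC]
  have hBa := bounded_of_periodic J.p_pos _ J.aC_periodic
  have hBb := bounded_of_periodic J.p_pos _ J.bC_periodic
  have hBt : ∃ C : ℝ, ∀ n, ‖Matrix.toEuclideanCLM (𝕜 := ℂ) (J.aC (n - 1)).transpose‖ ≤ C :=
    bounded_of_periodic J.p_pos (fun n => (J.aC (n - 1)).transpose) fun n => by
      rw [show n + (p : ℤ) - 1 = n - 1 + p by ring, J.aC_periodic]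
  rw [IsSelfAdjoint, operator, star_add, star_add,
    star_shiftMul J.aC (fun n => (J.aC (n - 1)).transpose) hBa hBt 1 fun n => (ha _).symm,
    star_shiftMul J.bC J.bC hBb hBb 0 fun n => by rw [sub_zero, hb],
    star_shiftMul (fun n => (J.aC (n - 1)).transpose) J.aC hBt hBa (-1) fun n => by
      rw [← ha, Matrix.conjTranspose_conjTranspose, sub_neg_eq_add, add_sub_cancel_right],
    neg_neg, neg_zero]
  abel

theorem im_eq_zero_of_mem_spectrum {z : ℂ} (hz : z ∈ spectrum ℂ J.operator) : z.im = 0 :=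
  J.isSelfAdjoint_operator.im_eq_zero_of_mem_spectrum hz

theorem aC_add_of_dvd {k : ℤ} (hk : (p : ℤ) ∣ k) (n : ℤ) : J.aC (k + n) = J.aC n := by
  obtain ⟨j, rfl⟩ := hk
  have h : Function.Periodic J.aC (p : ℤ) := J.aC_periodic
  rw [add_comm, mul_comm]
  exact h.int_mul j n

theorem bC_add_of_dvd {k : ℤ} (hk : (p : ℤ) ∣ k) (n : ℤ) : J.bC (k + n) = J.bC n := by
  obtain ⟨j, rfl⟩ := hk
  have h : Function.Periodic J.bC (p : ℤ) := J.bC_periodic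
  rw [add_comm, mul_comm]
  exact h.int_mul j n

theorem sublattice_mul_shift_mul_operator (n : ℤ) :
    sublattice m p * shift m n * J.operator =
      constMul m (J.aC n) * (sublattice m p * shift m (n + 1))
        + constMul m (J.bC n) * (sublattice m p * shift m n)
        + constMul m (J.aC (n - 1)).transpose * (sublattice m p * shift m (n - 1)) := by
  refine EllTwo.clm_ext fun y k => ?_
  simp only [mul_apply_eq_comp, add_apply, lp.coeFn_add,
    Pi.add_apply, sublattice_apply, shift_apply, constMul_apply]
  split_ifs with h
  · rw [operator_apply, J.aC_add_of_dvd h, J.bC_add_of_dvd h,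
      show k + n - 1 = k + (n - 1) by ring, J.aC_add_of_dvd h, add_assoc k n 1]
  · simp

theorem shift_mul_constMul_mul (B : Matrix (Fin m) (Fin m) ℂ) (n : ℤ) :
    shift m p * (constMul m B * (sublattice m p * shift m n)) =
      constMul m B * (sublattice m p * shift m (n + p)) := by
  refine EllTwo.clm_ext fun y k => ?_
  simp only [mul_apply_eq_comp, sublattice_apply, shift_apply, constMul_apply,
    dvd_add_self_right]
  rw [show k + p + n = k + (n + p) by ring]

/-- The class of `sublattice m p * shift m n` modulo the left ideal generated by `J - z`. In `n`
this is a solution of the difference equation with values in the quotient module. -/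
def universalSolution (z : ℂ) (n : ℤ) :
    (EllTwo m →L[ℂ] EllTwo m) ⧸
      (Submodule.span (EllTwo m →L[ℂ] EllTwo m) {J.operator - algebraMap ℂ _ z}) :=
  Submodule.Quotient.mk (sublattice m p * shift m n)

theorem universalSolution_eq (z : ℂ) (n : ℤ) :
    constMul m (J.aC n) • J.universalSolution z (n + 1)
      + constMul m (J.bC n) • J.universalSolution z n
      + constMul m (J.aC (n - 1)).transpose • J.universalSolution z (n - 1)
      = constMul m (z • 1) • J.universalSolution z n := by
  simp only [universalSolution, ← Submodule.Quotient.mk_smul, ← Submodule.Quotient.mk_add,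
    smul_eq_mul]
  rw [← sublattice_mul_shift_mul_operator, Submodule.Quotient.eq]
  refine Submodule.mem_span_singleton.mpr ⟨sublattice m p * shift m n, ?_⟩
  rw [smul_eq_mul, mul_sub, map_smul, map_one, ← Algebra.commutes, Algebra.algebraMap_eq_smul_one]

theorem universalSolution_natCast (z : ℂ) (n : ℕ) :
    J.universalSolution z n = constMul m (J.theta z n) • J.universalSolution z 0
      + constMul m (J.phi z n) • J.universalSolution z 1 := by
  induction n using Nat.twoStepInduction with
  | zero => simp [theta, phi, matSol]
  | one => simp [theta, phi, matSol]
  | more n ih1 ih2 =>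
    have h := J.universalSolution_eq z (n + 1)
    have hu := J.isUnit_det_aC (n + 1)
    have h1 : constMul m (J.aC (n + 1)) • J.universalSolution z (n + 1 + 1)
        = constMul m (z • 1 - J.bC (n + 1)) • J.universalSolution z (n + 1)
          - constMul m (J.aC n).transpose • J.universalSolution z n := by
      rw [add_sub_cancel_right] at h
      rw [map_sub, sub_smul, ← h]
      abel
    have h2 := congrArg (fun q => constMul m (J.aC (n + 1))⁻¹ • q) h1
    simp only [smul_smul, ← map_mul, Matrix.nonsing_inv_mul _ hu, map_one, one_smul] at h2
    push_cast at ih1 ih2 ⊢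
    rw [show (n : ℤ) + 2 = n + 1 + 1 by ring, h2, ih1, ih2]
    simp only [theta, phi, matSol, map_mul, map_sub, mul_smul, sub_smul, smul_add, smul_sub]
    abel

/-- The block row `R = (R₁, R₂)` acting on the initial values of the universal solution. -/
def universalRow (z : ℂ) (R : Matrix (Fin m) (Fin m ⊕ Fin m) ℂ) :
    (EllTwo m →L[ℂ] EllTwo m) ⧸
      (Submodule.span (EllTwo m →L[ℂ] EllTwo m) {J.operator - algebraMap ℂ _ z}) :=
  constMul m R.toCols₁ • J.universalSolution z 0 + constMul m R.toCols₂ • J.universalSolution z 1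

/-- The shift by a period commutes with the coefficients, hence acts on the initial values as the
monodromy matrix. -/
theorem shift_smul_universalRow (z : ℂ) (R : Matrix (Fin m) (Fin m ⊕ Fin m) ℂ) :
    shift m p • J.universalRow z R = J.universalRow z (R * J.monodromy z) := by
  have h1 : ∀ (B : Matrix (Fin m) (Fin m) ℂ) (n : ℤ),
      shift m p • constMul m B • J.universalSolution z n
        = constMul m B • J.universalSolution z (n + p) := fun B n => by
    simp only [universalSolution, ← Submodule.Quotient.mk_smul, smul_eq_mul,
      shift_mul_constMul_mul]
  obtain ⟨A, B, rfl⟩ : ∃ A B, R = Matrix.fromCols A B :=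
    ⟨_, _, (Matrix.fromCols_toCols R).symm⟩
  have h0 := J.universalSolution_natCast z p
  have h2 := J.universalSolution_natCast z (p + 1)
  push_cast at h2
  rw [monodromy, Matrix.fromCols_mul_fromBlocks]
  simp only [universalRow, Matrix.toCols₁_fromCols, Matrix.toCols₂_fromCols, smul_add, h1,
    zero_add, add_comm (1 : ℤ), h0, h2, map_add, map_mul, add_smul, mul_smul]
  abel

theorem aeval_shift_smul_universalRow (z : ℂ) (f : ℂ[X])
    (R : Matrix (Fin m) (Fin m ⊕ Fin m) ℂ) :
    aeval (shift m p) f • J.universalRow z R = J.universalRow z (R * aeval (J.monodromy z) f) := by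
  have hadd : ∀ R R', J.universalRow z (R + R') = J.universalRow z R + J.universalRow z R' := by
    intro R R'
    have h1 : (R + R').toCols₁ = R.toCols₁ + R'.toCols₁ := rfl
    have h2 : (R + R').toCols₂ = R.toCols₂ + R'.toCols₂ := rfl
    simp only [universalRow, h1, h2, map_add, add_smul]
    abel
  have hpow : ∀ (k : ℕ) R, shift m p ^ k • J.universalRow z R
      = J.universalRow z (R * J.monodromy z ^ k) := by
    intro k
    induction k with
    | zero => intro R; simp
    | succ k ih =>
      intro R
      rw [pow_succ, mul_smul, shift_smul_universalRow, ih, pow_succ', Matrix.mul_assoc]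
  have hc : ∀ (c : ℂ) R, algebraMap ℂ (EllTwo m →L[ℂ] EllTwo m) c • J.universalRow z R
      = J.universalRow z (c • R) := by
    intro c R
    have h1 : (c • R).toCols₁ = c • R.toCols₁ := rfl
    have h2 : (c • R).toCols₂ = c • R.toCols₂ := rfl
    simp only [universalRow, h1, h2, map_smul, smul_add, smul_smul, ← Algebra.smul_def]
  induction f using Polynomial.induction_on' with
  | add f g hf hg => rw [map_add, map_add, add_smul, hf, hg, Matrix.mul_add, hadd]
  | monomial k c =>
    rw [aeval_monomial, aeval_monomial, mul_smul, hpow, hc, ← Algebra.smul_def, Matrix.mul_smul]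

/-- If no multiplier lies on the unit circle, then the universal solution vanishes: the shift by a
period acts on its initial values as the monodromy matrix, whereas the shift is unitary. Therefore
the left ideal generated by `J - x` contains `1`. -/
theorem exists_norm_eq_one_of_mem_spectrum {x : ℝ} (hx : (x : ℂ) ∈ spectrum ℂ J.operator) :
    ∃ t : ℂ, ‖t‖ = 1 ∧ (J.M x).charpoly.eval t = 0 := by
  by_contra! hcon
  let f := (J.monodromy x).charpoly
  have hdeg : 0 < f.degree := by
    rw [Matrix.charpoly_degree_eq_dim, Fintype.card_sum, Fintype.card_fin]
    have := J.m_pos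
    exact_mod_cast (by omega)
  have hu : IsUnit (aeval (shift m p) f) := by
    by_contra h
    have h0 : (0 : ℂ) ∈ spectrum ℂ (aeval (shift m p) f) := by
      rwa [spectrum.zero_mem_iff]
    rw [spectrum.map_polynomial_aeval_of_degree_pos _ _ hdeg] at h0
    obtain ⟨t, ht, ht0⟩ := h0
    refine hcon t ?_ (by rw [charpoly_M]; exact ht0)
    exact spectrum.norm_eq_one_of_unitary (shift_mem_unitary m p) ht
  have hrow : ∀ R, J.universalRow x R = 0 := by
    intro R
    have h := J.aeval_shift_smul_universalRow x f R
    rw [Matrix.aeval_self_charpoly, Matrix.mul_zero] at h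
    have h2 : J.universalRow x 0 = 0 := by
      have h3 : (0 : Matrix (Fin m) (Fin m ⊕ Fin m) ℂ).toCols₁ = 0 := rfl
      have h4 : (0 : Matrix (Fin m) (Fin m ⊕ Fin m) ℂ).toCols₂ = 0 := rfl
      simp [universalRow, h3, h4]
    rw [h2] at h
    obtain ⟨u, hu⟩ := hu
    rw [← one_smul (EllTwo m →L[ℂ] EllTwo m) (J.universalRow x R), ← u.inv_mul, mul_smul, hu, h,
      smul_zero]
  have h0 : J.universalSolution x 0 = 0 := by
    simpa [universalRow] using hrow (Matrix.fromCols 1 0)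
  have h1 : J.universalSolution x 1 = 0 := by
    simpa [universalRow] using hrow (Matrix.fromCols 0 1)
  have hsol : ∀ n : ℕ, J.universalSolution x n = 0 := fun n => by
    rw [universalSolution_natCast, h0, h1, smul_zero, smul_zero, add_zero]
  have hone : (1 : EllTwo m →L[ℂ] EllTwo m) ∈
      Submodule.span (EllTwo m →L[ℂ] EllTwo m) {J.operator - algebraMap ℂ _ (x : ℂ)} := by
    rw [← sum_shift_sublattice_shift m J.p_pos]
    refine Submodule.sum_mem _ fun j _ => ?_
    exact Submodule.smul_mem _ (shift m (-j)) ((Submodule.Quotient.mk_eq_zero _).mp (hsol j))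
  obtain ⟨B, hB⟩ := Submodule.mem_span_singleton.mp hone
  rw [smul_eq_mul] at hB
  have hsa : star (J.operator - algebraMap ℂ (EllTwo m →L[ℂ] EllTwo m) (x : ℂ))
      = J.operator - algebraMap ℂ _ (x : ℂ) := by
    rw [star_sub, J.isSelfAdjoint_operator.star_eq, ← algebraMap_star_comm]
    simp
  have hB' := congrArg star hB
  rw [star_mul, hsa, star_one] at hB'
  refine spectrum.mem_iff.mp hx ?_
  rw [← IsUnit.neg_iff, neg_sub]
  exact isUnit_iff_exists_and_exists.mpr ⟨⟨_, hB'⟩, ⟨_, hB⟩⟩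

end PeriodicJacobi

/-! ### Floquet solutions and the spectrum -/

/-- A sequence with `W (n + p) = t • W n` extends to the integers. -/
theorem exists_int_extension {V : Type*} [AddCommGroup V] [Module ℂ V] {p : ℕ} (hp : 1 ≤ p)
    {W : ℕ → V} {t : ℂ} (ht : t ≠ 0) (hY : ∀ n, W (n + p) = t • W n) :
    ∃ y : ℤ → V, (∀ n : ℕ, y n = W n) ∧ ∀ n, y (n + p) = t • y n := by
  have hYk : ∀ k n : ℕ, W (n + k * p) = t ^ k • W n := by
    intro k
    induction k with
    | zero => simp
    | succ k ih => intro n; rw [Nat.succ_mul, ← add_assoc, hY, ih, smul_smul, pow_succ']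
  have hp' : (1 : ℤ) ≤ p := by exact_mod_cast hp
  have hnn : ∀ n : ℤ, 0 ≤ n + n.natAbs * p := fun n => by
    have h1 : (n.natAbs : ℤ) ≤ n.natAbs * p := le_mul_of_one_le_right (by positivity) hp'
    omega
  let y : ℤ → V := fun n => (t ^ n.natAbs)⁻¹ • W (n + n.natAbs * p).toNat
  have hy : ∀ (n : ℤ) (k l : ℕ), (l : ℤ) = n + k * p → y n = (t ^ k)⁻¹ • W l := by
    intro n k l hl
    obtain ⟨l', hl'⟩ := Int.eq_ofNat_of_zero_le (hnn n)
    have h1 : l + n.natAbs * p = l' + k * p := by zify at *; linarith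
    have h2 : t ^ n.natAbs • W l = t ^ k • W l' := by rw [← hYk, ← hYk, h1]
    have h3 : y n = (t ^ n.natAbs)⁻¹ • W l' := by
      simp only [y]
      rw [hl']
      rfl
    rw [h3, inv_smul_eq_iff₀ (pow_ne_zero _ ht), smul_comm, h2, inv_smul_smul₀ (pow_ne_zero _ ht)]
  refine ⟨y, fun n => by simpa using hy n 0 n (by simp), fun n => ?_⟩
  obtain ⟨l, hl⟩ := Int.eq_ofNat_of_zero_le (hnn n)
  rw [hy (n + p) n.natAbs (l + p) (by rw [Nat.cast_add, ← hl]; ring),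
    hy n n.natAbs l hl.symm, hY, smul_comm]

namespace PeriodicJacobi

variable {m p : ℕ} (J : PeriodicJacobi m p)

theorem matSol_mulVec_add (z : ℂ) (v w : Fin m → ℂ) (n : ℕ) :
    (J.theta z (n + 2)).mulVec v + (J.phi z (n + 2)).mulVec w =
      (J.aC (n + 1))⁻¹.mulVec ((z • (1 : Matrix (Fin m) (Fin m) ℂ) - J.bC (n + 1)).mulVec
          ((J.theta z (n + 1)).mulVec v + (J.phi z (n + 1)).mulVec w)
        - (J.aC n).transpose.mulVec ((J.theta z n).mulVec v + (J.phi z n).mulVec w)) := by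
  simp only [theta, phi, matSol, ← Matrix.mulVec_mulVec, Matrix.sub_mulVec, Matrix.mulVec_add,
    Matrix.mulVec_sub]
  abel

/-- An eigenvector of the monodromy matrix gives a Floquet solution. -/
theorem exists_floquet_solution {z t : ℂ} (ht : t ≠ 0) (h : (J.M z).charpoly.eval t = 0) :
    ∃ y : ℤ → Fin m → ℂ, y ≠ 0 ∧ J.IsSolution z y ∧ ∀ n, y (n + p) = t • y n := by
  rw [charpoly_M, Matrix.eval_charpoly] at h
  obtain ⟨u, hu0, hu⟩ := Matrix.exists_mulVec_eq_zero_iff.mpr h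
  rw [Matrix.sub_mulVec, sub_eq_zero] at hu
  obtain ⟨v, w, rfl⟩ : ∃ v w, u = Sum.elim v w := ⟨_, _, (Sum.elim_comp_inl_inr u).symm⟩
  rw [monodromy, Matrix.fromBlocks_mulVec, Matrix.scalar_apply, ← Matrix.smul_one_eq_diagonal, Matrix.smul_mulVec,
    Matrix.one_mulVec] at hu
  let W : ℕ → Fin m → ℂ := fun n => (J.theta z n).mulVec v + (J.phi z n).mulVec w
  have hYrec : ∀ n, W (n + 2) = (J.aC (n + 1))⁻¹.mulVec
      ((z • (1 : Matrix (Fin m) (Fin m) ℂ) - J.bC (n + 1)).mulVec (W (n + 1))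
        - (J.aC n).transpose.mulVec (W n)) := J.matSol_mulVec_add z v w
  have hY0 : W 0 = v := by simp [W, theta, phi, matSol]
  have hY1 : W 1 = w := by simp [W, theta, phi, matSol]
  have hp0 : W p = t • W 0 := by
    rw [hY0]
    exact (congrArg (· ∘ Sum.inl) hu).symm
  have hp1 : W (p + 1) = t • W 1 := by
    rw [hY1]
    exact (congrArg (· ∘ Sum.inr) hu).symm
  have hYp : ∀ n, W (n + p) = t • W n := by
    intro n
    induction n using Nat.twoStepInduction with
    | zero => rw [zero_add, hp0]
    | one => rw [add_comm, hp1]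
    | more n ih1 ih2 =>
      rw [show n + 2 + p = n + p + 2 by ring, hYrec, hYrec n,
        show n + p + 1 = n + 1 + p by ring, ih1, ih2]
      push_cast
      rw [show (n : ℤ) + p + 1 = n + 1 + p by ring, J.aC_periodic, J.aC_periodic, J.bC_periodic,
        Matrix.mulVec_smul, Matrix.mulVec_smul, ← smul_sub, Matrix.mulVec_smul]
  obtain ⟨y, hyY, hy⟩ := exists_int_extension J.p_pos ht hYp
  have hsol : ∀ n : ℤ, 1 ≤ n → (J.aC n).mulVec (y (n + 1)) + (J.bC n).mulVec (y n)
      + (J.aC (n - 1)).transpose.mulVec (y (n - 1)) = z • y n := by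
    intro n hn
    obtain ⟨k, rfl⟩ : ∃ k : ℕ, n = k + 1 := ⟨(n - 1).toNat, by omega⟩
    rw [add_sub_cancel_right, show (k : ℤ) + 1 + 1 = (k + 2 : ℕ) by push_cast; ring,
      show (k : ℤ) + 1 = (k + 1 : ℕ) by push_cast; ring, hyY, hyY, hyY, hYrec,
      Matrix.mulVec_mulVec]
    push_cast
    rw [Matrix.mul_nonsing_inv _ (J.isUnit_det_aC _), Matrix.one_mulVec, Matrix.sub_mulVec,
      Matrix.smul_mulVec, Matrix.one_mulVec]
    abel
  refine ⟨y, ?_, ?_, hy⟩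
  · rintro rfl
    apply hu0
    rw [← hY0, ← hY1, ← hyY, ← hyY]
    ext (i | i) <;> rfl
  · have hstep : ∀ k : ℕ, ∀ n : ℤ, 1 ≤ n + k * p → (J.aC n).mulVec (y (n + 1))
        + (J.bC n).mulVec (y n) + (J.aC (n - 1)).transpose.mulVec (y (n - 1)) = z • y n := by
      intro k
      induction k with
      | zero => intro n hn; exact hsol n (by simpa using hn)
      | succ k ih =>
        intro n hn
        have h1 := ih (n + p) (by push_cast at hn; linarith)
        rw [show n + (p : ℤ) + 1 = n + 1 + p by ring, show n + (p : ℤ) - 1 = n - 1 + p by ring,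
          J.aC_periodic, J.aC_periodic, J.bC_periodic, hy, hy, hy, Matrix.mulVec_smul,
          Matrix.mulVec_smul, Matrix.mulVec_smul, ← smul_add, ← smul_add, smul_comm z t] at h1
        exact smul_right_injective _ ht h1
    intro n
    refine hstep (n.natAbs + 1) n ?_
    have hp' : (1 : ℤ) ≤ p := by exact_mod_cast J.p_pos
    have h1 : ((n.natAbs + 1 : ℕ) : ℤ) ≤ (n.natAbs + 1 : ℕ) * p :=
      le_mul_of_one_le_right (by positivity) hp'
    omega

/-- The restriction of a sequence to the window `[-N, N]`. -/
def truncation (W : ℤ → EuclideanSpace ℂ (Fin m)) (N : ℕ) : EllTwo m :=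
  ∑ n ∈ Finset.Icc (-N : ℤ) N, lp.single 2 n (W n)

theorem truncation_apply (W : ℤ → EuclideanSpace ℂ (Fin m)) (N : ℕ) (k : ℤ) :
    truncation W N k = if k ∈ Finset.Icc (-N : ℤ) N then W k else 0 := by
  simp only [truncation, lp.coeFn_sum, Finset.sum_apply, lp.coeFn_single, Finset.sum_pi_single]

theorem norm_truncation_rpow (W : ℤ → EuclideanSpace ℂ (Fin m)) (N : ℕ) :
    ‖truncation W N‖ ^ (2 : ℝ≥0∞).toReal =
      ∑ n ∈ Finset.Icc (-N : ℤ) N, ‖W n‖ ^ (2 : ℝ≥0∞).toReal :=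
  lp.norm_sum_single (by norm_num) W _

theorem norm_le_of_eq_zero_of_notMem {g : EllTwo m} {T : Finset ℤ} {B : ℝ}
    (hB : ∀ k, ‖g k‖ ≤ B) (hT : ∀ k ∉ T, g k = 0) : ‖g‖ ≤ T.card * B := by
  have hgsum : g = ∑ k ∈ T, lp.single 2 k (g k) := by
    refine lp.ext (funext fun k => ?_)
    rw [lp.coeFn_sum, Finset.sum_apply]
    simp only [lp.coeFn_single, Finset.sum_pi_single]
    split_ifs with hk
    · rfl
    · exact hT k hk
  rw [hgsum, ← nsmul_eq_mul, ← Finset.sum_const]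
  refine norm_sum_le_of_le _ fun k _ => ?_
  rw [lp.norm_single (by norm_num)]
  exact hB k

/-- `z - J` maps the truncations of a bounded solution to sequences supported near the ends of the
window. -/
theorem exists_norm_truncation_le {z : ℂ} {W : ℤ → EuclideanSpace ℂ (Fin m)} {K : ℝ}
    (hK : ∀ n, ‖W n‖ ≤ K)
    (hsol : ∀ n, Matrix.toEuclideanCLM (𝕜 := ℂ) (J.aC n) (W (n + 1))
      + Matrix.toEuclideanCLM (𝕜 := ℂ) (J.bC n) (W n)
      + Matrix.toEuclideanCLM (𝕜 := ℂ) (J.aC (n - 1)).transpose (W (n - 1)) = z • W n) :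
    ∃ B, ∀ N, ‖z • truncation W N - J.operator (truncation W N)‖ ≤ B := by
  have hK0 : 0 ≤ K := (norm_nonneg _).trans (hK 0)
  obtain ⟨Ca, hCa⟩ := bounded_of_periodic J.p_pos _ J.aC_periodic
  obtain ⟨Cb, hCb⟩ := bounded_of_periodic J.p_pos _ J.bC_periodic
  obtain ⟨Ct, hCt⟩ := bounded_of_periodic J.p_pos (fun n => (J.aC (n - 1)).transpose) fun n => by
    rw [show n + (p : ℤ) - 1 = n - 1 + p by ring, J.aC_periodic]
  let B : ℝ := ‖z‖ * K + (Ca * K + Cb * K + Ct * K)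
  refine ⟨4 * B, fun N => ?_⟩
  generalize hf : truncation W N = f
  have hfk : ∀ k, f k = if k ∈ Finset.Icc (-N : ℤ) N then W k else 0 := fun k => by
    rw [← hf, truncation_apply]
  have hfK : ∀ k, ‖f k‖ ≤ K := fun k => by
    rw [hfk]
    split_ifs
    · exact hK k
    · simpa using hK0
  have hgk : ∀ k, (z • f - J.operator f) k
      = z • f k - (Matrix.toEuclideanCLM (𝕜 := ℂ) (J.aC k) (f (k + 1))
        + Matrix.toEuclideanCLM (𝕜 := ℂ) (J.bC k) (f k)
        + Matrix.toEuclideanCLM (𝕜 := ℂ) (J.aC (k - 1)).transpose (f (k - 1))) := fun k => by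
    rw [← operator_apply]
    rfl
  have hmul : ∀ (A : Matrix (Fin m) (Fin m) ℂ) (C : ℝ) (j : ℤ),
      ‖Matrix.toEuclideanCLM (𝕜 := ℂ) A‖ ≤ C →
      ‖Matrix.toEuclideanCLM (𝕜 := ℂ) A (f j)‖ ≤ C * K := fun A C j hA =>
    (ContinuousLinearMap.le_opNorm _ _).trans
      (mul_le_mul hA (hfK j) (norm_nonneg _) ((norm_nonneg _).trans hA))
  have hgB : ∀ k, ‖(z • f - J.operator f) k‖ ≤ B := by
    intro k
    rw [hgk]
    refine (norm_sub_le _ _).trans (add_le_add ?_ (norm_add₃_le.trans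
      (add_le_add_three (hmul _ _ _ (hCa k)) (hmul _ _ _ (hCb k)) (hmul _ _ _ (hCt k)))))
    rw [norm_smul]
    exact mul_le_mul_of_nonneg_left (hfK k) (norm_nonneg _)
  let T : Finset ℤ := {-(N : ℤ) - 1, -(N : ℤ), (N : ℤ), (N : ℤ) + 1}
  have hgT : ∀ k ∉ T, (z • f - J.operator f) k = 0 := by
    intro k hk
    simp only [T, Finset.mem_insert, Finset.mem_singleton, not_or] at hk
    rw [hgk, hfk, hfk, hfk]
    simp only [Finset.mem_Icc]
    by_cases hin : -(N : ℤ) ≤ k ∧ k ≤ N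
    · rw [if_pos hin, if_pos (by omega), if_pos (by omega), hsol, sub_self]
    · rw [if_neg hin, if_neg (by omega), if_neg (by omega), map_zero, map_zero, map_zero,
        smul_zero, add_zero, add_zero, sub_zero]
  have hBnn : 0 ≤ B := (norm_nonneg _).trans (hgB 0)
  exact (norm_le_of_eq_zero_of_notMem hgB hgT).trans
    (mul_le_mul_of_nonneg_right (by exact_mod_cast Finset.card_le_four) hBnn)

theorem exists_norm_le_of_notMem_spectrum {z : ℂ} (hz : z ∉ spectrum ℂ J.operator) :
    ∃ C, 0 ≤ C ∧ ∀ f, ‖f‖ ≤ C * ‖z • f - J.operator f‖ := by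
  rw [spectrum.notMem_iff] at hz
  obtain ⟨u, hu⟩ := hz
  refine ⟨‖(↑u⁻¹ : EllTwo m →L[ℂ] EllTwo m)‖, norm_nonneg _, fun f => ?_⟩
  have h2 : (u : EllTwo m →L[ℂ] EllTwo m) f = z • f - J.operator f := by
    rw [hu, sub_apply, Algebra.algebraMap_eq_smul_one]
    rfl
  have h1 : (↑u⁻¹ : EllTwo m →L[ℂ] EllTwo m) ((u : EllTwo m →L[ℂ] EllTwo m) f) = f := by
    rw [← mul_apply_eq_comp, u.inv_mul]
    rfl
  rw [← h2]
  conv_lhs => rw [← h1]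
  exact ContinuousLinearMap.le_opNorm _ _

theorem exists_norm_le_of_periodic_norm {W : ℤ → EuclideanSpace ℂ (Fin m)} (hp : 1 ≤ p)
    (hper : ∀ n, ‖W (n + p)‖ = ‖W n‖) : ∃ K : ℝ, ∀ n, ‖W n‖ ≤ K := by
  have hper' : Function.Periodic (fun n => ‖W n‖) (p : ℤ) := hper
  have hp0 : (0 : ℤ) < p := by exact_mod_cast hp
  refine ⟨∑ j ∈ Finset.Ico (0 : ℤ) p, ‖W j‖, fun n => ?_⟩
  obtain ⟨k, hk, hkn⟩ := hper'.exists_mem_Ico₀ hp0 n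
  change ‖W n‖ = ‖W k‖ at hkn
  rw [hkn]
  exact Finset.single_le_sum (f := fun j : ℤ => ‖W j‖) (fun j _ => norm_nonneg _)
    (Finset.mem_Ico.mpr hk)

theorem not_summable_of_periodic_norm {W : ℤ → EuclideanSpace ℂ (Fin m)} (hp : 1 ≤ p)
    (hper : ∀ n, ‖W (n + p)‖ = ‖W n‖) (hW : W ≠ 0) :
    ¬ Summable fun n => ‖W n‖ ^ (2 : ℝ≥0∞).toReal := by
  intro hsum
  have hper' : Function.Periodic (fun n => ‖W n‖) (p : ℤ) := hper
  have hp0 : (0 : ℤ) < p := by exact_mod_cast hp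
  obtain ⟨n₀, hn₀⟩ := Function.ne_iff.mp hW
  have hinj : Function.Injective fun k : ℕ => n₀ + k * (p : ℤ) := fun k l hkl => by
    have h1 : (k : ℤ) * p = l * p := by simpa using hkl
    exact_mod_cast mul_right_cancel₀ hp0.ne' h1
  have hlim := (hsum.comp_injective hinj).tendsto_atTop_zero
  have hconst : ∀ k : ℕ, ‖W (n₀ + k * (p : ℤ))‖ = ‖W n₀‖ := fun k => hper'.nat_mul k n₀
  simp only [Function.comp_def, hconst] at hlim
  have h0 := tendsto_nhds_unique hlim tendsto_const_nhds
  exact hn₀ (norm_eq_zero.mp ((Real.rpow_eq_zero (norm_nonneg _) (by norm_num)).mp h0.symm))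

/-- The truncations of a bounded Floquet solution show that `z - J` is not bounded below. -/
theorem mem_spectrum_of_norm_eq_one {z t : ℂ} (ht : ‖t‖ = 1)
    (h : (J.M z).charpoly.eval t = 0) : z ∈ spectrum ℂ J.operator := by
  have ht0 : t ≠ 0 := norm_ne_zero_iff.mp (by rw [ht]; exact one_ne_zero)
  obtain ⟨y, hy0, hsol, hy⟩ := J.exists_floquet_solution ht0 h
  let W : ℤ → EuclideanSpace ℂ (Fin m) := fun n => WithLp.toLp 2 (y n)
  have hper : ∀ n, ‖W (n + p)‖ = ‖W n‖ := fun n => by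
    simp only [W, hy, WithLp.toLp_smul, norm_smul, ht, one_mul]
  have hW : W ≠ 0 := fun h0 => hy0 (funext fun n => congrArg WithLp.ofLp (congrFun h0 n))
  by_contra hz
  obtain ⟨C, hC0, hC⟩ := J.exists_norm_le_of_notMem_spectrum hz
  obtain ⟨K, hK⟩ := exists_norm_le_of_periodic_norm J.p_pos hper
  obtain ⟨B, hB⟩ := J.exists_norm_truncation_le (z := z) hK fun n => by
    simp only [W, Matrix.toEuclideanCLM_toLp, ← WithLp.toLp_add, ← WithLp.toLp_smul, hsol n]
  refine not_summable_of_periodic_norm J.p_pos hper hW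
    (summable_of_sum_le (c := (C * B) ^ (2 : ℝ≥0∞).toReal) (fun n => by positivity) fun s => ?_)
  obtain ⟨N, hN⟩ : ∃ N : ℕ, s ⊆ Finset.Icc (-N : ℤ) N := by
    refine ⟨∑ k ∈ s, k.natAbs, fun k hk => ?_⟩
    have h1 : k.natAbs ≤ ∑ k ∈ s, k.natAbs :=
      Finset.single_le_sum (f := fun k : ℤ => k.natAbs) (fun _ _ => Nat.zero_le _) hk
    rw [Finset.mem_Icc]
    omega
  calc ∑ n ∈ s, ‖W n‖ ^ (2 : ℝ≥0∞).toReal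
      ≤ ∑ n ∈ Finset.Icc (-N : ℤ) N, ‖W n‖ ^ (2 : ℝ≥0∞).toReal :=
        Finset.sum_le_sum_of_subset_of_nonneg hN fun n _ _ => by positivity
    _ = ‖truncation W N‖ ^ (2 : ℝ≥0∞).toReal := (norm_truncation_rpow W N).symm
    _ ≤ _ := Real.rpow_le_rpow (norm_nonneg _)
        ((hC _).trans (mul_le_mul_of_nonneg_left (hB N) hC0)) (by norm_num)

theorem norm_eq_one_of_mem_Icc {d : ℝ} (hd : d ∈ Set.Icc (-1 : ℝ) 1) {t : ℂ} (ht : t ≠ 0)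
    (h : (d : ℂ) = (t + t⁻¹) / 2) : ‖t‖ = 1 := by
  -- `t` solves `t ^ 2 - 2 d t + 1 = 0`, so that `(t - d) ^ 2 = d ^ 2 - 1 ≤ 0`
  have h1 : t * t - 2 * d * t + 1 = 0 := by
    rw [h]
    field_simp
    ring
  have hre := congrArg Complex.re h1
  have him := congrArg Complex.im h1
  simp at hre him
  have h2 : t.im = 0 ∨ t.re = d := by
    have : t.im * (t.re - d) = 0 := by linarith
    rcases mul_eq_zero.mp this with h | h
    · exact Or.inl h
    · exact Or.inr (by linarith)
  have h3 : t.re * t.re + t.im * t.im = 1 := by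
    rcases h2 with h2 | h2
    · rw [h2] at hre ⊢
      have h4 : (t.re - d) ^ 2 = d ^ 2 - 1 := by nlinarith
      have h5 : d ^ 2 ≤ 1 := by nlinarith [hd.1, hd.2]
      have h6 : t.re - d = 0 := by nlinarith [sq_nonneg (t.re - d)]
      nlinarith
    · rw [← h2] at hre
      nlinarith
  rw [← Complex.normSq_apply, Complex.normSq_eq_norm_sq] at h3
  nlinarith [norm_nonneg t]

/-- The spectrum consists of the points where a Lyapunov function has a value in `[-1, 1]`. -/
theorem mem_spectrum_iff {z : ℂ} : z ∈ spectrum ℂ J.operator ↔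
    ∃ d ∈ Set.Icc (-1 : ℝ) 1, J.lyapunovPoly.evalEval z d = 0 := by
  constructor
  · intro hz
    obtain ⟨x, rfl⟩ : ∃ x : ℝ, z = x :=
      ⟨z.re, Complex.ext rfl (by simpa using J.im_eq_zero_of_mem_spectrum hz)⟩
    obtain ⟨t, ht, h⟩ := J.exists_norm_eq_one_of_mem_spectrum hz
    have ht0 : t ≠ 0 := norm_ne_zero_iff.mp (by rw [ht]; exact one_ne_zero)
    rw [J.eval_charpoly_M _ ht0, mul_eq_zero] at h
    refine ⟨t.re, abs_le.mp ((Complex.abs_re_le_norm t).trans ht.le), ?_⟩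
    have h1 : (t + t⁻¹) / 2 = (t.re : ℂ) := by
      rw [Complex.inv_eq_conj ht, Complex.add_conj]
      push_cast
      ring
    rw [← h1]
    exact h.resolve_left (pow_ne_zero _ (mul_ne_zero two_ne_zero ht0))
  · rintro ⟨d, hd, h⟩
    obtain ⟨t, ht, hdt⟩ := exists_add_inv_div_two_eq (d : ℂ)
    have ht0 : t ≠ 0 := norm_pos_iff.mp (one_pos.trans_le ht)
    refine J.mem_spectrum_of_norm_eq_one (norm_eq_one_of_mem_Icc hd ht0 hdt) ?_
    rw [J.eval_charpoly_M _ ht0, ← hdt, h, mul_zero]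

theorem isPeriodicEigenvalue_of_evalEval_one {z : ℂ} (h : J.lyapunovPoly.evalEval z 1 = 0) :
    J.IsPeriodicEigenvalue z := by
  obtain ⟨y, hy0, hsol, hy⟩ := J.exists_floquet_solution (z := z) one_ne_zero (by
    rw [J.eval_charpoly_M _ one_ne_zero, inv_one, one_add_one_eq_two, div_self two_ne_zero, h,
      mul_zero])
  exact ⟨y, hy0, hsol, fun n => by rw [hy, one_smul]⟩

theorem isAntiperiodicEigenvalue_of_evalEval_neg_one {z : ℂ}
    (h : J.lyapunovPoly.evalEval z (-1) = 0) : J.IsAntiperiodicEigenvalue z := by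
  have h1 : (-1 + (-1)⁻¹ : ℂ) / 2 = -1 := by norm_num
  obtain ⟨y, hy0, hsol, hy⟩ := J.exists_floquet_solution (z := z) (neg_ne_zero.mpr one_ne_zero) (by
    rw [J.eval_charpoly_M _ (neg_ne_zero.mpr one_ne_zero), h1, h, mul_zero])
  exact ⟨y, hy0, hsol, fun n => by rw [hy, neg_one_smul]⟩

end PeriodicJacobi

/-! ### Real values of holomorphic branches -/

/-- If `c ≠ 0` and `2 ≤ k`, then `c * u ^ k` crosses the real axis while `u` moves in the upper
half-plane. -/
theorem exists_im_mul_pow_sign_change {c : ℂ} (hc : c ≠ 0) {k : ℕ} (hk : 2 ≤ k) :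
    ∃ u v : ℂ, 0 < u.im ∧ 0 < v.im ∧ (c * u ^ k).im < 0 ∧ 0 < (c * v ^ k).im := by
  have hk0 : (0 : ℝ) < k := by positivity
  have hkC : (k : ℂ) ≠ 0 := by exact_mod_cast hk0.ne'
  have hk2 : (2 : ℝ) ≤ k := by exact_mod_cast hk
  -- the angles `r * π / k` with `r < 2` lie in `(0, π)`
  let e : ℝ → ℂ := fun r => Complex.exp ((r * Real.pi / k : ℝ) * Complex.I)
  have he : ∀ r, 0 < r → r < 2 → 0 < (e r).im := fun r h0 h2 => by
    simp only [e, Complex.exp_ofReal_mul_I_im]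
    refine Real.sin_pos_of_pos_of_lt_pi (by positivity) ?_
    rw [div_lt_iff₀ hk0, mul_comm]
    exact mul_lt_mul_of_pos_left (by linarith) Real.pi_pos
  have hek : ∀ r, e r ^ k = Complex.exp (r * (Real.pi * Complex.I)) := fun r => by
    simp only [e]
    rw [← Complex.exp_nat_mul]
    congr 1
    push_cast
    field_simp
  have hpi : ∀ r, e (r + 1) ^ k = -e r ^ k := fun r => by
    rw [hek, hek]
    push_cast
    rw [add_mul, one_mul, Complex.exp_add, Complex.exp_pi_mul_I, mul_neg_one]
  have hhalf : ∀ r, e (r + 1 / 2) ^ k = e r ^ k * Complex.I := fun r => by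
    have h1 : (1 / 2 : ℂ) * (Real.pi * Complex.I) = Real.pi / 2 * Complex.I := by ring
    rw [hek, hek]
    push_cast
    rw [add_mul, Complex.exp_add, h1, Complex.exp_pi_div_two_mul_I]
  obtain ⟨r, h0, h1, hr⟩ : ∃ r : ℝ, 0 < r ∧ r < 1 ∧ (c * e r ^ k).im ≠ 0 := by
    by_cases h : (c * e (1 / 4) ^ k).im = 0
    · refine ⟨1 / 4 + 1 / 2, by norm_num, by norm_num, fun h' => ?_⟩
      rw [hhalf, ← mul_assoc, Complex.mul_I_im] at h'
      exact mul_ne_zero hc (pow_ne_zero _ (Complex.exp_ne_zero _)) (Complex.ext h' h)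
    · exact ⟨1 / 4, by norm_num, by norm_num, h⟩
  have hneg : (c * e (r + 1) ^ k).im = -(c * e r ^ k).im := by
    rw [hpi, mul_neg, Complex.neg_im]
  rcases lt_or_gt_of_ne hr with h | h
  · exact ⟨e r, e (r + 1), he _ h0 (by linarith), he _ (by linarith) (by linarith), h,
      by rw [hneg]; linarith⟩
  · exact ⟨e (r + 1), e r, he _ (by linarith) (by linarith), he _ h0 (by linarith),
      by rw [hneg]; linarith, h⟩

/-- A nonconstant holomorphic function with a critical point at `x` takes real values at nonreal
points near `x` if its value at `x` is real. -/
theorem frequently_im_ne_zero_of_deriv_eq_zero {δ : ℂ → ℂ} {x : ℝ} (hδ : AnalyticAt ℂ δ x)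
    (him : (δ x).im = 0) (hd : deriv δ x = 0) : ∃ᶠ z in 𝓝 (x : ℂ), z.im ≠ 0 ∧ (δ z).im = 0 := by
  by_cases hconst : ∀ᶠ z in 𝓝 (x : ℂ), δ z - δ x = 0
  · have hfreq : ∃ᶠ z in 𝓝 (x : ℂ), z.im ≠ 0 := by
      intro h
      have h1 : Tendsto (fun r : ℝ => (x : ℂ) + r * Complex.I) (𝓝[≠] 0) (𝓝 x) := by
        refine Tendsto.mono_left ?_ nhdsWithin_le_nhds
        refine Continuous.tendsto' (by fun_prop) _ _ (by simp)
      obtain ⟨r, hr, hr0⟩ := ((h1.eventually h).and self_mem_nhdsWithin).exists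
      exact hr (by simpa using hr0)
    refine (hfreq.and_eventually hconst).mono fun z hz => ⟨hz.1, ?_⟩
    rw [sub_eq_zero.mp hz.2, him]
  · obtain ⟨k, g, hg, hg0, hgk⟩ :=
      (hδ.sub analyticAt_const).exists_eventuallyEq_pow_smul_nonzero_iff.mpr hconst
    simp only [smul_eq_mul] at hgk
    have hk : 2 ≤ k := by
      by_contra! hk
      interval_cases k
      · have h := hgk.self_of_nhds
        simp only [Pi.sub_apply, sub_self, pow_zero, one_mul] at h
        exact hg0 h.symm
      · have h1 : HasDerivAt (fun z => (z - (x : ℂ)) ^ 1 * g z) (g x) x := by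
          have h2 := ((hasDerivAt_id (x : ℂ)).sub_const (x : ℂ)).mul
            hg.differentiableAt.hasDerivAt
          rw [id_eq, sub_self, zero_mul, add_zero, one_mul] at h2
          exact h2.congr_of_eventuallyEq (Eventually.of_forall fun z => by
            simp only [pow_one]; rfl)
        have h3 : HasDerivAt (fun z => δ z - δ x) (deriv δ x) x :=
          hδ.differentiableAt.hasDerivAt.sub_const _
        rw [hd] at h3
        exact hg0 (h1.unique (h3.congr_of_eventuallyEq (hgk.mono fun z hz => hz.symm)))
    obtain ⟨u, v, hu, hv, hu', hv'⟩ := exists_im_mul_pow_sign_change hg0 hk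
    let q : ℝ → ℂ := fun s => (1 - s) * u + s * v
    have hqim : ∀ s ∈ Set.Icc (0 : ℝ) 1, 0 < (q s).im := fun s hs => by
      have h1 : (q s).im = (1 - s) * u.im + s * v.im := by
        simp [q]
      rw [h1]
      rcases hs.1.eq_or_lt with rfl | h0
      · simpa using hu
      · have := mul_pos h0 hv
        have := mul_nonneg (sub_nonneg.mpr hs.2) hu.le
        linarith
    have hqc : Continuous q := by fun_prop
    have htend : ∀ w : ℂ, Tendsto (fun r : ℝ => (x : ℂ) + r * w) (𝓝[>] 0) (𝓝 x) := fun w => by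
      refine Tendsto.mono_left ?_ nhdsWithin_le_nhds
      exact Continuous.tendsto' (by fun_prop) _ _ (by simp)
    have hlim : ∀ w : ℂ, Tendsto (fun r : ℝ => (g (x + r * w) * w ^ k).im) (𝓝[>] 0)
        (𝓝 (g x * w ^ k).im) := fun w => by
      refine (Complex.continuous_im.tendsto _).comp ?_
      exact ((hg.continuousAt.tendsto.comp (htend w)).mul_const _)
    have hform : ∀ (r : ℝ) (w : ℂ), (δ (x + r * w) - δ x) =
        (((x : ℂ) + r * w) - x) ^ k * g (x + r * w) →
        (δ (x + r * w)).im = r ^ k * (g (x + r * w) * w ^ k).im := fun r w h => by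
      have h1 : δ (x + r * w) = δ x + (r ^ k : ℝ) * (g (x + r * w) * w ^ k) := by
        rw [sub_eq_iff_eq_add'.mp h]
        push_cast
        ring
      rw [h1, Complex.add_im, him, zero_add, Complex.im_ofReal_mul]
    rw [frequently_iff]
    intro U hU
    have hgood : ∀ᶠ z in 𝓝 (x : ℂ), z ∈ U ∧ AnalyticAt ℂ δ z ∧
        δ z - δ x = (z - x) ^ k * g z :=
      (Filter.eventually_mem_set.mpr hU).and (hδ.eventually_analyticAt.and hgk)
    obtain ⟨ε, hε, hball⟩ := Metric.eventually_nhds_iff_ball.mp hgood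
    obtain ⟨R, hR⟩ : ∃ R, ∀ s ∈ Set.Icc (0 : ℝ) 1, ‖q s‖ ≤ R :=
      isCompact_Icc.exists_bound_of_continuousOn hqc.continuousOn
    have hR0 : 0 ≤ R := (norm_nonneg _).trans (hR 0 (by simp))
    have hsmall : ∀ᶠ r : ℝ in 𝓝[>] 0, r * (R + 1) < ε := by
      have h1 : Tendsto (fun r : ℝ => r * (R + 1)) (𝓝[>] 0) (𝓝 (0 * (R + 1))) :=
        (tendsto_nhdsWithin_of_tendsto_nhds tendsto_id).mul_const _
      rw [zero_mul] at h1
      exact h1.eventually_lt_const hε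
    obtain ⟨r, ⟨⟨hr, hru⟩, hrv⟩, hr0⟩ := ((((hsmall.and ((hlim u).eventually_lt_const hu')).and
      ((hlim v).eventually_const_lt hv')).and self_mem_nhdsWithin)).exists
    have hr0 : 0 < r := hr0
    have hmem : ∀ s ∈ Set.Icc (0 : ℝ) 1, (x : ℂ) + r * q s ∈ Metric.ball (x : ℂ) ε := by
      intro s hs
      rw [mem_ball_iff_norm, add_sub_cancel_left, norm_mul, Complex.norm_real,
        Real.norm_of_nonneg hr0.le]
      exact (mul_le_mul_of_nonneg_left ((hR s hs).trans (by linarith)) hr0.le).trans_lt hr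
    have hcont : ContinuousOn (fun s => (δ (x + r * q s)).im) (Set.Icc (0 : ℝ) 1) := by
      refine Complex.continuous_im.comp_continuousOn fun s hs => ?_
      exact ((hball _ (hmem s hs)).2.1.continuousAt.comp (f := fun s : ℝ => (x : ℂ) + r * q s)
        (by fun_prop)).continuousWithinAt
    have hq0 : q 0 = u := by simp [q]
    have hq1 : q 1 = v := by simp [q]
    have hneg : (δ (x + r * q 0)).im ≤ 0 := by
      rw [hform r _ (hball _ (hmem 0 (by simp))).2.2, hq0]
      exact (mul_neg_of_pos_of_neg (by positivity) hru).le
    have hpos : 0 ≤ (δ (x + r * q 1)).im := by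
      rw [hform r _ (hball _ (hmem 1 (by simp))).2.2, hq1]
      exact (mul_pos (by positivity) hrv).le
    obtain ⟨s, hs, hs0⟩ := intermediate_value_Icc zero_le_one hcont ⟨hneg, hpos⟩
    refine ⟨x + r * q s, (hball _ (hmem s hs)).1, ?_, hs0⟩
    have h1 : ((x : ℂ) + r * q s).im = r * (q s).im := by simp
    rw [h1]
    exact (mul_pos hr0 (hqim s hs)).ne'

/-- Every solution of `F (z, d) = 0` with `d ∈ [-1, 1]` has a real `z`. -/
def RealOnInterval (F : ℂ[X][Y]) : Prop :=
  ∀ z : ℂ, ∀ d ∈ Set.Icc (-1 : ℝ) 1, F.evalEval z d = 0 → z.im = 0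

theorem RealOnInterval.eventually_im_eq_zero {F : ℂ[X][Y]} (hF : RealOnInterval F) {δ : ℂ → ℂ}
    {x d : ℝ} (hδ : ContinuousAt δ x) (h0 : ∀ᶠ z in 𝓝 (x : ℂ), F.evalEval z (δ z) = 0)
    (hx : δ x = d) (hd : d ∈ Set.Ioo (-1 : ℝ) 1) :
    ∀ᶠ z in 𝓝 (x : ℂ), (δ z).im = 0 → z.im = 0 := by
  have h1 : ∀ᶠ z in 𝓝 (x : ℂ), (δ z).re ∈ Set.Ioo (-1 : ℝ) 1 := by
    refine (Complex.continuous_re.continuousAt.comp hδ).eventually_mem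
      (isOpen_Ioo.mem_nhds ?_)
    simpa [hx] using hd
  filter_upwards [h0, h1] with z hz hre him
  refine hF z (δ z).re (Set.Ioo_subset_Icc_self hre) ?_
  rwa [show (((δ z).re : ℝ) : ℂ) = δ z from Complex.ext rfl (by simp [him])]

/-- At a critical point the branch would be real at nonreal points nearby. -/
theorem RealOnInterval.deriv_ne_zero {F : ℂ[X][Y]} (hF : RealOnInterval F) {δ : ℂ → ℂ}
    {x d : ℝ} (hδ : AnalyticAt ℂ δ x) (h0 : ∀ᶠ z in 𝓝 (x : ℂ), F.evalEval z (δ z) = 0)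
    (hx : δ x = d) (hd : d ∈ Set.Ioo (-1 : ℝ) 1) : deriv δ x ≠ 0 := by
  intro h
  have h1 := frequently_im_ne_zero_of_deriv_eq_zero hδ (by rw [hx, Complex.ofReal_im]) h
  obtain ⟨z, hz, hz'⟩ :=
    (h1.and_eventually (hF.eventually_im_eq_zero hδ.continuousAt h0 hx hd)).exists
  exact hz.1 (hz' hz.2)

/-- A holomorphic branch with a value in `(-1, 1)` at the real point `x` maps a real neighbourhood
of `x` to `(-1, 1)`: by `RealOnInterval` its local inverse is real on `(-1, 1)`. -/
theorem RealOnInterval.eventually_exists {F : ℂ[X][Y]} (hF : RealOnInterval F) {δ : ℂ → ℂ}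
    {x d : ℝ} (hδ : AnalyticAt ℂ δ x) (h0 : ∀ᶠ z in 𝓝 (x : ℂ), F.evalEval z (δ z) = 0)
    (hx : δ x = d) (hd : d ∈ Set.Ioo (-1 : ℝ) 1) :
    ∀ᶠ y : ℝ in 𝓝 x, ∃ d' ∈ Set.Icc (-1 : ℝ) 1, F.evalEval (y : ℂ) d' = 0 := by
  have hne := hF.deriv_ne_zero hδ h0 hx hd
  have hs : HasStrictDerivAt δ (deriv δ x) x := hδ.hasStrictDerivAt
  let g := hs.localInverse δ (deriv δ x) x hne
  have hgd : HasStrictDerivAt g (deriv δ x)⁻¹ d := hx ▸ hs.to_localInverse hne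
  have hgx : g d = x := by
    have := (hs.eventually_left_inverse hne).self_of_nhds
    rwa [hx] at this
  have hright : ∀ᶠ w in 𝓝 (d : ℂ), δ (g w) = w := hx ▸ hs.eventually_right_inverse hne
  have hgt : Tendsto g (𝓝 (d : ℂ)) (𝓝 (x : ℂ)) := by
    have := hgd.hasDerivAt.continuousAt.tendsto
    rwa [hgx] at this
  have hreal : ∀ᶠ s : ℝ in 𝓝 d, (g s).im = 0 ∧ F.evalEval (g s) s = 0 ∧
      s ∈ Set.Icc (-1 : ℝ) 1 := by
    have hof : Tendsto (fun s : ℝ => (s : ℂ)) (𝓝 d) (𝓝 (d : ℂ)) :=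
      Complex.continuous_ofReal.tendsto d
    filter_upwards [hof.eventually hright, (hgt.comp hof).eventually h0,
      (hgt.comp hof).eventually (hF.eventually_im_eq_zero hδ.continuousAt h0 hx hd),
      Icc_mem_nhds hd.1 hd.2] with s h1 h2 h3 h4
    simp only [Function.comp_apply, h1] at h2 h3
    exact ⟨h3 (Complex.ofReal_im s), h2, h4⟩
  -- the local inverse restricts to a real function with a nonzero derivative
  have hre : HasStrictDerivAt (fun s : ℝ => (g s).re) ((deriv δ x)⁻¹).re d :=
    hgd.real_of_complex
  have him : HasDerivAt (fun s : ℝ => (g s).im) ((deriv δ x)⁻¹).im d := by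
    have h1 := (hgd.hasDerivAt.const_mul (-Complex.I)).real_of_complex
    simpa using h1
  have him0 : ((deriv δ x)⁻¹).im = 0 :=
    him.unique ((hasDerivAt_const d (0 : ℝ)).congr_of_eventuallyEq (hreal.mono fun s hs => hs.1))
  have hre0 : ((deriv δ x)⁻¹).re ≠ 0 := fun h => inv_ne_zero hne (Complex.ext h him0)
  have hmap := hre.map_nhds_eq hre0
  rw [hgx, Complex.ofReal_re] at hmap
  rw [← hmap, eventually_map]
  filter_upwards [hreal] with s hs
  refine ⟨s, hs.2.2, ?_⟩
  rw [show (((g s).re : ℝ) : ℂ) = g s from Complex.ext rfl (by simp [hs.1])]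
  exact hs.2.1

/-- A real analytic function extends holomorphically. -/
theorem exists_analyticAt_ofReal_eq {δ : ℝ → ℝ} {x : ℝ} (hδ : AnalyticAt ℝ δ x) :
    ∃ f : ℂ → ℂ, AnalyticAt ℂ f x ∧ ∀ᶠ y : ℝ in 𝓝 x, f y = δ y := by
  obtain ⟨q, hq⟩ := hδ
  rw [hasFPowerSeriesAt_iff] at hq
  let a : ℕ → ℂ := fun n => (q.coeff n : ℂ)
  let Q := FormalMultilinearSeries.ofScalars ℂ a
  obtain ⟨ε, hε, hball⟩ := Metric.eventually_nhds_iff_ball.mp hq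
  have hhalf : (ε / 2) ∈ Metric.ball (0 : ℝ) ε := by
    rw [mem_ball_zero_iff, Real.norm_of_nonneg (by positivity)]
    linarith
  have hbdd : ∃ B, ∀ n, ‖Q n‖ * ((ε / 2).toNNReal : ℝ) ^ n ≤ B := by
    have h1 := (hball _ hhalf).summable.tendsto_atTop_zero.norm.bddAbove_range
    obtain ⟨B, hB⟩ := h1
    refine ⟨B, fun n => ?_⟩
    have h2 : ‖(ε / 2) ^ n • q.coeff n‖ ≤ B := hB ⟨n, rfl⟩
    rw [FormalMultilinearSeries.ofScalars_norm, Real.coe_toNNReal _ (by positivity)]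
    simp only [a, Complex.norm_real]
    rw [norm_smul, norm_pow, Real.norm_of_nonneg (by positivity : 0 ≤ ε / 2)] at h2
    linarith
  obtain ⟨B, hB⟩ := hbdd
  have hrad : 0 < Q.radius := by
    refine lt_of_lt_of_le ?_ (Q.le_radius_of_bound B hB)
    rw [ENNReal.coe_pos, Real.toNNReal_pos]
    positivity
  have hQ := (Q.hasFPowerSeriesOnBall hrad).hasFPowerSeriesAt
  refine ⟨fun z => Q.sum (z - x), ?_, ?_⟩
  · have h1 : AnalyticAt ℂ Q.sum (((x : ℂ)) - x) := by
      rw [sub_self]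
      exact hQ.analyticAt
    exact AnalyticAt.comp (f := fun z : ℂ => z - x) h1 (analyticAt_id.sub analyticAt_const)
  · rw [hasFPowerSeriesAt_iff] at hQ
    have h1 : Tendsto (fun y : ℝ => y - x) (𝓝 x) (𝓝 0) :=
      Continuous.tendsto' (by fun_prop) _ _ (sub_self x)
    have h2 : Tendsto (fun y : ℝ => (y : ℂ) - x) (𝓝 x) (𝓝 0) :=
      Continuous.tendsto' (by fun_prop) _ _ (sub_self _)
    filter_upwards [h1.eventually hq, h2.eventually hQ] with y hy hy'
    rw [zero_add] at hy'
    rw [add_sub_cancel] at hy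
    refine hy'.unique ?_
    have h3 := Complex.hasSum_ofReal.mpr hy
    have h4 : (fun n => ((y : ℂ) - x) ^ n • Q.coeff n)
        = fun n => (((y - x) ^ n • q.coeff n : ℝ) : ℂ) := by
      funext n
      rw [FormalMultilinearSeries.coeff_ofScalars]
      simp [a]
    rw [h4]
    exact h3

/-- The case of real analytic branches follows by analytic continuation to a neighbourhood. -/
theorem RealOnInterval.deriv_ne_zero_of_real {F : ℂ[X][Y]} (hF : RealOnInterval F)
    {δ : ℝ → ℝ} {x : ℝ} (hδ : AnalyticAt ℝ δ x)
    (h0 : ∀ᶠ y : ℝ in 𝓝 x, F.evalEval (y : ℂ) (δ y) = 0) (hx : δ x ∈ Set.Ioo (-1 : ℝ) 1) :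
    deriv δ x ≠ 0 := by
  obtain ⟨f, hf, hfδ⟩ := exists_analyticAt_ofReal_eq hδ
  have hFa : AnalyticAt ℂ (fun z => F.evalEval z (f z)) x := by
    have h1 : AnalyticAt ℂ (fun z => ∑ n ∈ Finset.range (F.natDegree + 1),
        (F.coeff n).eval z * f z ^ n) x := by
      refine Finset.analyticAt_fun_sum _ fun n _ => ?_
      exact ((AnalyticOnNhd.eval_polynomial (F.coeff n)) _ trivial).mul (hf.pow n)
    refine h1.congr (Eventually.of_forall fun z => ?_)
    exact (CurvePoint.evalEval_eq_sum F z (f z)).symm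
  have h1 : ∀ᶠ z in 𝓝 (x : ℂ), F.evalEval z (f z) = 0 := by
    rw [← hFa.frequently_zero_iff_eventually_zero]
    have h2 : Tendsto (fun y : ℝ => (y : ℂ)) (𝓝[≠] x) (𝓝[≠] (x : ℂ)) :=
      (Complex.continuous_ofReal.tendsto x).inf (tendsto_principal_principal.mpr
        fun y hy => by simpa using hy)
    refine h2.frequently (Eventually.frequently ?_)
    refine Eventually.filter_mono nhdsWithin_le_nhds ?_
    filter_upwards [h0, hfδ] with y hy hy'
    rw [hy', hy]
  have hfx : f x = (δ x : ℝ) := hfδ.self_of_nhds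
  have hne := hF.deriv_ne_zero hf h1 hfx hx
  intro hd
  have h3 := hf.differentiableAt.hasDerivAt.real_of_complex
  have h4 : HasDerivAt (fun y : ℝ => (f y).re) 0 x := by
    rw [← hd]
    refine hδ.differentiableAt.hasDerivAt.congr_of_eventuallyEq (hfδ.mono fun y hy => ?_)
    simp only [hy, Complex.ofReal_re]
  have h5 : HasDerivAt (fun y : ℝ => (f y).im) (deriv f x).im x := by
    have h6 := (hf.differentiableAt.hasDerivAt.const_mul (-Complex.I)).real_of_complex
    simpa using h6
  have h7 : HasDerivAt (fun y : ℝ => (f y).im) 0 x :=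
    (hasDerivAt_const x (0 : ℝ)).congr_of_eventuallyEq (hfδ.mono fun y hy => by
      simp only [hy, Complex.ofReal_im])
  exact hne (Complex.ext (h3.unique h4) (h5.unique h7))

/-- The inverse of an injective holomorphic function is holomorphic. -/
theorem exists_analyticAt_rightInverse {h : ℂ → ℂ} {w : ℂ} (hh : AnalyticAt ℂ h w)
    {V : Set ℂ} (hV : V ∈ 𝓝 w) (hinj : Set.InjOn h V) :
    ∃ g : ℂ → ℂ, AnalyticAt ℂ g (h w) ∧ g (h w) = w ∧ ∀ᶠ z in 𝓝 (h w), h (g z) = z := by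
  obtain ⟨W, hWV, hWo, hwW⟩ := mem_nhds_iff.mp (inter_mem hV hh.eventually_analyticAt)
  have hinjW : Set.InjOn h W := hinj.mono fun z hz => (hWV hz).1
  have han : ∀ z ∈ W, AnalyticAt ℂ h z := fun z hz => (hWV hz).2
  have hnc : ∀ z ∈ W, ¬ ∀ᶠ y in 𝓝 z, h y = h z := by
    intro z hz hcon
    have h1 : ∀ᶠ y in 𝓝 z, y = z := by
      filter_upwards [hcon, hWo.mem_nhds hz] with y hy hyW
      exact hinjW hyW hz hy
    obtain ⟨y, hy, hyz⟩ := ((h1.filter_mono nhdsWithin_le_nhds).and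
      (self_mem_nhdsWithin : ∀ᶠ y in 𝓝[≠] z, y ∈ ({z}ᶜ : Set ℂ))).exists
    exact hyz hy
  have hopen : ∀ z ∈ W, 𝓝 (h z) ≤ map h (𝓝 z) := fun z hz =>
    ((han z hz).eventually_constant_or_nhds_le_map_nhds).resolve_left (hnc z hz)
  have hnbhd : ∀ z ∈ W, ∀ U ∈ 𝓝 z, h '' (U ∩ W) ∈ 𝓝 (h z) := fun z hz U hU =>
    hopen z hz (image_mem_map (inter_mem hU (hWo.mem_nhds hz)))
  let g := Function.invFunOn h W
  have hgl : ∀ z ∈ W, g (h z) = z := fun z hz => hinjW.leftInvOn_invFunOn hz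
  have hgr : ∀ᶠ z in 𝓝 (h w), h (g z) = z := by
    filter_upwards [hnbhd w hwW _ univ_mem]
    rintro _ ⟨z, ⟨-, hz⟩, rfl⟩
    rw [hgl z hz]
  have hgc : ∀ z ∈ W, ContinuousAt g (h z) := by
    intro z hz U hU
    rw [hgl z hz] at hU
    refine mem_map.mpr (mem_of_superset (hnbhd z hz U hU) ?_)
    rintro _ ⟨y, ⟨hyU, hyW⟩, rfl⟩
    rwa [Set.mem_preimage, hgl y hyW]
  have hderiv : ∀ᶠ z in 𝓝[≠] w, deriv h z ≠ 0 := by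
    rcases hh.deriv.eventually_eq_zero_or_eventually_ne_zero with h0 | h0
    · exfalso
      obtain ⟨ε, hε, hball⟩ := Metric.eventually_nhds_iff_ball.mp
        (h0.and (hWo.mem_nhds hwW))
      refine hnc w hwW ?_
      filter_upwards [Metric.ball_mem_nhds w hε] with y hy
      exact (convex_ball w ε).is_const_of_fderivWithin_eq_zero (𝕜 := ℂ)
        (fun z hz => (han z (hball z hz).2).differentiableAt.differentiableWithinAt)
        (fun z hz => by
          rw [fderivWithin_of_isOpen Metric.isOpen_ball hz]
          ext
          simpa using (hball z hz).1) hy (Metric.mem_ball_self hε)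
    · exact h0
  refine ⟨g, ?_, hgl w hwW, hgr⟩
  refine Complex.analyticAt_of_differentiable_on_punctured_nhds_of_continuousAt ?_ (hgc w hwW)
  have htend : Tendsto g (𝓝[≠] (h w)) (𝓝[≠] w) := by
    refine tendsto_nhdsWithin_iff.mpr ⟨?_, ?_⟩
    · have h1 := (hgc w hwW).tendsto
      rw [hgl w hwW] at h1
      exact h1.mono_left nhdsWithin_le_nhds
    · filter_upwards [hgr.filter_mono nhdsWithin_le_nhds, self_mem_nhdsWithin] with z hz hne hzw
      rw [Set.mem_singleton_iff.mp hzw] at hz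
      exact hne hz.symm
  filter_upwards [htend.eventually hderiv, hgr.filter_mono nhdsWithin_le_nhds,
    htend.eventually (nhdsWithin_le_nhds (hWo.mem_nhds hwW)),
    (hgr.eventually_nhds).filter_mono nhdsWithin_le_nhds] with z h1 h2 h3 h4
  have h5 : ContinuousAt g z := by
    have := hgc (g z) h3
    rwa [h2] at this
  exact (HasDerivAt.of_local_left_inverse h5 ((han _ h3).differentiableAt.hasDerivAt) h1
    h4).differentiableAt

/-- Near a point that is not a branch point, the function has a holomorphic branch. -/
theorem FunctionOnCover.exists_branch {S : FunctionOnCover} {z : ℂ} (hz : ¬ S.IsBranchPoint z)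
    {P : S.carrier} (hP : P ∈ S.fiber z) :
    ∃ δ : ℂ → ℂ, AnalyticAt ℂ δ z ∧ δ z = S.fn P ∧ ∀ᶠ y in 𝓝 z, δ y ∈ S.fn '' S.fiber y := by
  unfold FunctionOnCover.IsBranchPoint at hz
  push Not at hz
  obtain ⟨U, hU, hinj⟩ := hz P hP
  let φ := chartAt ℂ P
  have hφP : P ∈ φ.source := mem_chart_source ℂ P
  have hφP' : φ P ∈ φ.target := φ.map_source hφP
  have hsymm : φ.symm (φ P) = P := φ.left_inv hφP
  have hana : ∀ f : S.carrier → ℂ, MDifferentiable 𝓘(ℂ) 𝓘(ℂ) f →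
      AnalyticAt ℂ (f ∘ φ.symm) (φ P) := by
    intro f hf
    have h1 : MDifferentiableOn 𝓘(ℂ) 𝓘(ℂ) (f ∘ φ.symm) φ.target :=
      hf.comp_mdifferentiableOn
        ((contMDiffOn_chart_symm (I := 𝓘(ℂ)) (n := ω) (x := P)).mdifferentiableOn (by simp))
    exact (mdifferentiableOn_iff_differentiableOn.mp h1).analyticAt
      (φ.open_target.mem_nhds hφP')
  have hV : φ.symm ⁻¹' U ∩ φ.target ∈ 𝓝 (φ P) := by
    refine inter_mem ?_ (φ.open_target.mem_nhds hφP')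
    refine (φ.symm.continuousAt hφP').preimage_mem_nhds ?_
    rwa [hsymm]
  obtain ⟨g, hg, hgP, hgr⟩ := exists_analyticAt_rightInverse (hana _ S.proj_holomorphic) hV
    (fun a ha b hb hab => φ.symm.injOn ha.2 hb.2 (hinj ha.1 hb.1 hab))
  have hbase : (S.proj ∘ φ.symm) (φ P) = z := by rw [Function.comp_apply, hsymm]; exact hP
  rw [hbase] at hg hgP hgr
  refine ⟨(S.fn ∘ φ.symm) ∘ g, ?_, ?_, ?_⟩
  · refine AnalyticAt.comp ?_ hg
    rw [hgP]
    exact hana _ S.fn_holomorphic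
  · rw [Function.comp_apply, hgP, Function.comp_apply, hsymm]
  · filter_upwards [hgr] with y hy
    exact ⟨φ.symm (g y), hy, rfl⟩

/-! ### Polynomials near infinity -/

theorem eventually_one_le_norm : ∀ᶠ z in Bornology.cobounded ℂ, 1 ≤ ‖z‖ :=
  tendsto_norm_cobounded_atTop.eventually_ge_atTop 1

theorem tendsto_norm_inv_cobounded :
    Tendsto (fun z : ℂ => ‖z‖⁻¹) (Bornology.cobounded ℂ) (𝓝 0) :=
  tendsto_inv_atTop_zero.comp tendsto_norm_cobounded_atTop

theorem isBigO_eval_div_pow_sub {q : ℂ[X]} {N : ℕ} (h : q.natDegree ≤ N) :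
    (fun z => q.eval z / z ^ N - q.coeff N) =O[Bornology.cobounded ℂ] fun z => ‖z‖⁻¹ := by
  have h1 : (fun z => q.eval z / z ^ N - q.coeff N) =ᶠ[Bornology.cobounded ℂ]
      fun z => ∑ i ∈ Finset.range N, q.coeff i * (z ^ i / z ^ N) := by
    filter_upwards [eventually_one_le_norm] with z hz
    have hz0 : z ≠ 0 := norm_pos_iff.mp (by linarith)
    rw [eval_eq_sum_range' (Nat.lt_succ_of_le h), Finset.sum_range_succ, add_div,
      mul_div_cancel_right₀ _ (pow_ne_zero _ hz0), add_sub_cancel_right, Finset.sum_div]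
    exact Finset.sum_congr rfl fun i _ => by ring
  refine h1.trans_isBigO (IsBigO.fun_sum fun i hi => IsBigO.const_mul_left ?_ _)
  refine IsBigO.of_bound 1 ?_
  filter_upwards [eventually_one_le_norm] with z hz
  have hz0 : 0 < ‖z‖ := by linarith
  rw [norm_div, norm_pow, norm_pow, one_mul, norm_inv, norm_norm, div_le_iff₀ (by positivity)]
  have h2 : ‖z‖ ^ (i + 1) ≤ ‖z‖ ^ N := pow_le_pow_right₀ hz (Finset.mem_range.mp hi)
  rw [pow_succ] at h2
  rw [inv_mul_eq_div, le_div_iff₀ hz0]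
  exact h2

theorem natDegree_le_of_isBigO {q : ℂ[X]} {N : ℕ}
    (h : (fun z => q.eval z / z ^ N) =O[Bornology.cobounded ℂ] fun _ => (1 : ℝ)) :
    q.natDegree ≤ N := by
  by_contra! hlt
  obtain ⟨k, hk⟩ : ∃ k, q.natDegree = N + (k + 1) := ⟨q.natDegree - N - 1, by omega⟩
  have h1 : Tendsto (fun z => q.eval z / z ^ q.natDegree - q.leadingCoeff)
      (Bornology.cobounded ℂ) (𝓝 0) :=
    (isBigO_eval_div_pow_sub le_rfl).trans_tendsto tendsto_norm_inv_cobounded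
  have h2 : Tendsto (fun z => q.eval z / z ^ q.natDegree) (Bornology.cobounded ℂ) (𝓝 0) := by
    have h3 : (fun z : ℂ => 1 / z ^ (k + 1)) =O[Bornology.cobounded ℂ] fun z => ‖z‖⁻¹ := by
      refine IsBigO.of_bound 1 ?_
      filter_upwards [eventually_one_le_norm] with z hz
      rw [norm_div, norm_pow, one_mul, norm_inv, norm_norm, norm_one, one_div]
      refine inv_anti₀ (by linarith) ?_
      simpa using pow_le_pow_right₀ hz (show 1 ≤ k + 1 by omega)
    have h4 := h.mul h3
    simp only [one_mul] at h4
    refine (h4.trans_tendsto tendsto_norm_inv_cobounded).congr fun z => ?_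
    rw [hk, pow_add z N, div_mul_div_comm, mul_one]
  have h5 := tendsto_nhds_unique (h1.add_const q.leadingCoeff) (by simpa using h2)
  rw [zero_add, leadingCoeff_eq_zero] at h5
  rw [h5, natDegree_zero] at hlt
  omega

/-! ### Numbering the roots of nearby polynomials -/

theorem roots_prod_X_sub_C_apply {ι : Type*} (s : Finset ι) (f : ι → ℂ) :
    (∏ i ∈ s, (X - C (f i))).roots = s.val.map f := by
  change (s.val.map ((fun a => X - C a) ∘ f)).prod.roots = _
  rw [← Multiset.map_map, roots_multiset_prod_X_sub_C]

theorem exists_equiv_of_prod_eq {ι κ : Type*} [Fintype ι] [Fintype κ] (r : ι → ℂ) (s : κ → ℂ)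
    (h : {t : ℂ | ∏ i, (t - r i) = ∏ j, (t - s j)}.Infinite) :
    ∃ e : ι ≃ κ, ∀ i, s (e i) = r i := by
  classical
  have h1 : (∏ i, (X - C (r i))) = ∏ j, (X - C (s j)) := by
    refine eq_of_infinite_eval_eq _ _ (h.mono fun t ht => ?_)
    simpa [eval_prod] using ht
  have h2 : Finset.univ.val.map r = Finset.univ.val.map s := by
    rw [← roots_prod_X_sub_C_apply, ← roots_prod_X_sub_C_apply, h1]
  have h4 : ∀ c, Fintype.card {i // r i = c} = Fintype.card {j // s j = c} := by
    intro c
    have h5 := congrArg (Multiset.count c) h2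
    rw [Multiset.count_map, Multiset.count_map] at h5
    rw [Fintype.card_subtype, Fintype.card_subtype, Finset.card_def, Finset.card_def,
      Finset.filter_val, Finset.filter_val]
    simpa [eq_comm] using h5
  exact ⟨Equiv.ofFiberEquiv fun c => Fintype.equivOfCardEq (h4 c),
    fun i => Equiv.ofFiberEquiv_map _ i⟩

/-- The roots of polynomials that converge to `∏ i, (t - r i)` can be numbered so that the root
with the number `i` is near `r i`. -/
theorem eventually_exists_numbering {α ι : Type*} [Fintype ι] {l : Filter α} {r : ι → ℂ}
    {G : α → ℂ → ℂ} (hG : ∀ᶠ z in l, ∃ μ : ι → ℂ, ∀ t, G z t = ∏ i, (t - μ i)) {B : ℝ}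
    (hB : ∀ᶠ z in l, ∀ t, G z t = 0 → ‖t‖ ≤ B)
    (hlim : ∀ t, Tendsto (fun z => G z t) l (𝓝 (∏ i, (t - r i)))) {ε : ℝ} (hε : 0 < ε) :
    ∀ᶠ z in l, ∃ μ : ι → ℂ, (∀ t, G z t = ∏ i, (t - μ i)) ∧ ∀ i, ‖μ i - r i‖ < ε := by
  classical
  -- along an ultrafilter any numbering converges, and its limit is a permutation of `r`
  refine mem_iff_ultrafilter.mpr fun U hU => ?_
  have hex : ∃ μ : α → ι → ℂ, ∀ᶠ z in U, ∀ t, G z t = ∏ i, (t - μ z i) := by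
    choose! μ hμ using fun z (h : ∃ μ : ι → ℂ, ∀ t, G z t = ∏ i, (t - μ i)) => h
    exact ⟨μ, (hG.filter_mono hU).mono hμ⟩
  obtain ⟨μ, hμ⟩ := hex
  have hbdd : ∀ᶠ z in U, μ z ∈ Set.pi Set.univ fun _ : ι => Metric.closedBall (0 : ℂ) B := by
    filter_upwards [hμ, hB.filter_mono hU] with z hz hz' i _
    rw [mem_closedBall_zero_iff]
    refine hz' _ ?_
    rw [hz]
    exact Finset.prod_eq_zero (Finset.mem_univ i) (sub_self _)
  have hcomp : IsCompact (Set.pi Set.univ fun _ : ι => Metric.closedBall (0 : ℂ) B) :=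
    isCompact_univ_pi fun _ => isCompact_closedBall _ _
  obtain ⟨s, -, hs⟩ := hcomp.ultrafilter_le_nhds (U.map μ) (le_principal_iff.mpr hbdd)
  have hs' : Tendsto μ U (𝓝 s) := hs
  have hsi : ∀ i, Tendsto (fun z => μ z i) U (𝓝 (s i)) := fun i => (tendsto_pi_nhds.mp hs') i
  have hprod : ∀ t, ∏ i, (t - r i) = ∏ i, (t - s i) := fun t => by
    refine tendsto_nhds_unique ((hlim t).mono_left hU) ?_
    refine Tendsto.congr' (hμ.mono fun z hz => (hz t).symm) ?_
    exact tendsto_finsetProd _ fun i _ => tendsto_const_nhds.sub (hsi i)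
  obtain ⟨e, he⟩ := exists_equiv_of_prod_eq r s
    (Set.infinite_univ.mono fun t _ => hprod t)
  have hnear : ∀ᶠ z in U, ∀ i, ‖μ z (e i) - r i‖ < ε := by
    rw [eventually_all]
    intro i
    have h1 := ((hsi (e i)).sub_const (r i)).norm
    rw [he, sub_self, norm_zero] at h1
    exact h1.eventually_lt_const hε
  filter_upwards [hμ, hnear] with z hz hz'
  exact ⟨fun i => μ z (e i), fun t => by
    rw [hz, ← e.prod_comp fun i => t - μ z i], hz'⟩

/-- In a suitable numbering, the `n`-th powers of the distances of the roots are bounded by the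
distance of the polynomials, where `n` is the degree. -/
theorem eventually_exists_numbering_pow_le {α ι : Type*} [Fintype ι] {l : Filter α} {r : ι → ℂ}
    {G : α → ℂ → ℂ} (hG : ∀ᶠ z in l, ∃ μ : ι → ℂ, ∀ t, G z t = ∏ i, (t - μ i)) {B : ℝ}
    (hB : ∀ᶠ z in l, ∀ t, G z t = 0 → ‖t‖ ≤ B) {η : α → ℝ}
    (hlim : ∀ t, Tendsto (fun z => G z t) l (𝓝 (∏ i, (t - r i))))
    (hrate : ∀ᶠ z in l, ∀ t, ‖t‖ ≤ B → ‖G z t - ∏ i, (t - r i)‖ ≤ η z) :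
    ∀ᶠ z in l, ∃ μ : ι → ℂ, (∀ t, G z t = ∏ i, (t - μ i)) ∧
      ∀ i, ‖μ i - r i‖ < 1 ∧ ‖μ i - r i‖ ^ Fintype.card ι ≤ η z := by
  have hsep : ∃ ε : ℝ, 0 < ε ∧ ε < 1 ∧ ∀ i k, r i ≠ r k → 2 * ε < ‖r i - r k‖ := by
    have h1 : ∀ᶠ ε : ℝ in 𝓝[>] 0, ∀ i k, r i ≠ r k → 2 * ε < ‖r i - r k‖ := by
      rw [eventually_all]
      intro i
      rw [eventually_all]
      intro k
      by_cases h : r i = r k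
      · exact Eventually.of_forall fun _ h' => absurd h h'
      · have h2 : Tendsto (fun ε : ℝ => 2 * ε) (𝓝[>] 0) (𝓝 0) := by
          refine Tendsto.mono_left ?_ nhdsWithin_le_nhds
          exact Continuous.tendsto' (by fun_prop) _ _ (by simp)
        exact (h2.eventually_lt_const (norm_pos_iff.mpr (sub_ne_zero.mpr h))).mono fun _ h' _ => h'
    have h3 : ∀ᶠ ε : ℝ in 𝓝[>] 0, ε < 1 :=
      (eventually_lt_nhds one_pos).filter_mono nhdsWithin_le_nhds
    obtain ⟨ε, ⟨h4, h5⟩, h6⟩ := ((h1.and h3).and self_mem_nhdsWithin).exists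
    exact ⟨ε, h6, h5, h4⟩
  obtain ⟨ε, hε, hε1, hsep⟩ := hsep
  filter_upwards [eventually_exists_numbering hG hB hlim hε, hB, hrate] with z ⟨μ, hμ, hμr⟩ hz hz'
  refine ⟨μ, hμ, fun i => ⟨(hμr i).trans hε1, ?_⟩⟩
  have h0 : G z (μ i) = 0 := by
    rw [hμ]
    exact Finset.prod_eq_zero (Finset.mem_univ i) (sub_self _)
  have h1 := hz' _ (hz _ h0)
  rw [h0, zero_sub, norm_neg, norm_prod] at h1
  refine le_trans ?_ h1
  rw [← Finset.card_univ, ← Finset.prod_const]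
  refine Finset.prod_le_prod (fun _ _ => norm_nonneg _) fun k _ => ?_
  by_cases h : r i = r k
  · rw [h]
  · have h2 := hsep i k h
    have h3 := norm_sub_norm_le (r i - r k) (r i - μ i)
    rw [sub_sub_sub_cancel_left, norm_sub_rev (r i) (μ i)] at h3
    linarith [hμr i]

/-! ### Monic factors -/

theorem exists_monic_irreducible_list {F : ℂ[X][Y]} (hF : F.Monic) :
    ∃ L : List ℂ[X][Y], (∀ g ∈ L, g.Monic ∧ Irreducible g) ∧ L.prod = F := by
  induction hn : F.natDegree using Nat.strong_induction_on generalizing F with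
  | _ n ih =>
    by_cases h1 : F = 1
    · exact ⟨[], by simp, by simp [h1]⟩
    · obtain ⟨g, hg, h, rfl⟩ := WfDvdMonoid.exists_irreducible_factor
        (fun hu => h1 (hF.eq_one_of_isUnit hu)) hF.ne_zero
      have hlead : g.leadingCoeff * h.leadingCoeff = 1 := by
        rw [← leadingCoeff_mul]
        exact hF
      have hu : IsUnit (C h.leadingCoeff) :=
        isUnit_C.mpr (IsUnit.of_mul_eq_one_right _ hlead)
      have hm1 : (g * C h.leadingCoeff).Monic := by
        rw [Monic, leadingCoeff_mul, leadingCoeff_C, hlead]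
      have hm2 : (C g.leadingCoeff * h).Monic := by
        rw [Monic, leadingCoeff_mul, leadingCoeff_C, hlead]
      have hirr : Irreducible (g * C h.leadingCoeff) :=
        (associated_mul_unit_right g _ hu).irreducible hg
      have hprod : g * C h.leadingCoeff * (C g.leadingCoeff * h) = g * h := by
        have h2 : (C g.leadingCoeff * C h.leadingCoeff : ℂ[X][Y]) = 1 := by
          rw [← C_mul, hlead, C_1]
        linear_combination (g * h) * h2
      have hdeg : (C g.leadingCoeff * h).natDegree < n := by
        rw [← hn, ← hprod, hm1.natDegree_mul hm2]
        have h3 : (g * C h.leadingCoeff).natDegree ≠ 0 := fun h0 =>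
          hirr.not_isUnit (by rw [hm1.natDegree_eq_zero.mp h0]; exact isUnit_one)
        omega
      obtain ⟨L, hL, hLp⟩ := ih _ hdeg hm2 rfl
      refine ⟨(g * C h.leadingCoeff) :: L, ?_, by rw [List.prod_cons, hLp, hprod]⟩
      intro f hf
      rcases List.mem_cons.mp hf with rfl | hf
      · exact ⟨hm1, hirr⟩
      · exact hL f hf

theorem exists_monic_irreducible_factors {F : ℂ[X][Y]} (hF : F.Monic) :
    ∃ (k : ℕ) (Φ : Fin k → ℂ[X][Y]), (∀ s, (Φ s).Monic) ∧ (∀ s, Irreducible (Φ s)) ∧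
      ∏ s, Φ s = F := by
  obtain ⟨L, hL, rfl⟩ := exists_monic_irreducible_list hF
  exact ⟨L.length, L.get, fun s => (hL _ (L.get_mem s)).1, fun s => (hL _ (L.get_mem s)).2,
    by rw [← List.prod_ofFn, List.ofFn_get]⟩

/-- Distinct monic irreducible polynomials have common roots over finitely many points only. -/
theorem finite_common_roots {f g : ℂ[X][Y]} (hf : f.Monic) (hg : g.Monic) (hf' : Irreducible f)
    (hg' : Irreducible g) (hne : f ≠ g) :
    {z : ℂ | ∃ y, f.evalEval z y = 0 ∧ g.evalEval z y = 0}.Finite := by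
  have hcop : IsCoprime (f.map (algebraMap ℂ[X] (FractionRing ℂ[X])))
      (g.map (algebraMap ℂ[X] (FractionRing ℂ[X]))) := by
    have h1 := (Monic.irreducible_iff_irreducible_map_fraction_map (K := FractionRing ℂ[X])
      hf).mp hf'
    have h2 := (Monic.irreducible_iff_irreducible_map_fraction_map (K := FractionRing ℂ[X])
      hg).mp hg'
    refine (h1.isCoprime_or_dvd _).resolve_right fun hd => hne ?_
    refine map_injective _ (IsFractionRing.injective ℂ[X] (FractionRing ℂ[X])) ?_
    exact eq_of_monic_of_associated (hf.map _) (hg.map _) (h1.associated_of_dvd h2 hd)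
  obtain ⟨r, hr, h⟩ := exists_ne_zero_of_isCoprime_map hf hcop
  refine (Multiset.finite_toSet r.roots).subset fun z ⟨y, hy, hy'⟩ => (mem_roots hr).mpr ?_
  by_contra h0
  exact h z h0 y hy hy'

/-! ### Discriminants -/

section Discriminant

variable {m : ℕ} {Φ : ℂ[X][Y]} {Δ : Fin m → ℂ → ℂ} {w : Finset (Fin m)}

theorem map_eval_eq_prod {z : ℂ} (h : ∀ ν, Φ.evalEval z ν = ∏ j ∈ w, (ν - Δ j z)) :
    Φ.map (evalRingHom z) = ∏ j ∈ w, (X - C (Δ j z)) := by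
  refine Polynomial.funext fun ν => ?_
  rw [map_evalRingHom_eval, h, eval_prod]
  simp

theorem discrProd_eq_zero_of_not_simpleRootsAt {z : ℂ}
    (h : ∀ ν, Φ.evalEval z ν = ∏ j ∈ w, (ν - Δ j z)) (hs : ¬ SimpleRootsAt Φ z) :
    discrProd Δ w z = 0 := by
  have h1 : ¬ (∏ j ∈ w, (X - C (Δ j z))).Separable := by
    rw [← map_eval_eq_prod h]
    rintro ⟨a, b, hab⟩
    refine hs fun y hy hy' => ?_
    have h2 := congrArg (eval y) hab
    rw [eval_add, eval_mul, eval_mul, derivative_map, map_evalRingHom_eval, map_evalRingHom_eval,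
      hy, hy', mul_zero, mul_zero, add_zero, eval_one] at h2
    exact zero_ne_one h2
  rw [separable_prod_X_sub_C_iff'] at h1
  push Not at h1
  obtain ⟨i, hi, j, hj, hij, hne⟩ := h1
  rcases lt_or_gt_of_ne hne with hlt | hlt
  · refine Finset.prod_eq_zero (i := (i, j)) (by simp [hi, hj, hlt]) ?_
    simp [hij]
  · refine Finset.prod_eq_zero (i := (j, i)) (by simp [hi, hj, hlt]) ?_
    simp [hij]

theorem prod_offDiag_eq_prod_lt (f : Fin m → Fin m → ℂ) :
    ∏ i ∈ w, ∏ j ∈ w.erase i, f i j =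
      ∏ q ∈ (w ×ˢ w).filter (fun q => q.1 < q.2), (f q.1 q.2 * f q.2 q.1) := by
  have h1 : ∏ i ∈ w, ∏ j ∈ w.erase i, f i j =
      ∏ q ∈ (w ×ˢ w).filter (fun q => q.1 ≠ q.2), f q.1 q.2 := by
    rw [Finset.prod_filter, Finset.prod_product]
    refine Finset.prod_congr rfl fun i _ => ?_
    rw [← Finset.prod_filter]
    refine Finset.prod_congr ?_ fun _ _ => rfl
    ext j
    simp only [Finset.mem_erase, Finset.mem_filter]
    tauto
  have h2 : (w ×ˢ w).filter (fun q => q.1 ≠ q.2) = (w ×ˢ w).filter (fun q => q.1 < q.2) ∪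
      (w ×ˢ w).filter (fun q => q.2 < q.1) := by
    rw [← Finset.filter_or]
    exact Finset.filter_congr fun q _ => ne_iff_lt_or_gt
  have h3 : ∏ q ∈ (w ×ˢ w).filter (fun q => q.2 < q.1), f q.1 q.2 =
      ∏ q ∈ (w ×ˢ w).filter (fun q => q.1 < q.2), f q.2 q.1 := by
    refine Finset.prod_nbij' Prod.swap Prod.swap ?_ ?_ ?_ ?_ ?_ <;>
      simp +contextual
  rw [h1, h2, Finset.prod_union, h3, Finset.prod_mul_distrib]
  rw [Finset.disjoint_filter]
  exact fun q _ h h' => lt_asymm h h'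

/-- The discriminant of a monic polynomial is a resultant up to a sign. -/
theorem exists_polynomial_discrProd (hΦ : Φ.Monic)
    (h : ∀ z ν, Φ.evalEval z ν = ∏ j ∈ w, (ν - Δ j z)) :
    ∃ q : ℂ[X], ∀ z, q.eval z = discrProd Δ w z := by
  classical
  let N := ((w ×ˢ w).filter (fun q => q.1 < q.2)).card
  refine ⟨C ((-1) ^ N) * Φ.resultant Φ.derivative Φ.natDegree Φ.natDegree, fun z => ?_⟩
  have hm := map_eval_eq_prod (h z)
  have hroots : (Φ.map (evalRingHom z)).roots = w.val.map fun j => Δ j z := by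
    rw [hm, roots_prod_X_sub_C_apply]
  have hder : ∀ i ∈ w, (Φ.map (evalRingHom z)).derivative.eval (Δ i z)
      = ∏ j ∈ w.erase i, (Δ i z - Δ j z) := by
    intro i hi
    rw [hm, ← Finset.mul_prod_erase w _ hi, derivative_mul]
    simp [eval_prod]
  have hres : (Φ.resultant Φ.derivative Φ.natDegree Φ.natDegree).eval z
      = ∏ i ∈ w, ∏ j ∈ w.erase i, (Δ i z - Δ j z) := by
    rw [← coe_evalRingHom, ← resultant_map_map, ← hΦ.natDegree_map (evalRingHom z),
      ← derivative_map, resultant_eq_prod_eval _ _ _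
        ((natDegree_derivative_le _).trans (Nat.sub_le _ _)) (IsAlgClosed.splits _),
      (hΦ.map _).leadingCoeff, one_pow, one_mul, hroots, Multiset.map_map]
    exact Finset.prod_congr rfl hder
  rw [eval_mul, eval_C, hres, prod_offDiag_eq_prod_lt, discrProd, ← Finset.prod_const,
    ← Finset.prod_mul_distrib]
  exact Finset.prod_congr rfl fun q _ => by ring

end Discriminant

/-! ### Rescaling near infinity -/

theorem evalEval_scaled {Φ : ℂ[X][Y]} {z a : ℂ} (ha : a ≠ 0) (t : ℂ) :
    (2 / a) ^ Φ.natDegree * Φ.evalEval z (a * t / 2) = ∑ k ∈ Finset.range (Φ.natDegree + 1),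
      (Φ.coeff k).eval z * (2 / a) ^ (Φ.natDegree - k) * t ^ k := by
  rw [CurvePoint.evalEval_eq_sum, Finset.mul_sum]
  refine Finset.sum_congr rfl fun k hk => ?_
  have h1 : Φ.natDegree = (Φ.natDegree - k) + k := by
    have := Finset.mem_range.mp hk
    omega
  have h2 : (2 / a) ^ Φ.natDegree = (2 / a) ^ (Φ.natDegree - k) * (2 / a) ^ k := by
    rw [← pow_add, ← h1]
  rw [h2, div_pow 2 a k, div_pow (a * t), mul_pow]
  field_simp

/-- If the roots of `Φ (z, ·)` are `O (z ^ p)`, then the rescaled polynomials converge at the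
rate `‖z‖⁻¹`, as their coefficients are polynomials in `z⁻¹`. -/
theorem exists_limit_scaled {Φ : ℂ[X][Y]} (hΦ : Φ.Monic) {p : ℕ} {K : ℝ}
    (hK : ∀ᶠ z in Bornology.cobounded ℂ, ∀ ν, Φ.evalEval z ν = 0 → ‖ν‖ ≤ K * ‖z‖ ^ p) :
    ∃ q : ℂ[X], q.Monic ∧ q.natDegree = Φ.natDegree ∧
      ∀ B : ℝ, ∃ K' : ℝ, ∀ᶠ z in Bornology.cobounded ℂ, ∀ t, ‖t‖ ≤ B →
        ‖(2 / z ^ p) ^ Φ.natDegree * Φ.evalEval z (z ^ p * t / 2) - q.eval t‖ ≤ K' * ‖z‖⁻¹ := by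
  let n := Φ.natDegree
  have hcoef : ∀ k, (fun z => (Φ.coeff k).eval z / z ^ (p * (n - k)))
      =O[Bornology.cobounded ℂ] fun _ => (1 : ℝ) := by
    intro k
    refine IsBigO.of_bound (K ^ (n - k) * n.choose k) ?_
    filter_upwards [hK, eventually_one_le_norm] with z hz hz1
    have h1 := coeff_le_of_roots_le (f := evalRingHom z) k hΦ (IsAlgClosed.splits _)
      (B := K * ‖z‖ ^ p) fun ν hν => hz ν (by
        rw [← map_evalRingHom_eval]
        exact (mem_roots'.mp hν).2)
    rw [coeff_map, coe_evalRingHom, mul_pow, ← pow_mul] at h1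
    rw [norm_div, norm_pow, div_le_iff₀ (by positivity), norm_one, mul_one]
    calc _ ≤ _ := h1
      _ = _ := by ring
  let c : ℕ → ℂ := fun k => 2 ^ (n - k) * (Φ.coeff k).coeff (p * (n - k))
  have hc : ∀ k, (fun z => (Φ.coeff k).eval z * (2 / z ^ p) ^ (n - k) - c k)
      =O[Bornology.cobounded ℂ] fun z => ‖z‖⁻¹ := by
    intro k
    refine ((isBigO_eval_div_pow_sub (natDegree_le_of_isBigO (hcoef k))).const_mul_left
      (2 ^ (n - k))).congr_left fun z => ?_
    rw [div_pow, ← pow_mul]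
    ring
  let q : ℂ[X] := ∑ k ∈ Finset.range (n + 1), C (c k) * X ^ k
  have hqc : q.coeff n = 1 := by
    rw [finsetSum_coeff, Finset.sum_eq_single n]
    · simp only [coeff_C_mul_X_pow, if_true, c, n, hΦ.coeff_natDegree, Nat.sub_self, mul_zero,
        pow_zero, coeff_one_zero, mul_one]
    · intro k _ hk
      rw [coeff_C_mul_X_pow, if_neg hk.symm]
    · simp
  have hqd : q.natDegree ≤ n := by
    refine natDegree_sum_le_of_forall_le _ _ fun k hk => (natDegree_C_mul_X_pow_le _ _).trans ?_
    have := Finset.mem_range.mp hk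
    omega
  refine ⟨q, monic_of_natDegree_le_of_coeff_eq_one n hqd hqc, le_antisymm hqd
    (le_natDegree_of_ne_zero (by rw [hqc]; exact one_ne_zero)), fun B => ?_⟩
  choose K' hK' using fun k => (hc k).bound
  refine ⟨∑ k ∈ Finset.range (n + 1), K' k * |B| ^ k, ?_⟩
  have hall : ∀ᶠ z in Bornology.cobounded ℂ, ∀ k ∈ Finset.range (n + 1),
      ‖(Φ.coeff k).eval z * (2 / z ^ p) ^ (n - k) - c k‖ ≤ K' k * ‖‖z‖⁻¹‖ :=
    (eventually_all_finset _).mpr fun k _ => hK' k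
  filter_upwards [hall, eventually_one_le_norm] with z hz hz1 t ht
  have hz0 : z ≠ 0 := norm_pos_iff.mp (by linarith)
  rw [evalEval_scaled (pow_ne_zero _ hz0), eval_finsetSum, ← Finset.sum_sub_distrib,
    Finset.sum_mul]
  refine norm_sum_le_of_le _ fun k hk => ?_
  have h1 := hz k hk
  rw [norm_inv, norm_norm] at h1
  rw [eval_mul, eval_C, eval_pow, eval_X, ← sub_mul, norm_mul, norm_pow]
  calc _ ≤ K' k * ‖z‖⁻¹ * |B| ^ k :=
        mul_le_mul h1 (pow_le_pow_left₀ (norm_nonneg _) (ht.trans (le_abs_self B)) _)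
          (by positivity) ((norm_nonneg _).trans h1)
    _ = _ := by ring

theorem isBigO_prod_sub_prod {ι α : Type*} {l : Filter α} (s : Finset ι) {f : ι → α → ℂ}
    {c : ι → ℂ} {g : α → ℝ} (hg : g =O[l] fun _ => (1 : ℝ))
    (h : ∀ i ∈ s, (fun z => f i z - c i) =O[l] g) :
    (fun z => ∏ i ∈ s, f i z - ∏ i ∈ s, c i) =O[l] g := by
  classical
  induction s using Finset.induction_on with
  | empty => simpa using isBigO_zero g l
  | insert i s hi ih =>
    have h1 := h i (Finset.mem_insert_self i s)
    have h2 := ih fun j hj => h j (Finset.mem_insert_of_mem hj)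
    have h3 : (fun z => f i z) =O[l] fun _ => (1 : ℝ) := by
      have h4 := (h1.trans hg).add (isBigO_const_const (c i) (one_ne_zero (α := ℝ)) l)
      simpa using h4
    have h5 := (h3.mul h2).add (h1.const_mul_left (∏ j ∈ s, c j) |>.congr_right fun z =>
      (one_mul (g z)).symm)
    simp only [one_mul] at h5
    refine h5.congr_left fun z => ?_
    rw [Finset.prod_insert hi, Finset.prod_insert hi]
    ring

theorem exists_numbering_of_monic {ι : Type*} [Fintype ι] {q : ℂ[X]} (hq : q.Monic)
    (h : q.natDegree = Fintype.card ι) : ∃ r : ι → ℂ, ∀ t, q.eval t = ∏ i, (t - r i) := by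
  have hlen : Fintype.card ι = q.roots.toList.length := by
    rw [Multiset.length_toList, ← h, (IsAlgClosed.splits q).natDegree_eq_card_roots]
  let e : ι ≃ Fin q.roots.toList.length := Fintype.equivFinOfCardEq hlen
  refine ⟨fun i => q.roots.toList.get (e i), fun t => ?_⟩
  rw [e.prod_comp fun k => t - q.roots.toList.get k, ← List.prod_ofFn]
  change _ = (List.ofFn ((fun a => t - a) ∘ q.roots.toList.get)).prod
  rw [← List.map_ofFn, List.ofFn_get]
  conv_lhs => rw [(IsAlgClosed.splits q).eq_prod_roots, hq.leadingCoeff, C_1, one_mul,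
    eval_multiset_prod, Multiset.map_map]
  rw [← Multiset.prod_coe, ← Multiset.map_coe, Multiset.coe_toList]
  simp

/-- An eigenvalue is bounded by the sum of the norms of the entries of the matrix. -/
theorem norm_le_of_det_eq_zero {n : Type*} [Fintype n] [DecidableEq n] {N : Matrix n n ℂ} {t : ℂ}
    (h : (Matrix.scalar n t - N).det = 0) : ‖t‖ ≤ ∑ i, ∑ j, ‖N i j‖ := by
  obtain ⟨v, hv0, hv⟩ := Matrix.exists_mulVec_eq_zero_iff.mpr h
  rw [Matrix.sub_mulVec, sub_eq_zero, Matrix.scalar_apply, ← Matrix.smul_one_eq_diagonal,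
    Matrix.smul_mulVec, Matrix.one_mulVec] at hv
  obtain ⟨i₀, hi₀⟩ := Function.ne_iff.mp hv0
  obtain ⟨i, -, hi⟩ := Finset.exists_max_image Finset.univ (fun i => ‖v i‖) ⟨i₀, Finset.mem_univ _⟩
  have hvi : 0 < ‖v i‖ := (norm_pos_iff.mpr hi₀).trans_le (hi i₀ (Finset.mem_univ _))
  have h1 : t * v i = ∑ j, N i j * v j := congrFun hv i
  have h2 : ‖t‖ * ‖v i‖ ≤ (∑ j, ‖N i j‖) * ‖v i‖ := by
    rw [← norm_mul, h1, Finset.sum_mul]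
    refine norm_sum_le_of_le _ fun j _ => ?_
    rw [norm_mul]
    exact mul_le_mul_of_nonneg_left (hi j (Finset.mem_univ _)) (norm_nonneg _)
  refine (le_of_mul_le_mul_right h2 hvi).trans ?_
  exact Finset.single_le_sum (f := fun i => ∑ j, ‖N i j‖) (fun _ _ => by positivity)
    (Finset.mem_univ i)

theorem eventually_ne_zero_cobounded : ∀ᶠ z in Bornology.cobounded ℂ, z ≠ 0 :=
  eventually_one_le_norm.mono fun z hz => norm_pos_iff.mp (by linarith)

theorem tendsto_inv_pow_cobounded (n : ℕ) :
    Tendsto (fun z : ℂ => (z ^ (n + 1))⁻¹) (Bornology.cobounded ℂ) (𝓝 0) := by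
  have h : Tendsto (fun z : ℂ => z⁻¹) (Bornology.cobounded ℂ) (𝓝 0) := tendsto_inv₀_cobounded
  simpa using h.pow (n + 1)

/-! ### The monodromy matrix near infinity -/

namespace PeriodicJacobi

variable {m p : ℕ} (J : PeriodicJacobi m p)

/-- The leading term of a solution is produced by the summand `z • 1` of the recursion. -/
theorem tendsto_matSol (Y0 Y1 : Matrix (Fin m) (Fin m) ℂ) (n : ℕ) :
    Tendsto (fun z => (z ^ n)⁻¹ • J.matSol z Y0 Y1 (n + 1)) (Bornology.cobounded ℂ)
      (𝓝 ((((List.range n).map fun k : ℕ => J.aC ((k : ℤ) + 1)).prod)⁻¹ * Y1)) ∧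
    Tendsto (fun z => (z ^ (n + 1))⁻¹ • J.matSol z Y0 Y1 n) (Bornology.cobounded ℂ) (𝓝 0) := by
  induction n with
  | zero =>
    constructor
    · simp [matSol]
    · have := (tendsto_inv_pow_cobounded 0).smul_const Y0
      rwa [zero_smul] at this
  | succ n ih =>
    obtain ⟨ih1, ih2⟩ := ih
    constructor
    · rw [List.range_succ, List.map_append, List.prod_append, List.map_singleton,
        List.prod_singleton, Matrix.mul_inv_rev, mul_assoc]
      have hb : Tendsto (fun z : ℂ => 1 - (z ^ (0 + 1))⁻¹ • J.bC (n + 1))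
          (Bornology.cobounded ℂ) (𝓝 1) := by
        have := ((tendsto_inv_pow_cobounded 0).smul_const (J.bC (n + 1))).const_sub 1
        rwa [zero_smul, sub_zero] at this
      have h1 := ((hb.mul ih1).sub (ih2.const_mul (J.aC n).transpose)).const_mul
        (J.aC (n + 1))⁻¹
      rw [one_mul, mul_zero, sub_zero] at h1
      refine h1.congr' ?_
      filter_upwards [eventually_ne_zero_cobounded] with z hz
      have h2 : (z ^ (n + 1))⁻¹ * z = (z ^ n)⁻¹ := by
        rw [pow_succ]
        field_simp
      have h3 : (z ^ n)⁻¹ * z⁻¹ = (z ^ (n + 1))⁻¹ := by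
        rw [pow_succ, mul_inv]
      rw [matSol]
      simp only [mul_sub, sub_mul, smul_sub, Matrix.mul_smul, Matrix.smul_mul, smul_smul, one_mul,
        h2, h3, zero_add, pow_one]
    · have h1 := (tendsto_inv_pow_cobounded 1).smul ih1
      rw [zero_smul] at h1
      refine h1.congr fun z => ?_
      rw [smul_smul, ← mul_inv_rev, ← pow_add, add_assoc]

theorem tendsto_monodromy : Tendsto (fun z => (z ^ p)⁻¹ • J.monodromy z) (Bornology.cobounded ℂ)
    (𝓝 (Matrix.fromBlocks 0 0 0 J.A)) := by
  have hlow : ∀ Y0 Y1, Tendsto (fun z => (z ^ p)⁻¹ • J.matSol z Y0 Y1 p) (Bornology.cobounded ℂ)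
      (𝓝 0) := by
    intro Y0 Y1
    obtain ⟨k, rfl⟩ : ∃ k, p = k + 1 := ⟨p - 1, by have := J.p_pos; omega⟩
    have h1 := (tendsto_inv_pow_cobounded 0).smul (J.tendsto_matSol Y0 Y1 k).1
    rw [zero_smul] at h1
    refine h1.congr fun z => ?_
    rw [smul_smul, ← mul_inv_rev, ← pow_add, zero_add]
  have hθ := (J.tendsto_matSol 1 0 p).1
  have hφ := (J.tendsto_matSol 0 1 p).1
  rw [mul_zero] at hθ
  rw [mul_one] at hφ
  have hent : ∀ {f : ℂ → Matrix (Fin m) (Fin m) ℂ} {L : Matrix (Fin m) (Fin m) ℂ},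
      Tendsto f (Bornology.cobounded ℂ) (𝓝 L) → ∀ i j,
      Tendsto (fun z => f z i j) (Bornology.cobounded ℂ) (𝓝 (L i j)) := fun h i j =>
    tendsto_pi_nhds.mp (tendsto_pi_nhds.mp h i) j
  simp only [monodromy, Matrix.fromBlocks_smul]
  refine tendsto_pi_nhds.mpr fun i => tendsto_pi_nhds.mpr fun j => ?_
  rcases i with i | i <;> rcases j with j | j
  · exact hent (hlow 1 0) i j
  · exact hent (hlow 0 1) i j
  · exact hent hθ i j
  · exact hent hφ i j

/-- A root `(t + t⁻¹) / 2` with `1 ≤ ‖t‖` is bounded by the eigenvalue `t` of the monodromy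
matrix, whose entries are `O (z ^ p)`. -/
theorem exists_eventually_root_bound : ∃ K : ℝ, ∀ᶠ z in Bornology.cobounded ℂ, ∀ ν,
    J.lyapunovPoly.evalEval z ν = 0 → ‖ν‖ ≤ K * ‖z‖ ^ p := by
  let f : Matrix (Fin m ⊕ Fin m) (Fin m ⊕ Fin m) ℂ → ℝ := fun N => ∑ i, ∑ j, ‖N i j‖
  have hf : Continuous f := by
    refine continuous_finsetSum _ fun i _ => continuous_finsetSum _ fun j _ => ?_
    exact (continuous_apply_apply i j).norm
  have hlim := (hf.tendsto _).comp J.tendsto_monodromy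
  refine ⟨f (Matrix.fromBlocks 0 0 0 J.A) + 1, ?_⟩
  filter_upwards [hlim.eventually_lt_const (lt_add_one _), eventually_ne_zero_cobounded]
    with z hz hz0 ν hν
  obtain ⟨t, ht, rfl⟩ := exists_add_inv_div_two_eq ν
  have ht0 : t ≠ 0 := norm_pos_iff.mp (one_pos.trans_le ht)
  have hdet : (Matrix.scalar _ t - J.monodromy z).det = 0 := by
    rw [← Matrix.eval_charpoly, ← charpoly_M, J.eval_charpoly_M _ ht0, hν, mul_zero]
  have h1 := norm_le_of_det_eq_zero hdet
  have h2 : f (J.monodromy z) = ‖z‖ ^ p * f ((z ^ p)⁻¹ • J.monodromy z) := by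
    simp only [f, Matrix.smul_apply, smul_eq_mul, norm_mul, norm_inv, norm_pow, ← Finset.mul_sum]
    rw [mul_inv_cancel_left₀ (pow_ne_zero _ (norm_ne_zero_iff.mpr hz0))]
  have h3 : ‖(t + t⁻¹) / 2‖ ≤ ‖t‖ := by
    have h4 : ‖t⁻¹‖ ≤ 1 := by
      rw [norm_inv]
      exact inv_le_one_of_one_le₀ ht
    rw [norm_div, Complex.norm_ofNat, div_le_iff₀ two_pos]
    linarith [norm_add_le t t⁻¹]
  calc _ ≤ ‖t‖ := h3
    _ ≤ f (J.monodromy z) := h1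
    _ ≤ ‖z‖ ^ p * (f (Matrix.fromBlocks 0 0 0 J.A) + 1) := by
      rw [h2]
      exact mul_le_mul_of_nonneg_left hz.le (by positivity)
    _ = _ := mul_comm _ _

/-- The argument is `(s + s⁻¹) / 2` for `s = z ^ p * t`, where the values of the Lyapunov polynomial
are given by the monodromy matrix. -/
theorem tendsto_lyapunovPoly_scaled {t : ℂ} (ht : t ≠ 0) :
    Tendsto (fun z => (2 / z ^ p) ^ m *
        J.lyapunovPoly.evalEval z (z ^ p * (t + (z ^ p * z ^ p * t)⁻¹) / 2))
      (Bornology.cobounded ℂ) (𝓝 (J.A.charpoly.eval t)) := by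
  have hdet : Tendsto (fun z => (t ^ m)⁻¹ *
      (Matrix.scalar _ t - (z ^ p)⁻¹ • J.monodromy z).det) (Bornology.cobounded ℂ)
      (𝓝 ((t ^ m)⁻¹ * (Matrix.scalar _ t - Matrix.fromBlocks 0 0 0 J.A).det)) :=
    (((continuous_const.sub continuous_id).matrix_det.tendsto _).comp
      J.tendsto_monodromy).const_mul _
  have hblock : (Matrix.scalar (Fin m ⊕ Fin m) t - Matrix.fromBlocks 0 0 0 J.A).det
      = t ^ m * J.A.charpoly.eval t := by
    have h1 : Matrix.scalar (Fin m ⊕ Fin m) t - Matrix.fromBlocks 0 0 0 J.A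
        = Matrix.fromBlocks (Matrix.scalar (Fin m) t) 0 0 (Matrix.scalar (Fin m) t - J.A) := by
      ext (i | i) (j | j) <;> simp [Matrix.scalar_apply, Matrix.diagonal_apply]
    rw [h1, Matrix.det_fromBlocks_zero₁₂, Matrix.eval_charpoly]
    congr 1
    simp
  rw [hblock, inv_mul_cancel_left₀ (pow_ne_zero _ ht)] at hdet
  refine hdet.congr' ?_
  filter_upwards [eventually_ne_zero_cobounded] with z hz
  have hzp : z ^ p ≠ 0 := pow_ne_zero _ hz
  have h1 : Matrix.scalar (Fin m ⊕ Fin m) t - (z ^ p)⁻¹ • J.monodromy z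
      = (z ^ p)⁻¹ • (Matrix.scalar _ (z ^ p * t) - J.monodromy z) := by
    rw [smul_sub, Matrix.scalar_apply, Matrix.scalar_apply, ← Matrix.smul_one_eq_diagonal,
      ← Matrix.smul_one_eq_diagonal, smul_smul, inv_mul_cancel_left₀ hzp]
  have h2 : z ^ p * (t + (z ^ p * z ^ p * t)⁻¹) = z ^ p * t + (z ^ p * t)⁻¹ := by
    field_simp
  rw [h1, Matrix.det_smul, ← Matrix.eval_charpoly, ← charpoly_M,
    J.eval_charpoly_M _ (mul_ne_zero hzp ht), Fintype.card_sum, Fintype.card_fin, h2, inv_pow,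
    div_pow, mul_pow, mul_pow, pow_add]
  field_simp

end PeriodicJacobi

/-! ### Numbering the Lyapunov functions -/

theorem scaled_prod {ι : Type*} [Fintype ι] {a : ℂ} (ha : a ≠ 0) (t : ℂ) (μ : ι → ℂ) :
    (2 / a) ^ Fintype.card ι * ∏ i, (a * t / 2 - μ i) = ∏ i, (t - μ i / (a / 2)) := by
  rw [← Finset.card_univ, ← Finset.prod_const, ← Finset.prod_mul_distrib]
  refine Finset.prod_congr rfl fun i _ => ?_
  field_simp

theorem prod_fiber_eq {m k : ℕ} {n : Fin k → ℕ} (e : (Σ s, Fin (n s)) ≃ Fin m) (s : Fin k)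
    (f : Fin m → ℂ) :
    ∏ j ∈ Finset.univ.filter (fun j => (e.symm j).1 = s), f j = ∏ i, f (e ⟨s, i⟩) := by
  rw [Finset.prod_filter, ← e.prod_comp, Fintype.prod_sigma, Finset.prod_eq_single s]
  · simp
  · intro s' _ hs'
    simp [hs']
  · simp

theorem card_fiber_eq {m k : ℕ} {n : Fin k → ℕ} (e : (Σ s, Fin (n s)) ≃ Fin m) (s : Fin k) :
    (Finset.univ.filter (fun j => (e.symm j).1 = s)).card = n s := by
  rw [Finset.card_filter, ← e.sum_comp, Fintype.sum_sigma, Finset.sum_eq_single s]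
  · simp
  · intro s' _ hs'
    simp [hs']
  · simp

/-- The roots of `Φ (z, ·)`, divided by `z ^ p / 2`, can be numbered so that they approach the
roots of the limit polynomial. -/
theorem exists_root_numbering {ι : Type*} [Fintype ι] {Φ : ℂ[X][Y]} (hΦ : Φ.Monic)
    (hcard : Φ.natDegree = Fintype.card ι) {p : ℕ} {K : ℝ}
    (hK : ∀ᶠ z in Bornology.cobounded ℂ, ∀ ν, Φ.evalEval z ν = 0 → ‖ν‖ ≤ K * ‖z‖ ^ p)
    {q : ℂ[X]} {r : ι → ℂ} (hr : ∀ t, q.eval t = ∏ i, (t - r i))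
    (hq : ∀ B : ℝ, ∃ K' : ℝ, ∀ᶠ z in Bornology.cobounded ℂ, ∀ t, ‖t‖ ≤ B →
      ‖(2 / z ^ p) ^ Φ.natDegree * Φ.evalEval z (z ^ p * t / 2) - q.eval t‖ ≤ K' * ‖z‖⁻¹) :
    ∃ μ : ι → ℂ → ℂ, (∀ z ν, Φ.evalEval z ν = ∏ i, (ν - μ i z)) ∧ ∃ K' : ℝ,
      ∀ᶠ z in Bornology.cobounded ℂ, ∀ i, ‖μ i z / (z ^ p / 2) - r i‖ < 1 ∧
        ‖μ i z / (z ^ p / 2) - r i‖ ^ Fintype.card ι ≤ K' * ‖z‖⁻¹ := by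
  have hnum : ∀ z, ∃ μ : ι → ℂ, ∀ ν, Φ.evalEval z ν = ∏ i, (ν - μ i) := fun z => by
    obtain ⟨μ, hμ⟩ := exists_numbering_of_monic (ι := ι) (hΦ.map (evalRingHom z))
      (by rw [hΦ.natDegree_map, hcard])
    exact ⟨μ, fun ν => by rw [← hμ, map_evalRingHom_eval]⟩
  let G : ℂ → ℂ → ℂ := fun z t => (2 / z ^ p) ^ Φ.natDegree * Φ.evalEval z (z ^ p * t / 2)
  have hG : ∀ᶠ z in Bornology.cobounded ℂ, ∃ μ : ι → ℂ, ∀ t, G z t = ∏ i, (t - μ i) := by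
    filter_upwards [eventually_ne_zero_cobounded] with z hz
    obtain ⟨μ, hμ⟩ := hnum z
    refine ⟨fun i => μ i / (z ^ p / 2), fun t => ?_⟩
    simp only [G]
    rw [hμ, hcard, scaled_prod (pow_ne_zero _ hz)]
  have hB : ∀ᶠ z in Bornology.cobounded ℂ, ∀ t, G z t = 0 → ‖t‖ ≤ 2 * K := by
    filter_upwards [eventually_ne_zero_cobounded, hK] with z hz hzK t ht
    have h1 := (mul_eq_zero.mp ht).resolve_left
      (pow_ne_zero _ (div_ne_zero two_ne_zero (pow_ne_zero _ hz)))
    have h2 := hzK _ h1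
    rw [norm_div, norm_mul, norm_pow, Complex.norm_ofNat, div_le_iff₀ two_pos] at h2
    have h3 : 0 < ‖z‖ ^ p := pow_pos (norm_pos_iff.mpr hz) p
    refine le_of_mul_le_mul_left (a := ‖z‖ ^ p) ?_ h3
    linarith
  have hlim : ∀ t, Tendsto (fun z => G z t) (Bornology.cobounded ℂ) (𝓝 (∏ i, (t - r i))) := by
    intro t
    obtain ⟨K', hK'⟩ := hq ‖t‖
    rw [← hr, tendsto_iff_norm_sub_tendsto_zero]
    have h1 := tendsto_norm_inv_cobounded.const_mul K'
    rw [mul_zero] at h1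
    exact squeeze_zero' (Eventually.of_forall fun _ => norm_nonneg _)
      (hK'.mono fun z hz => hz t le_rfl) h1
  obtain ⟨K', hK'⟩ := hq (2 * K)
  have hgood := eventually_exists_numbering_pow_le (η := fun z => K' * ‖z‖⁻¹) hG hB hlim
    (hK'.mono fun z hz t ht => by rw [← hr]; exact hz t ht)
  have hall : ∀ z, ∃ μ : ι → ℂ, (∀ ν, Φ.evalEval z ν = ∏ i, (ν - μ i)) ∧
      ((z ≠ 0 ∧ ∃ μ : ι → ℂ, (∀ t, G z t = ∏ i, (t - μ i)) ∧
        ∀ i, ‖μ i - r i‖ < 1 ∧ ‖μ i - r i‖ ^ Fintype.card ι ≤ K' * ‖z‖⁻¹) →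
        ∀ i, ‖μ i / (z ^ p / 2) - r i‖ < 1 ∧
          ‖μ i / (z ^ p / 2) - r i‖ ^ Fintype.card ι ≤ K' * ‖z‖⁻¹) := by
    intro z
    by_cases h : z ≠ 0 ∧ ∃ μ : ι → ℂ, (∀ t, G z t = ∏ i, (t - μ i)) ∧
        ∀ i, ‖μ i - r i‖ < 1 ∧ ‖μ i - r i‖ ^ Fintype.card ι ≤ K' * ‖z‖⁻¹
    · obtain ⟨hz, μ, hμ, hμr⟩ := h
      have hzp : z ^ p ≠ 0 := pow_ne_zero _ hz
      have h1 : ∀ i, z ^ p * μ i / 2 / (z ^ p / 2) = μ i := fun i => by field_simp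
      refine ⟨fun i => z ^ p * μ i / 2, fun ν => ?_, fun _ i => by rw [h1]; exact hμr i⟩
      have h2 := hμ (ν / (z ^ p / 2))
      have h3 : z ^ p * (ν / (z ^ p / 2)) / 2 = ν := by field_simp
      have h4 := scaled_prod hzp (ν / (z ^ p / 2)) fun i => z ^ p * μ i / 2
      simp only [h1, h3, G] at h2 h4
      rw [← h4, hcard] at h2
      exact mul_left_cancel₀ (pow_ne_zero _ (div_ne_zero two_ne_zero hzp)) h2
    · obtain ⟨μ, hμ⟩ := hnum z
      exact ⟨μ, hμ, fun h' => absurd h' h⟩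
  choose μ hμ hμr using hall
  refine ⟨fun i z => μ z i, hμ, K', ?_⟩
  filter_upwards [hgood, eventually_ne_zero_cobounded] with z hz hz0
  exact hμr z ⟨hz0, hz⟩

theorem isBigO_rpow_of_pow_le {m : ℕ} (hm : 1 ≤ m) {f : ℂ → ℂ} {K : ℝ}
    (h : ∀ᶠ z in Bornology.cobounded ℂ, ‖f z‖ ^ m ≤ K * ‖z‖⁻¹) :
    f =O[Bornology.cobounded ℂ] fun z => ‖z‖ ^ (-(1 / (m : ℝ))) := by
  have hm0 : (0 : ℝ) < m := by exact_mod_cast hm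
  refine IsBigO.of_bound (|K| ^ (1 / (m : ℝ))) ?_
  filter_upwards [h, eventually_one_le_norm] with z hz hz1
  have hz0 : 0 < ‖z‖ := by linarith
  have h1 : ‖f z‖ ^ m ≤ |K| * ‖z‖⁻¹ :=
    hz.trans (mul_le_mul_of_nonneg_right (le_abs_self K) (by positivity))
  have h2 := Real.rpow_le_rpow (by positivity) h1 (show 0 ≤ 1 / (m : ℝ) by positivity)
  rw [Real.mul_rpow (abs_nonneg _) (by positivity), ← Real.rpow_natCast, ← Real.rpow_mul
    (norm_nonneg _), mul_one_div_cancel hm0.ne', Real.rpow_one, Real.inv_rpow hz0.le,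
    ← Real.rpow_neg hz0.le] at h2
  rwa [Real.norm_of_nonneg (Real.rpow_nonneg hz0.le _)]

namespace PeriodicJacobi

variable {m p : ℕ} (J : PeriodicJacobi m p)

/-- The factorization of the Lyapunov polynomial, with a numbering of its roots that is compatible
with the factors and with the eigenvalues of `J.A`. -/
theorem exists_lyapunov_numbering {τ₀ : Fin m → ℂ}
    (hτ₀ : J.A.charpoly = ∏ j, (X - C (τ₀ j))) :
    ∃ (k : ℕ) (Φ : Fin k → ℂ[X][Y]) (c : Fin m → Fin k) (Δ : Fin m → ℂ → ℂ),
      (∀ s, (Φ s).Monic) ∧ (∀ s, Irreducible (Φ s)) ∧ ∏ s, Φ s = J.lyapunovPoly ∧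
      (∀ s, (Φ s).natDegree = (Finset.univ.filter fun j => c j = s).card) ∧
      (∀ s z ν, (Φ s).evalEval z ν = ∏ j ∈ Finset.univ.filter (fun j => c j = s), (ν - Δ j z)) ∧
      ∀ j, (fun z => Δ j z / (z ^ p / 2) - τ₀ j)
        =O[Bornology.cobounded ℂ] fun z => ‖z‖ ^ (-(1 / (m : ℝ))) := by
  classical
  obtain ⟨k, Φ, hm, hirr, hprod⟩ :=
    exists_monic_irreducible_factors J.lyapunovPoly_monic_natDegree.1
  obtain ⟨K, hK⟩ := J.exists_eventually_root_bound
  have hKs : ∀ s, ∀ᶠ z in Bornology.cobounded ℂ, ∀ ν, (Φ s).evalEval z ν = 0 →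
      ‖ν‖ ≤ K * ‖z‖ ^ p := fun s => hK.mono fun z hz ν hν => hz ν (by
    rw [← hprod, evalEval_prod]
    exact Finset.prod_eq_zero (Finset.mem_univ s) hν)
  choose q hqm hqd hq using fun s => exists_limit_scaled (hm s) (hKs s)
  choose r hr using fun s => exists_numbering_of_monic (ι := Fin (Φ s).natDegree) (hqm s)
    (by rw [hqd, Fintype.card_fin])
  have hdeg : ∑ s, (Φ s).natDegree = m := by
    rw [← natDegree_prod_of_monic _ _ fun s _ => hm s, hprod,
      J.lyapunovPoly_monic_natDegree.2]
  -- the limits of the factors multiply to the characteristic polynomial of `J.A`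
  have hlim : ∀ t : ℂ, t ≠ 0 → ∏ s, (q s).eval t = J.A.charpoly.eval t := by
    intro t ht
    refine tendsto_nhds_unique ?_ (J.tendsto_lyapunovPoly_scaled ht)
    let u : ℂ → ℂ := fun z => t + (z ^ p * z ^ p * t)⁻¹
    have hu : Tendsto u (Bornology.cobounded ℂ) (𝓝 t) := by
      obtain ⟨k, hk⟩ : ∃ k, p + p = k + 1 := ⟨p + p - 1, by have := J.p_pos; omega⟩
      have h1 := ((tendsto_inv_pow_cobounded k).mul_const t⁻¹).const_add t
      rw [zero_mul, add_zero] at h1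
      refine h1.congr fun z => ?_
      simp only [u]
      rw [mul_inv (z ^ p * z ^ p), ← pow_add, hk]
    have hub : ∀ᶠ z in Bornology.cobounded ℂ, ‖u z‖ ≤ ‖t‖ + 1 :=
      (hu.norm.eventually_lt_const (lt_add_one _)).mono fun _ h => h.le
    have hs : ∀ s, Tendsto (fun z => (2 / z ^ p) ^ (Φ s).natDegree *
        (Φ s).evalEval z (z ^ p * u z / 2)) (Bornology.cobounded ℂ) (𝓝 ((q s).eval t)) := by
      intro s
      obtain ⟨K', hK'⟩ := hq s (‖t‖ + 1)
      have h1 := tendsto_norm_inv_cobounded.const_mul K'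
      rw [mul_zero] at h1
      have h2 : Tendsto (fun z => (2 / z ^ p) ^ (Φ s).natDegree *
          (Φ s).evalEval z (z ^ p * u z / 2) - (q s).eval (u z)) (Bornology.cobounded ℂ) (𝓝 0) :=
        squeeze_zero_norm' ((hK'.and hub).mono fun z hz => hz.1 _ hz.2) h1
      have h3 := h2.add (((q s).continuous.tendsto t).comp hu)
      rw [zero_add] at h3
      refine h3.congr fun z => ?_
      simp
    refine (tendsto_finsetProd Finset.univ fun s _ => hs s).congr fun z => ?_
    rw [Finset.prod_mul_distrib, Finset.prod_pow_eq_pow_sum, hdeg, ← evalEval_prod, hprod]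
  obtain ⟨e, he⟩ := exists_equiv_of_prod_eq (fun x : Σ s, Fin (Φ s).natDegree => r x.1 x.2) τ₀
    ((Set.finite_singleton (0 : ℂ)).infinite_compl.mono fun t ht => by
      have h1 := hlim t ht
      rw [hτ₀, eval_prod] at h1
      simp only [eval_sub, eval_X, eval_C] at h1
      rw [Set.mem_ofPred_eq, ← h1, Fintype.prod_sigma]
      exact Finset.prod_congr rfl fun s _ => (hr s t).symm)
  let c : Fin m → Fin k := fun j => (e.symm j).1
  have hmem : ∀ s j, j ∈ Finset.univ.filter (fun j => c j = s) ↔ c j = s := by simp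
  have hcard : ∀ s, (Φ s).natDegree = Fintype.card {j // c j = s} := fun s => by
    rw [Fintype.card_subtype, card_fiber_eq e]
  have hr' : ∀ s t, (q s).eval t = ∏ j : {j // c j = s}, (t - τ₀ j) := fun s t => by
    rw [hr, ← Finset.prod_subtype _ (hmem s) fun j => t - τ₀ j, prod_fiber_eq e]
    exact Finset.prod_congr rfl fun i _ => by rw [he ⟨s, i⟩]
  choose μ hμ K' hK' using fun s =>
    exists_root_numbering (hm s) (hcard s) (hKs s) (hr' s) (hq s)
  have hcongr : ∀ s (j : {j // c j = s}) z, μ (c j) ⟨j, rfl⟩ z = μ s j z := by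
    rintro _ ⟨j, rfl⟩ z
    rfl
  refine ⟨k, Φ, c, fun j => μ (c j) ⟨j, rfl⟩, hm, hirr, hprod,
    fun s => (card_fiber_eq e s).symm, fun s z ν => ?_, fun j => ?_⟩
  · rw [hμ, Finset.prod_subtype _ (hmem s) fun j => ν - μ (c j) ⟨j, rfl⟩ z]
    exact Finset.prod_congr rfl fun j _ => by rw [hcongr]
  · refine isBigO_rpow_of_pow_le J.m_pos (K := K' (c j)) ((hK' (c j)).mono fun z hz => ?_)
    obtain ⟨h1, h2⟩ := hz ⟨j, rfl⟩
    refine (pow_le_pow_of_le_one (norm_nonneg _) h1.le ?_).trans h2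
    rw [Fintype.card_subtype]
    exact (Finset.card_le_univ _).trans_eq (Fintype.card_fin m)

end PeriodicJacobi

/-! ### Asymptotics of the multipliers and of the discriminants -/

theorem isBigO_norm_inv_pow {m p : ℕ} (hm : 1 ≤ m) (hp : 1 ≤ p) {f : ℂ → ℂ}
    (hf : ∀ z, ‖f z‖ ≤ 1) :
    (fun z => f z / z ^ p) =O[Bornology.cobounded ℂ] fun z => ‖z‖ ^ (-(1 / (m : ℝ))) := by
  refine IsBigO.of_bound 1 ?_
  filter_upwards [eventually_one_le_norm] with z hz
  have hz0 : 0 < ‖z‖ := one_pos.trans_le hz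
  have hm1 : (1 : ℝ) ≤ m := by exact_mod_cast hm
  have h1 : ‖z‖ ^ (1 / (m : ℝ)) ≤ ‖z‖ ^ p := by
    calc ‖z‖ ^ (1 / (m : ℝ)) ≤ ‖z‖ ^ (1 : ℝ) :=
          Real.rpow_le_rpow_of_exponent_le hz ((div_le_one (by linarith)).mpr hm1)
      _ = ‖z‖ ^ 1 := by rw [Real.rpow_one, pow_one]
      _ ≤ ‖z‖ ^ p := pow_le_pow_right₀ hz hp
  rw [one_mul, Real.norm_of_nonneg (by positivity), Real.rpow_neg hz0.le, norm_div, norm_pow,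
    div_eq_mul_inv]
  calc ‖f z‖ * (‖z‖ ^ p)⁻¹ ≤ 1 * (‖z‖ ^ p)⁻¹ :=
        mul_le_mul_of_nonneg_right (hf z) (by positivity)
    _ ≤ (‖z‖ ^ (1 / (m : ℝ)))⁻¹ := by
      rw [one_mul]
      exact inv_anti₀ (by positivity) h1

/-- The multiplier of modulus at least `1` has the asymptotics of twice the Lyapunov function. -/
theorem isBigO_multiplier {m p : ℕ} (hm : 1 ≤ m) (hp : 1 ≤ p) {τ Δ : ℂ → ℂ} {c : ℂ}
    (hτ : ∀ z, 1 ≤ ‖τ z‖) (hΔ : ∀ z, Δ z = (τ z + (τ z)⁻¹) / 2)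
    (h : (fun z => Δ z / (z ^ p / 2) - c) =O[Bornology.cobounded ℂ]
      fun z => ‖z‖ ^ (-(1 / (m : ℝ)))) :
    (fun z => τ z / z ^ p - c) =O[Bornology.cobounded ℂ] fun z => ‖z‖ ^ (-(1 / (m : ℝ))) := by
  have h1 : (fun z => (τ z)⁻¹ / z ^ p) =O[Bornology.cobounded ℂ]
      fun z => ‖z‖ ^ (-(1 / (m : ℝ))) := by
    refine isBigO_norm_inv_pow hm hp fun z => ?_
    rw [norm_inv]
    exact inv_le_one_of_one_le₀ (hτ z)
  refine (h.sub h1).congr' ?_ EventuallyEq.rfl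
  filter_upwards [eventually_ne_zero_cobounded] with z hz
  have hzp : z ^ p ≠ 0 := pow_ne_zero _ hz
  have hτ0 : τ z ≠ 0 := norm_pos_iff.mp (one_pos.trans_le (hτ z))
  rw [hΔ]
  field_simp
  ring

theorem isBigO_rpow_one {m : ℕ} :
    (fun z : ℂ => ‖z‖ ^ (-(1 / (m : ℝ)))) =O[Bornology.cobounded ℂ] fun _ => (1 : ℝ) := by
  refine IsBigO.of_bound 1 ?_
  filter_upwards [eventually_one_le_norm] with z hz
  rw [Real.norm_of_nonneg (by positivity), norm_one, mul_one]
  exact Real.rpow_le_one_of_one_le_of_nonpos hz (by rw [neg_nonpos]; positivity)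

theorem tendsto_rpow_cobounded {m : ℕ} (hm : 1 ≤ m) :
    Tendsto (fun z : ℂ => ‖z‖ ^ (-(1 / (m : ℝ)))) (Bornology.cobounded ℂ) (𝓝 0) := by
  have hm0 : (0 : ℝ) < m := by exact_mod_cast hm
  exact (tendsto_rpow_neg_atTop (by positivity)).comp tendsto_norm_cobounded_atTop

theorem two_mul_card_filter_lt {m : ℕ} (w : Finset (Fin m)) :
    2 * ((w ×ˢ w).filter (fun q => q.1 < q.2)).card = w.card * (w.card - 1) := by
  have h1 : ((w ×ˢ w).filter (fun q => q.2 < q.1)).card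
      = ((w ×ˢ w).filter (fun q => q.1 < q.2)).card := by
    refine Finset.card_nbij' Prod.swap Prod.swap ?_ ?_ ?_ ?_ <;>
      intro q hq <;> simp_all
  have h2 : w.offDiag = (w ×ˢ w).filter (fun q => q.1 < q.2) ∪
      (w ×ˢ w).filter (fun q => q.2 < q.1) := by
    ext q
    simp only [Finset.mem_offDiag, Finset.mem_union, Finset.mem_filter, Finset.mem_product]
    have := @ne_iff_lt_or_gt _ _ q.1 q.2
    tauto
  have h3 := congrArg Finset.card h2
  rw [Finset.offDiag_card, Finset.card_union_of_disjoint, h1] at h3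
  · rw [two_mul, ← h3, Nat.mul_sub, mul_one]
  · rw [Finset.disjoint_filter]
    exact fun q _ h h' => lt_asymm h h'

theorem discrProd_div_pow {m : ℕ} (Δ : Fin m → ℂ → ℂ) (w : Finset (Fin m)) {z : ℂ} (hz : z ≠ 0)
    (p : ℕ) :
    discrProd Δ w z / z ^ (p * (w.card * (w.card - 1))) =
      ∏ q ∈ (w ×ˢ w).filter (fun q => q.1 < q.2),
        ((Δ q.1 z / (z ^ p / 2) - Δ q.2 z / (z ^ p / 2)) / 2) ^ 2 := by
  have hzp : z ^ p ≠ 0 := pow_ne_zero _ hz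
  rw [← two_mul_card_filter_lt, pow_mul, pow_mul, ← Finset.prod_const, discrProd,
    ← Finset.prod_div_distrib]
  refine Finset.prod_congr rfl fun q _ => ?_
  field_simp

theorem isBigO_discrProd {m p : ℕ} {Δ : Fin m → ℂ → ℂ} {w : Finset (Fin m)}
    {τ₀ : Fin m → ℂ} (hΔ : ∀ j, (fun z => Δ j z / (z ^ p / 2) - τ₀ j)
      =O[Bornology.cobounded ℂ] fun z => ‖z‖ ^ (-(1 / (m : ℝ)))) :
    (fun z => discrProd Δ w z / z ^ (p * (w.card * (w.card - 1))) -
        (∏ q ∈ (w ×ˢ w).filter (fun q => q.1 < q.2), (τ₀ q.1 - τ₀ q.2) ^ 2)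
          / 2 ^ (w.card * (w.card - 1)))
      =O[Bornology.cobounded ℂ] fun z => ‖z‖ ^ (-(1 / (m : ℝ))) := by
  have hc : (∏ q ∈ (w ×ˢ w).filter (fun q => q.1 < q.2), (τ₀ q.1 - τ₀ q.2) ^ 2)
      / 2 ^ (w.card * (w.card - 1)) =
      ∏ q ∈ (w ×ˢ w).filter (fun q => q.1 < q.2), ((τ₀ q.1 - τ₀ q.2) / 2) ^ 2 := by
    rw [← two_mul_card_filter_lt, pow_mul, ← Finset.prod_const, ← Finset.prod_div_distrib]
    simp only [div_pow]
  rw [hc]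
  have h1 : ∀ q : Fin m × Fin m,
      (fun z => ((Δ q.1 z / (z ^ p / 2) - Δ q.2 z / (z ^ p / 2)) / 2) ^ 2
        - ((τ₀ q.1 - τ₀ q.2) / 2) ^ 2) =O[Bornology.cobounded ℂ]
        fun z => ‖z‖ ^ (-(1 / (m : ℝ))) := by
    intro q
    have h2 : (fun z => (Δ q.1 z / (z ^ p / 2) - Δ q.2 z / (z ^ p / 2)) / 2
        - (τ₀ q.1 - τ₀ q.2) / 2) =O[Bornology.cobounded ℂ] fun z => ‖z‖ ^ (-(1 / (m : ℝ))) := by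
      refine (((hΔ q.1).sub (hΔ q.2)).const_mul_left (1 / 2)).congr_left fun z => ?_
      ring
    have h3 := isBigO_prod_sub_prod (Finset.range 2) isBigO_rpow_one
      (f := fun _ z => (Δ q.1 z / (z ^ p / 2) - Δ q.2 z / (z ^ p / 2)) / 2)
      (c := fun _ => (τ₀ q.1 - τ₀ q.2) / 2) fun _ _ => h2
    simpa only [Finset.prod_const, Finset.card_range] using h3
  refine (isBigO_prod_sub_prod ((w ×ˢ w).filter (fun q => q.1 < q.2)) isBigO_rpow_one
    fun q _ => h1 q).congr' ?_ EventuallyEq.rfl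
  filter_upwards [eventually_ne_zero_cobounded] with z hz
  rw [discrProd_div_pow Δ w hz]

/-- For a polynomial, any rate of convergence improves to `‖z‖⁻¹`. -/
theorem isBigO_norm_inv_of_polynomial {m N : ℕ} (hm : 1 ≤ m) {q : ℂ[X]} {c : ℂ}
    (h : (fun z => q.eval z / z ^ N - c) =O[Bornology.cobounded ℂ]
      fun z => ‖z‖ ^ (-(1 / (m : ℝ)))) :
    (fun z => q.eval z / z ^ N - c) =O[Bornology.cobounded ℂ] fun z => ‖z‖⁻¹ := by
  have h1 : q.natDegree ≤ N := by
    refine natDegree_le_of_isBigO ?_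
    refine ((h.trans isBigO_rpow_one).add (isBigO_const_const c one_ne_zero _)).congr_left
      fun z => ?_
    ring
  have h2 := isBigO_eval_div_pow_sub h1
  have h3 := h.trans_tendsto (tendsto_rpow_cobounded hm)
  have h4 := h2.trans_tendsto tendsto_norm_inv_cobounded
  have h5 : c = q.coeff N := by
    have h6 := tendsto_nhds_unique (h3.add_const c) (by simpa using h4.add_const (q.coeff N))
    simpa using h6
  rw [h5]
  exact h2

/-! ### The endpoints of the gaps -/

namespace PeriodicJacobi

variable {m p : ℕ} (J : PeriodicJacobi m p)

theorem realOnInterval_lyapunovPoly : RealOnInterval J.lyapunovPoly := fun _ d hd h =>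
  J.im_eq_zero_of_mem_spectrum (J.mem_spectrum_iff.mpr ⟨d, hd, h⟩)

/-- An endpoint of a gap is not an interior point of the spectrum. -/
theorem IsGap.not_eventually_mem_spectrum {J : PeriodicJacobi m p} {α β x : ℝ} (h : J.IsGap α β)
    (hx : x = α ∨ x = β) : ¬ ∀ᶠ y : ℝ in 𝓝 x, (y : ℂ) ∈ spectrum ℂ J.operator := by
  intro hcon
  have hcl : x ∈ closure (Set.Ioo α β) := by
    rw [closure_Ioo h.1.ne]
    rcases hx with rfl | rfl
    · exact Set.left_mem_Icc.mpr h.1.le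
    · exact Set.right_mem_Icc.mpr h.1.le
  obtain ⟨y, hy, hy'⟩ := mem_closure_iff_nhds.mp hcl _ hcon
  exact h.2.2.2 y hy' hy

end PeriodicJacobi

/-! ### The Lyapunov functions on their Riemann surfaces -/

/-- The surfaces are chosen as a function of the polynomial, so that equal factors have equal
surfaces. -/
theorem exists_functionOnCover_family : ∃ S : ℂ[X][Y] → FunctionOnCover,
    ∀ Φ : ℂ[X][Y], Φ.Monic → Irreducible Φ →
      (∀ z, (S Φ).fn '' (S Φ).fiber z = {y | Φ.evalEval z y = 0}) ∧
      (S Φ).HasSheets Φ.natDegree ∧ {z | ¬ Set.InjOn (S Φ).fn ((S Φ).fiber z)}.Finite ∧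
      ∀ z, SimpleRootsAt Φ z → ¬ (S Φ).IsBranchPoint z := by
  obtain ⟨S₀, -⟩ := exists_functionOnCover (monic_X (R := ℂ[X])) irreducible_X
  have : Nonempty FunctionOnCover := ⟨S₀⟩
  choose! S hS using fun (Φ : ℂ[X][Y]) (h : Φ.Monic ∧ Irreducible Φ) =>
    exists_functionOnCover h.1 h.2
  exact ⟨S, fun Φ h h' => hS Φ ⟨h, h'⟩⟩

theorem theorem1p2 {m p : ℕ} (J : PeriodicJacobi m p)
    -- the eigenvalues of `A_p`, listed with algebraic multiplicity
    (τ₀ : Fin m → ℂ) (hτ₀ : J.A.charpoly = ∏ j, (X - C (τ₀ j))) :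
    ∃ (τ Δ : Fin m → ℂ → ℂ) (p₀ : ℕ) (w : Fin p₀ → Finset (Fin m)) (Φ : Fin p₀ → ℂ[X][Y])
      (S : Fin p₀ → FunctionOnCover),
      -- the multipliers and the Lyapunov functions
      (∀ j z, τ j z ≠ 0) ∧
      (∀ z, (J.M z).charpoly = ∏ j, ((X - C (τ j z)) * (X - C (τ j z)⁻¹))) ∧
      (∀ j z, Δ j z = (τ j z + (τ j z)⁻¹) / 2) ∧
      -- i) the partition of the indices, the factorization, the Riemann surfaces
      p₀ ≤ m ∧
      (∀ s, (w s).Nonempty) ∧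
      (∀ s t, s ≠ t → Disjoint (w s) (w t)) ∧
      (∀ j, ∃ s, j ∈ w s) ∧
      (∀ z t : ℂ, t ≠ 0 →
        J.D z t / (2 * t) ^ m = ∏ s, (Φ s).evalEval z ((t + t⁻¹) / 2)) ∧
      (∀ s z ν, (Φ s).evalEval z ν = ∏ j ∈ w s, (ν - Δ j z)) ∧
      (∀ s, (S s).HasSheets (w s).card) ∧
      (∀ s z, (S s).fn '' (S s).fiber z = (fun j => Δ j z) '' (w s : Set (Fin m))) ∧
      (∀ s, {z : ℂ | ¬ Set.InjOn (S s).fn ((S s).fiber z)}.Finite) ∧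
      (∀ k s, ∀ i ∈ w k, ∀ j ∈ w s, {z : ℂ | Δ i z = Δ j z}.Infinite →
        Φ k = Φ s ∧ S k = S s) ∧
      -- ii) monotonicity of real analytic branches
      (∀ (α β : ℝ) (δ : ℝ → ℝ), AnalyticOnNhd ℝ δ (Set.Ioo α β) →
        (∀ x ∈ Set.Ioo α β, ∃ j, (δ x : ℂ) = Δ j x) →
        (∀ x ∈ Set.Ioo α β, -1 < δ x ∧ δ x < 1) →
        ∀ x ∈ Set.Ioo α β, deriv δ x ≠ 0) ∧
      -- iii) the discriminants are polynomials
      (∀ s, ∃ q : ℂ[X], ∀ z, q.eval z = discrProd Δ (w s) z) ∧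
      (∃ q : ℂ[X], ∀ z, q.eval z = ∏ s, discrProd Δ (w s) z) ∧
      -- iv) the endpoints of the gaps
      (∀ α β : ℝ, J.IsGap α β → ∀ x : ℝ, x = α ∨ x = β →
        J.IsPeriodicEigenvalue x ∨ J.IsAntiperiodicEigenvalue x ∨
          ((∃ s, (S s).IsBranchPoint x) ∧ ∏ s, discrProd Δ (w s) (x : ℂ) = 0)) ∧
      -- v) asymptotics at infinity
      (∀ j, (fun z => Δ j z / (z ^ p / 2) - τ₀ j)
        =O[Bornology.cobounded ℂ] fun z => ‖z‖ ^ (-(1 / (m : ℝ)))) ∧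
      (∀ j, (fun z => τ j z / z ^ p - τ₀ j)
        =O[Bornology.cobounded ℂ] fun z => ‖z‖ ^ (-(1 / (m : ℝ)))) ∧
      (∀ s, ∃ c : ℂ,
        c = (∏ q ∈ (w s ×ˢ w s).filter (fun q => q.1 < q.2), (τ₀ q.1 - τ₀ q.2) ^ 2)
          / 2 ^ ((w s).card * ((w s).card - 1)) ∧
        (fun z => discrProd Δ (w s) z / z ^ (p * ((w s).card * ((w s).card - 1))) - c)
          =O[Bornology.cobounded ℂ] (fun z => ‖z‖ ^ (-(1 / (m : ℝ)))) ∧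
        ((∀ j ∈ w s, ∀ k ∈ w s, j ≠ k → τ₀ j ≠ τ₀ k) →
          c ≠ 0 ∧
          (fun z => discrProd Δ (w s) z / z ^ (p * ((w s).card * ((w s).card - 1))) - c)
            =O[Bornology.cobounded ℂ] (fun z => ‖z‖⁻¹))) := by
  obtain ⟨k, Φ, c, Δ, hmonic, hirr, hprod, hdeg, heval, hasym⟩ := J.exists_lyapunov_numbering hτ₀
  obtain ⟨S, hS⟩ := exists_functionOnCover_family
  -- of the two multipliers with the mean `Δ j z`, the one of modulus at least `1` grows like `z ^ p`
  choose τ hτ1 hτ using fun j z => exists_add_inv_div_two_eq (Δ j z)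
  have hτ0 : ∀ j z, τ j z ≠ 0 := fun j z => norm_pos_iff.mp (one_pos.trans_le (hτ1 j z))
  let w : Fin k → Finset (Fin m) := fun s => Finset.univ.filter fun j => c j = s
  have hmem : ∀ j s, j ∈ w s ↔ c j = s := fun j s => by simp [w]
  have hF : ∀ z ν, J.lyapunovPoly.evalEval z ν = ∏ s, (Φ s).evalEval z ν := fun z ν => by
    rw [← hprod, evalEval_prod]
  have hall : ∀ z ν, J.lyapunovPoly.evalEval z ν = ∏ j, (ν - Δ j z) := fun z ν => by
    rw [hF, ← Finset.prod_fiberwise Finset.univ c]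
    exact Finset.prod_congr rfl fun s _ => heval s z ν
  have hroot : ∀ s z ν, (Φ s).evalEval z ν = 0 ↔ ∃ j ∈ w s, Δ j z = ν := fun s z ν => by
    rw [heval, Finset.prod_eq_zero_iff]
    simp only [sub_eq_zero, eq_comm, w]
  have hroot' : ∀ z ν, (∃ j, Δ j z = ν) → J.lyapunovPoly.evalEval z ν = 0 := by
    rintro z ν ⟨j, rfl⟩
    rw [hall]
    exact Finset.prod_eq_zero (Finset.mem_univ j) (sub_self _)
  have hne : ∀ s, (w s).Nonempty := fun s => by
    rw [← Finset.card_pos, ← hdeg, Nat.pos_iff_ne_zero]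
    intro h0
    exact (hirr s).not_isUnit (by rw [(hmonic s).natDegree_eq_zero.mp h0]; exact isUnit_one)
  have hdiscr : ∀ s, ∃ q : ℂ[X], ∀ z, q.eval z = discrProd Δ (w s) z := fun s =>
    exists_polynomial_discrProd (hmonic s) (heval s)
  refine ⟨τ, Δ, k, w, Φ, fun s => S (Φ s), hτ0, fun z => ?_, hτ, ?_, hne, ?_, fun j => ⟨c j, ?_⟩,
    fun z t ht => ?_, heval, fun s => ?_, fun s z => ?_, fun s => (hS _ (hmonic s) (hirr s)).2.2.1,
    ?_, ?_, hdiscr, ?_, ?_, hasym, fun j => ?_, fun s => ⟨_, rfl, ?_, fun hdist => ⟨?_, ?_⟩⟩⟩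
  · refine J.charpoly_M_eq_prod z (fun j => hτ0 j z) fun ν => ?_
    simp only [← hτ, hall]
  · have hsurj : Function.Surjective c := fun s => by
      obtain ⟨j, hj⟩ := hne s
      exact ⟨j, (hmem j s).mp hj⟩
    simpa using Fintype.card_le_of_surjective c hsurj
  · intro s t hst
    rw [Finset.disjoint_left]
    intro j hj hj'
    exact hst (((hmem j s).mp hj).symm.trans ((hmem j t).mp hj'))
  · exact (hmem _ _).mpr rfl
  · rw [J.D_eq_eval_charpoly, J.eval_charpoly_M z ht, hF,
      mul_div_cancel_left₀ _ (pow_ne_zero _ (mul_ne_zero two_ne_zero ht))]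
  · have h1 := (hS _ (hmonic s) (hirr s)).2.1
    rwa [hdeg] at h1
  · rw [(hS _ (hmonic s) (hirr s)).1]
    ext ν
    simp [hroot]
  · intro k' s i hi j hj hinf
    have h1 : Φ k' = Φ s := by
      by_contra hΦne
      refine hinf ((finite_common_roots (hmonic k') (hmonic s) (hirr k') (hirr s) hΦne).subset ?_)
      intro z hz
      exact ⟨Δ i z, (hroot _ _ _).mpr ⟨i, hi, rfl⟩, (hroot _ _ _).mpr ⟨j, hj, hz.symm⟩⟩
    exact ⟨h1, congrArg S h1⟩
  · intro α β δ hδ hbranch hlt x hx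
    refine J.realOnInterval_lyapunovPoly.deriv_ne_zero_of_real (hδ x hx) ?_ (hlt x hx)
    filter_upwards [isOpen_Ioo.mem_nhds hx] with y hy
    obtain ⟨j, hj⟩ := hbranch y hy
    exact hroot' _ _ ⟨j, hj.symm⟩
  · choose q hq using hdiscr
    exact ⟨∏ s, q s, fun z => by simp only [eval_prod, hq]⟩
  · intro α β hgap x hx
    have hspec : (x : ℂ) ∈ spectrum ℂ J.operator := by
      rcases hx with rfl | rfl
      exacts [hgap.2.1, hgap.2.2.1]
    obtain ⟨d, hd, hd0⟩ := J.mem_spectrum_iff.mp hspec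
    -- the values `1` and `-1` belong to the multipliers `1` and `-1`
    rcases eq_or_ne d 1 with rfl | hd1
    · exact Or.inl (J.isPeriodicEigenvalue_of_evalEval_one (by simpa using hd0))
    rcases eq_or_ne d (-1) with rfl | hd2
    · exact Or.inr (Or.inl (J.isAntiperiodicEigenvalue_of_evalEval_neg_one (by simpa using hd0)))
    rw [hF] at hd0
    obtain ⟨s, -, hs⟩ := Finset.prod_eq_zero_iff.mp hd0
    obtain ⟨himg, -, -, hbr⟩ := hS _ (hmonic s) (hirr s)
    have hbranch : (S (Φ s)).IsBranchPoint x := by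
      -- otherwise a holomorphic branch fills a real neighbourhood of `x` with spectrum
      by_contra hnb
      have hmemd : (d : ℂ) ∈ (S (Φ s)).fn '' (S (Φ s)).fiber x := by
        rw [himg]
        exact hs
      obtain ⟨P, hP, hPd⟩ := hmemd
      obtain ⟨δ, hδ, hδx, hδy⟩ := FunctionOnCover.exists_branch hnb hP
      refine hgap.not_eventually_mem_spectrum hx ?_
      have hδ0 : ∀ᶠ z in 𝓝 (x : ℂ), J.lyapunovPoly.evalEval z (δ z) = 0 := by
        filter_upwards [hδy] with z hz
        rw [himg] at hz
        rw [hF]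
        exact Finset.prod_eq_zero (Finset.mem_univ s) hz
      filter_upwards [J.realOnInterval_lyapunovPoly.eventually_exists hδ hδ0 (hδx.trans hPd)
        ⟨lt_of_le_of_ne hd.1 hd2.symm, lt_of_le_of_ne hd.2 hd1⟩] with y hy
      exact J.mem_spectrum_iff.mpr hy
    refine Or.inr (Or.inr ⟨⟨s, hbranch⟩, Finset.prod_eq_zero (Finset.mem_univ s) ?_⟩)
    exact discrProd_eq_zero_of_not_simpleRootsAt (heval s x) fun h => hbr _ h hbranch
  · exact isBigO_multiplier J.m_pos J.p_pos (hτ1 j) (hτ j) (hasym j)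
  · exact isBigO_discrProd hasym
  · refine div_ne_zero (Finset.prod_ne_zero_iff.mpr fun q hq => ?_) (pow_ne_zero _ two_ne_zero)
    rw [Finset.mem_filter, Finset.mem_product] at hq
    exact pow_ne_zero _ (sub_ne_zero.mpr (hdist _ hq.1.1 _ hq.1.2 hq.2.ne))
  · obtain ⟨q, hq⟩ := hdiscr s
    have h1 := isBigO_discrProd (w := w s) hasym
    simp only [← hq] at h1 ⊢
    exact isBigO_norm_inv_of_polynomial J.m_pos h1
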